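/- Let $K\ge 1$, let $m_1,\dots,m_{2K}>0$ (masses), $0<\zeta_1<\dots<\zeta_K$ and $b_1(0),\dots,b_K(0)>0$. For $1\le k\le 2K$ write $k'=2K+1-k$, for $1\le j\le K$ write $j^*=K+1-j$, and put $e_j=1/m_{j'}^2$, $[i,j]=\{i,i+1,\dots,j\}$, $[1,l]^*=\{j^*: j\in[1,l]\}$, $\mathbf y_I=\prod_{i\in I}y_i$, $$\Delta_{I,J}(\zeta)=\prod_{i\in I}\prod_{j\in J}(\zeta_i-\zeta_j),\qquad \Gamma_{I,J}(\mathbf e;\zeta)=\prod_{i\in I}\prod_{j\in J}(e_i+\zeta_j),$$ empty products being $1$. A *global ordered multipeakon solution* with masses $m_j$ consists of functions $x_1(t)<\dots<x_{2K}(t)$, $t\in\mathbb R$, satisfying the peakon equations of the modified Camassa–Holm equation $m_t+((u^2-u_x^2)m)_x=0$, $m=u-u_{xx}$, for $u=\sum_j m_je^{-|x-x_j(t)|}$ (with $u_x^2m$ read as $\langle u_x^2\rangle m$, where $\langle\cdot\rangle$ is the average of the one-sided limits), that is, $$\dot x_j=2\sum_{k\ne j}m_jm_ke^{-|x_j-x_k|}+4\sum_{1\le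 i<j<k\le 2K}m_im_ke^{-|x_i-x_k|},\qquad 1\le j\le 2K .$$ A configuration $x_1<\dots<x_{2K}$ *has spectral data* $(\zeta_j,b_j)_{1\le j\le K}$ if, with $h_k=m_ke^{x_k}$, $g_k=m_ke^{-x_k}$ and the polynomials $q_k,p_k$ in $z$ given by $q_0=0$, $p_0=1$, $q_k=q_{k-1}+h_kp_{k-1}$, $p_k=p_{k-1}-zg_kq_{k-1}$, one has $q_{2K}(z)/p_{2K}(z)=\sum_{j=1}^K b_j/(\zeta_j-z)$. Suppose that $$\frac{\zeta_K^{\frac{k-1}2}}{\zeta_1^{\frac{k+1}2}}<m_{(k+1)'}m_{k'}\qquad\text{for all odd }k,\ 1\le k\le 2K-1,$$ $$\frac{m_{(k+2)'}m_{(k+1)'}}{(1+m_{(k+1)'}^2\zeta_1)(1+m_{(k+2)'}^2\zeta_1)}<\frac{\zeta_1^{\frac{k+1}2}}{\zeta_K^{\frac{k-1}2}}\,\frac{2\min_j(\zeta_{j+1}-\zeta_j)^{k-1}}{(k+1)(\zeta_K-\zeta_1)^{k+1}}\qquad\text{for all odd }k,\ 1\le k\le 2K-3 .$$ Then there is exactly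 one global ordered multipeakon solution with masses $m_j$ whose configuration at $t=0$ has spectral data $(\zeta_j,b_j(0))$. The position $x_{k'}$ of its $k$-th peakon from the right satisfies, as $t\to+\infty$, for some $\alpha_k>0$ depending on the formula and on $k$: for odd $k$, $1\le k\le 2K-1$, $$x_{k'}=\frac{2t}{\zeta_{\frac{k+1}2}}+\ln\frac{b_{\frac{k+1}2}(0)\,\mathbf e_{[1,k-1]}\,\Delta^2_{[1,\frac{k-1}2],\{\frac{k+1}2\}}(\zeta)}{m_{k'}\,\Gamma_{[1,k],\{\frac{k+1}2\}}(\mathbf e;\zeta)\,\zeta^2_{[1,\frac{k-1}2]}}+O(e^{-\alpha_kt});$$ for even $k$, $2\le k\le 2K$, $$x_{k'}=\frac{2t}{\zeta_{\frac k2}}+\ln\frac{b_{\frac k2}(0)\,\mathbf e_{[1,k-1]}\,\Delta^2_{[1,\frac k2-1],\{\frac k2\}}(\zeta)}{m_{k'}\,\Gamma_{[1,k-1],\{\frac k2\}}(\mathbf e;\zeta)\,\zeta^2_{[1,\frac k2-1]}\,\zeta_{\frac k2}}+O(e^{-\alpha_kt});$$ for odd $k$, $1\le k\le 2K-1$, $$x_{k'}-x_{(k+1)'}=\ln\big(m_{(k+1)'}m_{k'}\zeta_{\frac{k+1}2}\big)+O(e^{-\alpha_kt}).$$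 As $t\to-\infty$ the same three formulas hold with $O(e^{-\alpha_kt})$ replaced by $O(e^{\beta_kt})$ for some $\beta_k>0$, and with each index of $\zeta$ and $b$ reflected: $\zeta_j,b_j(0)$ are replaced by $\zeta_{j^*},b_{j^*}(0)$, so that for instance $\Delta_{[1,l],\{s\}}$, $\Gamma_{[1,k],\{s\}}$, $\zeta_{[1,l]}$ become $\Delta_{[1,l]^*,\{s^*\}}$, $\Gamma_{[1,k],\{s^*\}}$, $\zeta_{[1,l]^*}$ (while $\mathbf e$ and $m$ keep their indices). In particular the peakons form pairs with common asymptotic speed: for $1\le s\le K$ and $k\in\{2s-1,2s\}$, $x_{k'}(t)/t\to 2/\zeta_s$ as $t\to+\infty$ and $x_{k'}(t)/t\to 2/\zeta_{s^*}$ as $t\to-\infty$; and these speeds are sorted: for $1\le s<r\le K$, $2/\zeta_s>2/\zeta_r$ and $2/\zeta_{s^*}<2/\zeta_{r^*}$. -/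

import Mathlib

open Filter Topology Asymptotics

noncomputable section

namespace MCH

/- All families (masses, positions, spectral data) are indexed from `1`, as functions on `ℕ`
of which only the values at `1, …, n` (or `1, …, K`) are used. -/

/-- Reflection of the interval `[1, n]`: `refl n k = n + 1 - k`.  With `n = 2K` this is `k ↦ k'`
(counting peakons from the right), and with `n = K` it is `j ↦ j*`. -/
def refl (n k : ℕ) : ℕ := n + 1 - k

/-! ### Peakon dynamics -/

/-- The right-hand side of the equation for `ẋ_j` in the `n`-peakon system of the modified
Camassa-Holm equation `m_t + ((u² - u_x²) m)_x = 0`, `m = u - u_xx`, for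
`u = ∑ m_j exp (-|x - x_j|)`, `x_1 < ⋯ < x_n`.  It equals `u(x_j)² - ⟨u_x²⟩(x_j)`, where `⟨·⟩` is
the average of the left and right limits. -/
def peakonField (n : ℕ) (m x : ℕ → ℝ) (j : ℕ) : ℝ :=
  2 * ∑ k ∈ (Finset.Icc 1 n).erase j, m j * m k * Real.exp (-|x j - x k|) +
    4 * ∑ i ∈ Finset.Icc 1 (j - 1), ∑ k ∈ Finset.Icc (j + 1) n,
      m i * m k * Real.exp (-|x i - x k|)

/-- `x t k`, `1 ≤ k ≤ n`, are the positions of the peakons of a global (`t ∈ ℝ`) ordered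
`n`-peakon solution with constant masses `m`. -/
structure IsGlobalMultipeakon (n : ℕ) (m : ℕ → ℝ) (x : ℝ → ℕ → ℝ) : Prop where
  ordered : ∀ t, ∀ i j, 1 ≤ i → i < j → j ≤ n → x t i < x t j
  evolves : ∀ t, ∀ j, 1 ≤ j → j ≤ n →
    HasDerivAt (fun s => x s j) (peakonField n m (x t) j) t

/-! ### Spectral data -/

/-- The pair of polynomials `(q_k, p_k)` in the spectral variable `z`, solving
`q_k - q_{k-1} = h_k p_{k-1}`, `p_k - p_{k-1} = - z g_k q_{k-1}`, `q_0 = 0`, `p_0 = 1`, where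
`h_k = m_k exp (x_k)` and `g_k = m_k exp (- x_k)`. -/
def qp (m x : ℕ → ℝ) : ℕ → Polynomial ℝ × Polynomial ℝ
  | 0 => (0, 1)
  | k + 1 =>
    ((qp m x k).1 + Polynomial.C (m (k + 1) * Real.exp (x (k + 1))) * (qp m x k).2,
      (qp m x k).2 -
        Polynomial.X * Polynomial.C (m (k + 1) * Real.exp (-x (k + 1))) * (qp m x k).1)

/-- The Weyl function `W(z) = q_n(z) / p_n(z)`, a rational function of `z`
(`p_n` is not the zero polynomial, as `p_n(0) = 1`). -/
def weyl (n : ℕ) (m x : ℕ → ℝ) : RatFunc ℝ :=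
  algebraMap (Polynomial ℝ) (RatFunc ℝ) (qp m x n).1 /
    algebraMap (Polynomial ℝ) (RatFunc ℝ) (qp m x n).2

/-- The configuration of `n = 2K` peakons with masses `m` and positions `x` has eigenvalues
`ζ_1, …, ζ_K` and residues `b_1, …, b_K`: its Weyl function is `∑ b_j / (ζ_j - z)`. -/
def HasSpectralData (K : ℕ) (m x ζ b : ℕ → ℝ) : Prop :=
  weyl (2 * K) m x =
    ∑ j ∈ Finset.Icc 1 K, RatFunc.C (b j) / (RatFunc.C (ζ j) - RatFunc.X)

/-! ### The sufficient condition for global existence -/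

/-- The smallest gap `min_j (ζ_{j+1} - ζ_j)`, `1 ≤ j ≤ K - 1` (used for `2 ≤ K` only). -/
def minGap (K : ℕ) (ζ : ℕ → ℝ) : ℝ :=
  sInf ((fun j => ζ (j + 1) - ζ j) '' Set.Icc 1 (K - 1))

/-- The condition on the `2K` masses, relative to the eigenvalues `ζ_1 < ⋯ < ζ_K`, which
guarantees global existence. -/
structure MassCondition (K : ℕ) (m ζ : ℕ → ℝ) : Prop where
  lower : ∀ k, Odd k → k + 1 ≤ 2 * K →
    ζ K ^ ((k - 1) / 2) / ζ 1 ^ ((k + 1) / 2) < m (refl (2 * K) (k + 1)) * m (refl (2 * K) k)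
  upper : ∀ k, Odd k → k + 3 ≤ 2 * K →
    m (refl (2 * K) (k + 2)) * m (refl (2 * K) (k + 1)) /
        ((1 + m (refl (2 * K) (k + 1)) ^ 2 * ζ 1) * (1 + m (refl (2 * K) (k + 2)) ^ 2 * ζ 1)) <
      ζ 1 ^ ((k + 1) / 2) / ζ K ^ ((k - 1) / 2) *
        (2 * minGap K ζ ^ (k - 1) / (((k : ℝ) + 1) * (ζ K - ζ 1) ^ (k + 1)))

/-! ### Asymptotic positions -/

/-- `Δ_{I,J}(x;y) = ∏_{i ∈ I} ∏_{j ∈ J} (x_i - y_j)`. -/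
def Delta (I J : Finset ℕ) (x y : ℕ → ℝ) : ℝ := ∏ i ∈ I, ∏ j ∈ J, (x i - y j)

/-- `Γ_{I,J}(x;y) = ∏_{i ∈ I} ∏_{j ∈ J} (x_i + y_j)`. -/
def Gamma (I J : Finset ℕ) (x y : ℕ → ℝ) : ℝ := ∏ i ∈ I, ∏ j ∈ J, (x i + y j)

/-- `e_j = 1 / m_{j'}²`. -/
def e (n : ℕ) (m : ℕ → ℝ) (j : ℕ) : ℝ := 1 / m (refl n j) ^ 2

/-- The constant term of the asymptotic position of the `k`-th peakon from the right, `k` odd. -/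
def shiftOdd (n : ℕ) (m ζ b : ℕ → ℝ) (k : ℕ) : ℝ :=
  Real.log
    ((b ((k + 1) / 2) * (∏ i ∈ Finset.Icc 1 (k - 1), e n m i) *
        Delta (Finset.Icc 1 ((k - 1) / 2)) {(k + 1) / 2} ζ ζ ^ 2) /
      (m (refl n k) * Gamma (Finset.Icc 1 k) {(k + 1) / 2} (e n m) ζ *
        (∏ i ∈ Finset.Icc 1 ((k - 1) / 2), ζ i) ^ 2))

/-- The constant term of the asymptotic position of the `k`-th peakon from the right, `k` even. -/
def shiftEven (n : ℕ) (m ζ b : ℕ → ℝ) (k : ℕ) : ℝ :=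
  Real.log
    ((b (k / 2) * (∏ i ∈ Finset.Icc 1 (k - 1), e n m i) *
        Delta (Finset.Icc 1 (k / 2 - 1)) {k / 2} ζ ζ ^ 2) /
      (m (refl n k) * Gamma (Finset.Icc 1 (k - 1)) {k / 2} (e n m) ζ *
        (∏ i ∈ Finset.Icc 1 (k / 2 - 1), ζ i) ^ 2 * ζ (k / 2)))

/-- The asymptotic formulas for the positions `x t k` of `n` peakons along the filter `l`
(`t → +∞` or `t → -∞`), in terms of spectral data `ζ`, `b` listed in the order in which they
become dominant.  The error is `O(exp (-α |t|))` for some `α > 0`, which may depend on `k`. -/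
structure HasAsymptotics (n : ℕ) (m ζ b : ℕ → ℝ) (x : ℝ → ℕ → ℝ) (l : Filter ℝ) : Prop where
  odd : ∀ k, Odd k → k ≤ n → ∃ α : ℝ, 0 < α ∧
    (fun t => x t (refl n k) - (2 * t / ζ ((k + 1) / 2) + shiftOdd n m ζ b k))
      =O[l] fun t => Real.exp (-α * |t|)
  even : ∀ k, Even k → 1 ≤ k → k ≤ n → ∃ α : ℝ, 0 < α ∧
    (fun t => x t (refl n k) - (2 * t / ζ (k / 2) + shiftEven n m ζ b k))
      =O[l] fun t => Real.exp (-α * |t|)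
  pairs : ∀ k, Odd k → k + 1 ≤ n → ∃ α : ℝ, 0 < α ∧
    (fun t => x t (refl n k) - x t (refl n (k + 1)) -
        Real.log (m (refl n (k + 1)) * m (refl n k) * ζ ((k + 1) / 2)))
      =O[l] fun t => Real.exp (-α * |t|)

end MCH

end

/-! The step from `(q_{k-1}, p_{k-1})` to `(q_k, p_k)` is linear with determinant `1 + z m_k²`, so a
configuration is a product of elementary factors. The inverse problem is to peel these off the Weyl
function. At `z = -1/m_n²` the last factor is singular, which forces `q_n/p_n = m_n exp x_n` there;
hence the Weyl function and the masses determine every position (`eq_of_qp_cross_eq`).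

Existence is explicit. At the nodes `ζ_j`, the values of `q_{2K-k}` and `p_{2K-k}` are, up to common
factors, values of orthogonal polynomials for the discrete weights `wt k` and `ζ · wt k`. Passing
between `k` and `k+1` multiplies the weight by `ζ + e_{k+1}`, a Christoffel transformation, and the
two resulting relations (`heinePoly_step_fst`, `heinePoly_step_snd`) are the inverted recurrence.
Vanishing of the right side of the first relation at `-e_{k+1}` gives `momentum` as a quotient of
Hankel determinants, all positive in Heine's form as sums over subsets. So `position` exists for all
positive data, whether or not it is ordered.

For the dynamics, the field is written without absolute values (`orderedField`), which agrees with
the peakon field on ordered configurations. The Lax pair keeps the eigenvalues and gives `b_j(t) =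
b_j exp(2t/ζ_j)`. A local solution through `position` has this evolving data, so by uniqueness it is
`position` at the evolved residues; this proves that the formula solves the equations, without
differentiating determinants. The same argument gives uniqueness of the global solution.

The mass condition is used only for ordering. Ratios of neighbouring momenta are ratios of Heine
sums, bounded by comparing products of nodes (odd neighbours) or by moving one node between two
subsets (even neighbours, `heineSum_exchange`). These bounds do not involve the residues beyond
positivity, hence hold at all times.

For the asymptotics, each Heine sum becomes a sum of exponentials in `t` in which one subset
dominates, the first `d` nodes as `t → +∞`. The case `t → -∞` is the same statement for the reversed
list of nodes, which has the same Weyl function. -/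

noncomputable section

namespace MCH

/-! ### Heine sums and orthogonal polynomials of discrete measures -/

/-- The squared Vandermonde product of the nodes `ζ_j`, `j ∈ J`. -/
def vdmSq (ζ : ℕ → ℝ) (J : Finset ℕ) : ℝ := ∏ i ∈ J, ∏ j ∈ J.erase i, |ζ i - ζ j|

/-- The Heine sum: the Hankel determinant of order `d` of the discrete measure with
nodes `ζ_j` and weights `w_j`, `j ∈ S`. -/
def heineSum (S : Finset ℕ) (ζ w : ℕ → ℝ) (d : ℕ) : ℝ :=
  ∑ J ∈ S.powersetCard d, vdmSq ζ J * ∏ j ∈ J, w j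

/-- The (unnormalized) orthogonal polynomial of degree `d` of the discrete measure with
nodes `ζ_j` and weights `w_j`, `j ∈ S`. -/
def heinePoly (S : Finset ℕ) (ζ w : ℕ → ℝ) (d : ℕ) : Polynomial ℝ :=
  ∑ J ∈ S.powersetCard d, Polynomial.C (vdmSq ζ J * ∏ j ∈ J, w j) *
    ∏ j ∈ J, (Polynomial.C (ζ j) - Polynomial.X)

lemma vdmSq_insert (ζ : ℕ → ℝ) {i : ℕ} {J : Finset ℕ} (hi : i ∉ J) :
    vdmSq ζ (insert i J) = vdmSq ζ J * ∏ j ∈ J, (ζ j - ζ i) ^ 2 := by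
  unfold vdmSq
  rw [Finset.prod_insert hi, Finset.erase_insert hi]
  have : ∀ k ∈ J, ∏ j ∈ (insert i J).erase k, |ζ k - ζ j| =
      |ζ k - ζ i| * ∏ j ∈ J.erase k, |ζ k - ζ j| := by
    intro k hk
    have hki : i ≠ k := fun h => hi (h ▸ hk)
    rw [Finset.erase_insert_of_ne hki,
      Finset.prod_insert (fun h => hi (Finset.mem_of_mem_erase h))]
  rw [Finset.prod_congr rfl this, Finset.prod_mul_distrib, ← mul_assoc, mul_comm,
    ← Finset.prod_mul_distrib]
  congr 1
  refine Finset.prod_congr rfl fun j _ => ?_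
  rw [abs_sub_comm (ζ i), ← sq, sq_abs]

lemma vdmSq_pos {ζ : ℕ → ℝ} {S J : Finset ℕ} (hζ : Set.InjOn ζ S) (hJ : J ⊆ S) :
    0 < vdmSq ζ J := by
  refine Finset.prod_pos fun i hi => Finset.prod_pos fun j hj => ?_
  rw [Finset.mem_erase] at hj
  exact abs_pos.2 (sub_ne_zero.2 fun h => hj.1 (hζ (hJ hj.2) (hJ hi) h.symm))

lemma heineSum_pos {S : Finset ℕ} {ζ w : ℕ → ℝ} {d : ℕ} (hζ : Set.InjOn ζ S)
    (hw : ∀ j ∈ S, 0 < w j) (hd : d ≤ S.card) : 0 < heineSum S ζ w d := by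
  refine Finset.sum_pos (fun J hJ => ?_) (Finset.powersetCard_nonempty.2 hd)
  rw [Finset.mem_powersetCard] at hJ
  exact mul_pos (vdmSq_pos hζ hJ.1) (Finset.prod_pos fun j hj => hw j (hJ.1 hj))

/-- The factors are `ζ_j - X`, not `X - ζ_j`, so values at `0` and at `-c` are again Heine sums,
with weights `ζ w` and `(ζ + c) w` and no signs. -/
lemma eval_heinePoly (S : Finset ℕ) (ζ w : ℕ → ℝ) (d : ℕ) (z : ℝ) :
    (heinePoly S ζ w d).eval z = heineSum S ζ (fun j => (ζ j - z) * w j) d := by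
  simp only [heinePoly, heineSum, Polynomial.eval_finsetSum, Polynomial.eval_mul,
    Polynomial.eval_C, Polynomial.eval_prod, Polynomial.eval_sub, Polynomial.eval_X,
    Finset.prod_mul_distrib]
  exact Finset.sum_congr rfl fun J _ => by ring

lemma natDegree_heinePoly_le (S : Finset ℕ) (ζ w : ℕ → ℝ) (d : ℕ) :
    (heinePoly S ζ w d).natDegree ≤ d := by
  refine Polynomial.natDegree_sum_le_of_forall_le _ _ fun J hJ => ?_
  rw [Finset.mem_powersetCard] at hJ
  refine (Polynomial.natDegree_C_mul_le _ _).trans ((Polynomial.natDegree_prod_le _ _).trans ?_)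
  rw [← hJ.2, Finset.card_eq_sum_ones]
  refine Finset.sum_le_sum fun j _ => ?_
  exact (Polynomial.natDegree_sub_le _ _).trans (by simp)

/-- A pair `(J, i)` with `i ∉ J` is the same as a set `L = J ∪ {i}` with a marked element; the pairs
with `i ∈ J` contribute zero. -/
lemma sum_sum_powersetCard (S : Finset ℕ) (d : ℕ) (F : ℕ → Finset ℕ → ℝ)
    (hF : ∀ J, ∀ i ∈ J, F i J = 0) :
    ∑ i ∈ S, ∑ J ∈ S.powersetCard d, F i J =
      ∑ L ∈ S.powersetCard (d + 1), ∑ i ∈ L, F i (L.erase i) := by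
  have h1 : ∀ J ∈ S.powersetCard d, ∑ i ∈ S, F i J = ∑ i ∈ S \ J, F i J := by
    intro J hJ
    refine (Finset.sum_subset Finset.sdiff_subset fun i hi hi' => hF J i ?_).symm
    by_contra h
    exact hi' (Finset.mem_sdiff.2 ⟨hi, h⟩)
  rw [Finset.sum_comm, Finset.sum_congr rfl h1, Finset.sum_sigma', Finset.sum_sigma']
  refine Finset.sum_bij' (fun p _ => ⟨insert p.2 p.1, p.2⟩) (fun p _ => ⟨p.1.erase p.2, p.2⟩)
    ?_ ?_ ?_ ?_ ?_
  · rintro ⟨J, i⟩ h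
    simp only [Finset.mem_sigma, Finset.mem_powersetCard, Finset.mem_sdiff] at h ⊢
    refine ⟨⟨Finset.insert_subset h.2.1 h.1.1, ?_⟩, Finset.mem_insert_self _ _⟩
    rw [Finset.card_insert_of_notMem h.2.2, h.1.2]
  · rintro ⟨L, i⟩ h
    simp only [Finset.mem_sigma, Finset.mem_powersetCard, Finset.mem_sdiff] at h ⊢
    refine ⟨⟨(Finset.erase_subset _ _).trans h.1.1, ?_⟩, h.1.1 h.2, Finset.notMem_erase _ _⟩
    rw [Finset.card_erase_of_mem h.2, h.1.2]; rfl
  · rintro ⟨J, i⟩ h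
    simp only [Finset.mem_sigma, Finset.mem_sdiff] at h
    simp [Finset.erase_insert h.2.2]
  · rintro ⟨L, i⟩ h
    simp only [Finset.mem_sigma] at h
    simp [Finset.insert_erase h.2]
  · rintro ⟨J, i⟩ h
    simp only [Finset.mem_sigma, Finset.mem_sdiff] at h
    simp [Finset.erase_insert h.2.2]

/-- Removing `i` divides the squared Vandermonde by the square of the product on the left. The
single factor left in the denominator is the one in Lagrange interpolation. -/
lemma vdmSq_erase_mul_prod {S L : Finset ℕ} {ζ : ℕ → ℝ} (hζ : Set.InjOn ζ S) (hL : L ⊆ S)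
    {i : ℕ} (hi : i ∈ L) :
    vdmSq ζ (L.erase i) * ∏ j ∈ L.erase i, (ζ j - ζ i) =
      vdmSq ζ L / ∏ j ∈ L.erase i, (ζ j - ζ i) := by
  have h0 : ∏ j ∈ L.erase i, (ζ j - ζ i) ≠ 0 := by
    refine Finset.prod_ne_zero_iff.2 fun j hj => sub_ne_zero.2 fun h => ?_
    rw [Finset.mem_erase] at hj
    exact hj.1 (hζ (hL hj.2) (hL hi) h)
  rw [eq_div_iff h0]
  conv_rhs => rw [← Finset.insert_erase hi, vdmSq_insert ζ (Finset.notMem_erase i L)]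
  rw [Finset.prod_pow]; ring

/-- Turns a sum against the polynomial into interpolation sums over the `(d+1)`-subsets `L`, which
the next two lemmas evaluate. -/
lemma sum_mul_eval_heinePoly {S : Finset ℕ} {ζ : ℕ → ℝ} (hζ : Set.InjOn ζ S) (w φ : ℕ → ℝ)
    (d : ℕ) :
    ∑ i ∈ S, φ i * (heinePoly S ζ w d).eval (ζ i) =
      ∑ L ∈ S.powersetCard (d + 1), vdmSq ζ L *
        ∑ i ∈ L, φ i * (∏ j ∈ L.erase i, w j) / ∏ j ∈ L.erase i, (ζ j - ζ i) := by
  simp only [eval_heinePoly, heineSum, Finset.mul_sum]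
  rw [sum_sum_powersetCard]
  · refine Finset.sum_congr rfl fun L hL => Finset.sum_congr rfl fun i hi => ?_
    rw [Finset.mem_powersetCard] at hL
    have := vdmSq_erase_mul_prod hζ hL.1 hi
    rw [Finset.prod_mul_distrib]
    calc _ = φ i * (∏ j ∈ L.erase i, w j) *
          (vdmSq ζ (L.erase i) * ∏ j ∈ L.erase i, (ζ j - ζ i)) := by ring
      _ = _ := by rw [this]; ring
  · intro J i hi
    rw [Finset.prod_eq_zero hi (by simp)]; ring

/-- Orthogonality to polynomials of lower degree. -/
lemma sum_heinePoly_orthogonal {S : Finset ℕ} {ζ : ℕ → ℝ} (hζ : Set.InjOn ζ S) (w : ℕ → ℝ)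
    {d : ℕ} {r : Polynomial ℝ} (hr : r.degree < d) :
    ∑ i ∈ S, w i * (heinePoly S ζ w d).eval (ζ i) * r.eval (ζ i) = 0 := by
  have := sum_mul_eval_heinePoly hζ w (fun i => w i * r.eval (ζ i)) d
  rw [Finset.sum_congr rfl (g := fun i => w i * r.eval (ζ i) * (heinePoly S ζ w d).eval (ζ i))
    (fun i _ => by ring), this]
  refine Finset.sum_eq_zero fun L hL => ?_
  rw [Finset.mem_powersetCard] at hL
  -- The inner sum over `L` is, up to sign and weights, the divided difference of `r` on `d + 1`
  -- nodes, i.e. its coefficient of degree `d`, which is zero.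
  have hc := Lagrange.coeff_eq_sum (s := L) (v := ζ) (hζ.mono (by exact_mod_cast hL.1))
    (P := r) (hr.trans (by rw [hL.2]; exact_mod_cast Nat.lt_succ_self d))
  rw [hL.2, Nat.add_sub_cancel, Polynomial.coeff_eq_zero_of_degree_lt hr] at hc
  have h2 : ∀ i ∈ L, w i * r.eval (ζ i) * (∏ j ∈ L.erase i, w j) / ∏ j ∈ L.erase i, (ζ j - ζ i)
      = ((∏ j ∈ L, w j) * (-1) ^ d) * (r.eval (ζ i) / ∏ j ∈ L.erase i, (ζ i - ζ j)) := by
    intro i hi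
    have h3 : ∏ j ∈ L.erase i, (ζ j - ζ i) = (-1) ^ d * ∏ j ∈ L.erase i, (ζ i - ζ j) := by
      rw [← Nat.add_sub_cancel (n := d) (m := 1), ← hL.2, ← Finset.card_erase_of_mem hi,
        ← Finset.prod_const, ← Finset.prod_mul_distrib]
      exact Finset.prod_congr rfl fun j _ => by ring
    rw [h3, ← Finset.mul_prod_erase L w hi, mul_comm ((-1 : ℝ) ^ d), ← div_div]
    rcases Nat.even_or_odd d with h | h
    · rw [h.neg_one_pow]; ring
    · rw [h.neg_one_pow]; ring
  rw [Finset.sum_congr rfl h2, ← Finset.mul_sum, ← hc]; ring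

/-- Here the inner sum over `L` is the value at `0` of the sum of all Lagrange basis polynomials,
which is `1`. -/
lemma sum_heinePoly_mul_node {S : Finset ℕ} {ζ : ℕ → ℝ} (hζ : Set.InjOn ζ S) (w : ℕ → ℝ)
    (d : ℕ) :
    ∑ i ∈ S, w i * (heinePoly S ζ (fun j => ζ j * w j) d).eval (ζ i) = heineSum S ζ w (d + 1) := by
  rw [sum_mul_eval_heinePoly hζ]
  refine Finset.sum_congr rfl fun L hL => ?_
  rw [Finset.mem_powersetCard] at hL
  have hne : L.Nonempty := Finset.card_pos.1 (by omega)
  have hinj : Set.InjOn ζ L := hζ.mono (by exact_mod_cast hL.1)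
  have h1 := congrArg (Polynomial.eval 0) (Lagrange.sum_basis hinj hne)
  rw [Polynomial.eval_finsetSum, Polynomial.eval_one] at h1
  have h2 : ∀ i ∈ L, w i * (∏ j ∈ L.erase i, ζ j * w j) / ∏ j ∈ L.erase i, (ζ j - ζ i)
      = (∏ j ∈ L, w j) * (Lagrange.basis L ζ i).eval 0 := by
    intro i hi
    rw [Finset.prod_mul_distrib, ← Finset.mul_prod_erase L w hi, Lagrange.basis,
      Polynomial.eval_prod]
    have : ∀ j ∈ L.erase i, (Lagrange.basisDivisor (ζ i) (ζ j)).eval 0 = ζ j / (ζ j - ζ i) := by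
      intro j hj
      simp only [Lagrange.basisDivisor, Polynomial.eval_mul, Polynomial.eval_C,
        Polynomial.eval_sub, Polynomial.eval_X]
      rw [← neg_sub (ζ j), inv_neg]; ring
    rw [Finset.prod_congr rfl this, Finset.prod_div_distrib]; ring
  rw [Finset.sum_congr rfl h2, ← Finset.mul_sum, h1, mul_one]

/-! ### Uniqueness of orthogonal polynomials on the nodes -/

lemma eq_zero_of_sum_mul_sq_eq_zero {S : Finset ℕ} {w f : ℕ → ℝ} (hw : ∀ j ∈ S, 0 < w j)
    (h : ∑ i ∈ S, w i * f i ^ 2 = 0) : ∀ j ∈ S, f j = 0 := by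
  intro j hj
  have := (Finset.sum_eq_zero_iff_of_nonneg
    (fun i hi => mul_nonneg (hw i hi).le (sq_nonneg (f i)))).1 h j hj
  simpa [(hw j hj).ne'] using this

lemma degree_divX_lt_of_natDegree_le {y : Polynomial ℝ} {D : ℕ} (hD : y.natDegree ≤ D) :
    y.divX.degree < D ∨ D = 0 ∧ y.divX = 0 := by
  by_cases h : y.divX = 0
  · rcases Nat.eq_zero_or_pos D with h0 | h0
    · exact Or.inr ⟨h0, h⟩
    · left; rw [h, Polynomial.degree_zero]; exact WithBot.bot_lt_coe _
  · left
    have hy : 0 < y.natDegree := by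
      by_contra h0
      rw [Polynomial.eq_C_of_natDegree_eq_zero (Nat.eq_zero_of_not_pos h0)] at h
      simp at h
    rw [Polynomial.degree_eq_natDegree h, Polynomial.natDegree_divX_eq_natDegree_tsub_one]
    exact_mod_cast (by omega : y.natDegree - 1 < D)

lemma eval_eq_divX (y : Polynomial ℝ) (z : ℝ) :
    y.eval z = z * y.divX.eval z + y.eval 0 := by
  conv_lhs => rw [← Polynomial.divX_mul_X_add y]
  simp [Polynomial.coeff_zero_eq_eval_zero]; ring

/-- Since `y = z y₁`, testing against `y₁` gives `∑ ζ w y₁² = 0`, a sum of nonnegative terms. Only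
vanishing at the nodes follows, which suffices and also covers degrees up to the number of nodes. -/
lemma eval_node_eq_zero_of_orthogonal {S : Finset ℕ} {ζ w : ℕ → ℝ} (hpos : ∀ j ∈ S, 0 < ζ j)
    (hw : ∀ j ∈ S, 0 < w j) {y : Polynomial ℝ} {D : ℕ} (hD : y.natDegree ≤ D)
    (h0 : y.eval 0 = 0)
    (horth : ∀ r : Polynomial ℝ, r.degree < D → ∑ i ∈ S, w i * y.eval (ζ i) * r.eval (ζ i) = 0) :
    ∀ j ∈ S, y.eval (ζ j) = 0 := by
  have hy : ∀ z, y.eval z = z * y.divX.eval z := fun z => by rw [eval_eq_divX, h0, add_zero]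
  rcases degree_divX_lt_of_natDegree_le hD with h | ⟨_, h⟩
  · have h1 := horth _ h
    have h2 := eq_zero_of_sum_mul_sq_eq_zero (S := S) (w := fun i => w i * ζ i)
      (f := fun i => y.divX.eval (ζ i)) (fun j hj => mul_pos (hw j hj) (hpos j hj))
      (by rw [← h1]; exact Finset.sum_congr rfl fun i _ => by rw [hy (ζ i)]; ring)
    intro j hj
    rw [hy, h2 j hj, mul_zero]
  · intro j _
    rw [hy, h]; simp

/-- Writing `y = z y₁ + y(0)` splits `∑ w y²` into the orthogonality relation against `y₁` and
`y(0)` times the zero mean. This is the variant for the weight `ζ w`, normalized by a mean instead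
of a value at `0`. -/
lemma eval_node_eq_zero_of_orthogonal' {S : Finset ℕ} {ζ w : ℕ → ℝ}
    (hw : ∀ j ∈ S, 0 < w j) {y : Polynomial ℝ} {D : ℕ} (hD : y.natDegree ≤ D)
    (h1 : ∑ i ∈ S, w i * y.eval (ζ i) = 0)
    (horth : ∀ r : Polynomial ℝ, r.degree < D →
      ∑ i ∈ S, ζ i * w i * y.eval (ζ i) * r.eval (ζ i) = 0) :
    ∀ j ∈ S, y.eval (ζ j) = 0 := by
  refine eq_zero_of_sum_mul_sq_eq_zero hw ?_
  have h2 : ∑ i ∈ S, ζ i * w i * y.eval (ζ i) * y.divX.eval (ζ i) = 0 := by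
    rcases degree_divX_lt_of_natDegree_le hD with h | ⟨_, h⟩
    · exact horth _ h
    · simp [h]
  calc ∑ i ∈ S, w i * y.eval (ζ i) ^ 2
      = ∑ i ∈ S, ζ i * w i * y.eval (ζ i) * y.divX.eval (ζ i)
        + y.eval 0 * ∑ i ∈ S, w i * y.eval (ζ i) := by
        rw [Finset.mul_sum, ← Finset.sum_add_distrib]
        refine Finset.sum_congr rfl fun i _ => ?_
        have := eval_eq_divX y (ζ i)
        linear_combination w i * y.eval (ζ i) * this
    _ = 0 := by rw [h1, h2]; ring

lemma exists_eval_eq_add_mul {F : Polynomial ℝ} {c : ℝ} {D : ℕ} (hF : F.eval (-c) = 0)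
    (hD : F.natDegree ≤ D + 1) :
    ∃ f : Polynomial ℝ, f.natDegree ≤ D ∧ ∀ z, F.eval z = (z + c) * f.eval z := by
  refine ⟨F /ₘ (Polynomial.X - Polynomial.C (-c)), ?_, fun z => ?_⟩
  · rw [Polynomial.natDegree_divByMonic _ (Polynomial.monic_X_sub_C _),
      Polynomial.natDegree_X_sub_C]
    omega
  · have := congrArg (Polynomial.eval z) (Polynomial.mul_divByMonic_eq_iff_isRoot.2 hF)
    rw [← this]
    simp

lemma natDegree_sub_le_of_both {p q : Polynomial ℝ} {n : ℕ} (hp : p.natDegree ≤ n)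
    (hq : q.natDegree ≤ n) : (p - q).natDegree ≤ n :=
  (Polynomial.natDegree_sub_le _ _).trans (max_le hp hq)

lemma natDegree_C_mul_heinePoly_le (a : ℝ) (S : Finset ℕ) (ζ w : ℕ → ℝ) (d : ℕ) :
    (Polynomial.C a * heinePoly S ζ w d).natDegree ≤ d :=
  (Polynomial.natDegree_C_mul_le _ _).trans (natDegree_heinePoly_le _ _ _ _)

lemma sum_heinePoly_node_orthogonal {S : Finset ℕ} {ζ : ℕ → ℝ} (hζ : Set.InjOn ζ S) (w : ℕ → ℝ)
    {d : ℕ} {r : Polynomial ℝ} (hr : r.degree < d) :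
    ∑ i ∈ S, w i * (heinePoly S ζ (fun j => ζ j * w j) d).eval (ζ i) * (ζ i * r.eval (ζ i)) = 0 := by
  rw [← sum_heinePoly_orthogonal hζ (fun j => ζ j * w j) hr]
  exact Finset.sum_congr rfl fun i _ => by ring

lemma sum_heinePoly_eq_zero {S : Finset ℕ} {ζ : ℕ → ℝ} (hζ : Set.InjOn ζ S) (w : ℕ → ℝ)
    {d : ℕ} (hd : 1 ≤ d) : ∑ i ∈ S, w i * (heinePoly S ζ w d).eval (ζ i) = 0 := by
  have := sum_heinePoly_orthogonal hζ w (d := d) (r := 1)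
    (by rw [Polynomial.degree_one]; exact_mod_cast hd)
  simpa using this

/-- Dividing the right side by `1 + z/c` leaves a polynomial of degree at most `D` that is
orthogonal for `w'` to lower degrees and equals `1` at `0`. The normalized polynomial on the left
has the same properties, so both agree on the nodes. -/
lemma heinePoly_step_fst {S : Finset ℕ} {ζ w w' : ℕ → ℝ} {c : ℝ} {d D : ℕ}
    (hζ : Set.InjOn ζ S) (hpos : ∀ j ∈ S, 0 < ζ j) (hw : ∀ j ∈ S, 0 < w j) (hc : 0 < c)
    (hw' : ∀ j, w' j = (ζ j + c) * w j) (hDd : D ≤ d) (hdD : d ≤ D + 1) (hd : d ≤ S.card)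
    (hD : D ≤ S.card) :
    ∀ j ∈ S, (1 + ζ j / c) * ((heinePoly S ζ w' D).eval (ζ j) / heineSum S ζ (fun j => ζ j * w' j) D)
      = (heinePoly S ζ w d).eval (ζ j) / heineSum S ζ (fun j => ζ j * w j) d +
        heineSum S ζ w' d / (heineSum S ζ (fun j => ζ j * w j) d *
          (c * heineSum S ζ (fun j => ζ j * w' j) D)) *
        (ζ j * (heinePoly S ζ (fun j => ζ j * w j) D).eval (ζ j)) := by
  have hw'pos : ∀ j ∈ S, 0 < w' j := fun j hj => by
    rw [hw']; exact mul_pos (add_pos (hpos j hj) hc) (hw j hj)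
  have hP0 : 0 < heineSum S ζ (fun j => ζ j * w j) d :=
    heineSum_pos hζ (fun j hj => mul_pos (hpos j hj) (hw j hj)) hd
  have hP'0 : 0 < heineSum S ζ (fun j => ζ j * w' j) D :=
    heineSum_pos hζ (fun j hj => mul_pos (hpos j hj) (hw'pos j hj)) hD
  set p0 := heineSum S ζ (fun j => ζ j * w j) d
  set p0' := heineSum S ζ (fun j => ζ j * w' j) D
  set P := heinePoly S ζ w d with hP
  set Q := heinePoly S ζ (fun j => ζ j * w j) D with hQ
  set P' := heinePoly S ζ w' D with hP'
  -- The coefficient that makes the combination vanish at `-c`, hence divisible by `z + c`.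
  set κ := heineSum S ζ w' d / (p0 * (c * p0'))
  have e1 : P.eval 0 = p0 := by rw [hP, eval_heinePoly]; simp only [sub_zero]; rfl
  have e2 : P'.eval 0 = p0' := by rw [hP', eval_heinePoly]; simp only [sub_zero]; rfl
  have e3 : P.eval (-c) = heineSum S ζ w' d := by
    rw [hP, eval_heinePoly]; simp only [sub_neg_eq_add, ← hw']
  have e4 : Q.eval (-c) = p0' := by
    rw [hQ, eval_heinePoly]
    simp only [sub_neg_eq_add, p0', hw']
    congr 1; funext j; ring
  obtain ⟨f, hfd, hf⟩ := exists_eval_eq_add_mul (F := Polynomial.C (1 / p0) * P +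
    Polynomial.C κ * (Polynomial.X * Q)) (c := c) (D := D) (by
      simp only [Polynomial.eval_add, Polynomial.eval_mul, Polynomial.eval_C, Polynomial.eval_X,
        e3, e4, κ]
      field_simp; ring) (by
      refine Polynomial.natDegree_add_le_of_degree_le
        ((natDegree_C_mul_heinePoly_le _ _ _ _ _).trans hdD) ?_
      refine (Polynomial.natDegree_C_mul_le _ _).trans (Polynomial.natDegree_mul_le.trans ?_)
      have : Q.natDegree ≤ D := natDegree_heinePoly_le S ζ (fun j => ζ j * w j) D
      rw [Polynomial.natDegree_X]; omega)
  simp only [Polynomial.eval_add, Polynomial.eval_mul, Polynomial.eval_C, Polynomial.eval_X] at hf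
  have key := eval_node_eq_zero_of_orthogonal (y := Polynomial.C c * f - Polynomial.C (1 / p0') * P')
    (D := D) hpos hw'pos
    (natDegree_sub_le_of_both ((Polynomial.natDegree_C_mul_le _ _).trans hfd)
      (natDegree_C_mul_heinePoly_le _ _ _ _ _))
    (by
      have := hf 0
      simp only [Polynomial.eval_sub, Polynomial.eval_mul, Polynomial.eval_C, e2]
      rw [e1, one_div_mul_cancel hP0.ne'] at this
      rw [one_div_mul_cancel hP'0.ne']
      linarith)
    (by
      intro r hr
      have o1 := sum_heinePoly_orthogonal hζ w (d := d) (r := r)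
        (hr.trans_le (by exact_mod_cast hDd))
      have o2 := sum_heinePoly_node_orthogonal hζ w hr
      have o3 := sum_heinePoly_orthogonal hζ w' hr
      have : ∀ i ∈ S, w' i * (Polynomial.C c * f - Polynomial.C (1 / p0') * P').eval (ζ i) *
          r.eval (ζ i) = c / p0 * (w i * P.eval (ζ i) * r.eval (ζ i)) +
          c * κ * (w i * Q.eval (ζ i) * (ζ i * r.eval (ζ i))) -
          1 / p0' * (w' i * P'.eval (ζ i) * r.eval (ζ i)) := by
        intro i _
        simp only [Polynomial.eval_sub, Polynomial.eval_mul, Polynomial.eval_C]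
        have := hf (ζ i)
        have h2 := hw' i
        linear_combination (-(c * w i * r.eval (ζ i))) * this +
          c * f.eval (ζ i) * r.eval (ζ i) * h2
      rw [Finset.sum_congr rfl this, Finset.sum_sub_distrib, Finset.sum_add_distrib,
        ← Finset.mul_sum, ← Finset.mul_sum, ← Finset.mul_sum, o1, o2, o3]
      ring)
  intro j hj
  have h1 := key j hj
  simp only [Polynomial.eval_sub, Polynomial.eval_mul, Polynomial.eval_C] at h1
  have h2 := hf (ζ j)
  have h3 : P'.eval (ζ j) / p0' = c * f.eval (ζ j) := by
    rw [div_eq_mul_one_div, mul_comm]; linarith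
  rw [h3, div_eq_mul_one_div (P.eval _), mul_comm (P.eval _), h2]
  field_simp; ring

/-- Companion of `heinePoly_step_fst` for the weight `ζ w`: the quotient by `z + c` is characterized
by orthogonality for `ζ w'` and by having mean `1` for `w'`. The mean is available because `P` has
mean zero for `w`. -/
lemma heinePoly_step_snd {S : Finset ℕ} {ζ w w' : ℕ → ℝ} {c : ℝ} {d D : ℕ}
    (hζ : Set.InjOn ζ S) (hpos : ∀ j ∈ S, 0 < ζ j) (hw : ∀ j ∈ S, 0 < w j) (hc : 0 < c)
    (hw' : ∀ j, w' j = (ζ j + c) * w j) (hDd : D ≤ d + 1) (hdD : d ≤ D) (hd : d + 1 ≤ S.card)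
    (hD : D + 1 ≤ S.card) :
    ∀ j ∈ S, (ζ j + c) * ((heinePoly S ζ (fun j => ζ j * w' j) d).eval (ζ j) /
        heineSum S ζ w' (d + 1))
      = (heinePoly S ζ (fun j => ζ j * w j) D).eval (ζ j) / heineSum S ζ w (D + 1) -
        heineSum S ζ (fun j => ζ j * w' j) D * heineSum S ζ (fun j => ζ j * w j) (d + 1) /
          (heineSum S ζ w (D + 1) * heineSum S ζ w' (d + 1)) *
        ((heinePoly S ζ w (d + 1)).eval (ζ j) / heineSum S ζ (fun j => ζ j * w j) (d + 1)) := by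
  have hw'pos : ∀ j ∈ S, 0 < w' j := fun j hj => by
    rw [hw']; exact mul_pos (add_pos (hpos j hj) hc) (hw j hj)
  have hP0 : 0 < heineSum S ζ (fun j => ζ j * w j) (d + 1) :=
    heineSum_pos hζ (fun j hj => mul_pos (hpos j hj) (hw j hj)) hd
  have ht : 0 < heineSum S ζ w (D + 1) := heineSum_pos hζ hw hD
  have ht' : 0 < heineSum S ζ w' (d + 1) := heineSum_pos hζ hw'pos hd
  set p0 := heineSum S ζ (fun j => ζ j * w j) (d + 1)
  set t := heineSum S ζ w (D + 1) with htd
  set t' := heineSum S ζ w' (d + 1) with htd'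
  set P := heinePoly S ζ w (d + 1) with hP
  set Q := heinePoly S ζ (fun j => ζ j * w j) D with hQ
  set Q' := heinePoly S ζ (fun j => ζ j * w' j) d with hQ'
  set q := heineSum S ζ (fun j => ζ j * w' j) D
  have e3 : P.eval (-c) = t' := by
    rw [hP, eval_heinePoly]; simp only [sub_neg_eq_add, ← hw', htd']
  have e4 : Q.eval (-c) = q := by
    rw [hQ, eval_heinePoly]
    simp only [sub_neg_eq_add, q, hw']
    congr 1; funext j; ring
  obtain ⟨f, hfd, hf⟩ := exists_eval_eq_add_mul (F := Polynomial.C (1 / t) * Q -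
    Polynomial.C (q / (t * t')) * P) (c := c) (D := d) (by
      simp only [Polynomial.eval_sub, Polynomial.eval_mul, Polynomial.eval_C, e3, e4]
      field_simp; ring) (natDegree_sub_le_of_both
        ((natDegree_C_mul_heinePoly_le _ _ _ _ _).trans hDd)
        (natDegree_C_mul_heinePoly_le _ _ _ _ _))
  simp only [Polynomial.eval_sub, Polynomial.eval_mul, Polynomial.eval_C] at hf
  have s1 : ∑ i ∈ S, w i * Q.eval (ζ i) = t := by rw [hQ, htd, sum_heinePoly_mul_node hζ]
  have s2 : ∑ i ∈ S, w' i * Q'.eval (ζ i) = t' := by rw [hQ', htd', sum_heinePoly_mul_node hζ]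
  have s3 : ∑ i ∈ S, w i * P.eval (ζ i) = 0 := sum_heinePoly_eq_zero hζ w (by omega)
  have key := eval_node_eq_zero_of_orthogonal' (ζ := ζ) (y := f - Polynomial.C (1 / t') * Q')
    (D := d) hw'pos
    (natDegree_sub_le_of_both hfd (natDegree_C_mul_heinePoly_le _ _ _ _ _))
    (by
      have : ∀ i ∈ S, w' i * (f - Polynomial.C (1 / t') * Q').eval (ζ i) =
          1 / t * (w i * Q.eval (ζ i)) - q / (t * t') * (w i * P.eval (ζ i)) -
          1 / t' * (w' i * Q'.eval (ζ i)) := by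
        intro i _
        simp only [Polynomial.eval_sub, Polynomial.eval_mul, Polynomial.eval_C]
        have := hf (ζ i)
        have h2 := hw' i
        linear_combination (-(w i)) * this + f.eval (ζ i) * h2
      rw [Finset.sum_congr rfl this, Finset.sum_sub_distrib, Finset.sum_sub_distrib,
        ← Finset.mul_sum, ← Finset.mul_sum, ← Finset.mul_sum, s1, s2, s3]
      field_simp; ring)
    (by
      intro r hr
      -- `P` has degree parameter `d + 1`, so it is orthogonal to `z r` as well; this turns
      -- orthogonality for `w` into orthogonality for `ζ w`.
      have hrX : (Polynomial.X * r).degree < ((d + 1 : ℕ) : WithBot ℕ) := by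
        rcases eq_or_ne r 0 with rfl | h0
        · simp
        · rw [Polynomial.degree_eq_natDegree h0] at hr
          rw [Polynomial.degree_eq_natDegree (mul_ne_zero Polynomial.X_ne_zero h0),
            Polynomial.natDegree_X_mul h0]
          exact_mod_cast Nat.succ_lt_succ (by exact_mod_cast hr)
      have o1 := sum_heinePoly_orthogonal hζ w hrX
      have o2 := sum_heinePoly_node_orthogonal hζ w (d := D) (r := r)
        (hr.trans_le (by exact_mod_cast hdD))
      have o3 := sum_heinePoly_node_orthogonal hζ w' hr
      have : ∀ i ∈ S, ζ i * w' i * (f - Polynomial.C (1 / t') * Q').eval (ζ i) *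
          r.eval (ζ i) = 1 / t * (w i * Q.eval (ζ i) * (ζ i * r.eval (ζ i))) -
          q / (t * t') * (w i * P.eval (ζ i) * (Polynomial.X * r).eval (ζ i)) -
          1 / t' * (w' i * Q'.eval (ζ i) * (ζ i * r.eval (ζ i))) := by
        intro i _
        simp only [Polynomial.eval_sub, Polynomial.eval_mul, Polynomial.eval_C, Polynomial.eval_X]
        have := hf (ζ i)
        have h2 := hw' i
        linear_combination (-(ζ i * w i * r.eval (ζ i))) * this +
          ζ i * f.eval (ζ i) * r.eval (ζ i) * h2
      rw [Finset.sum_congr rfl this, Finset.sum_sub_distrib, Finset.sum_sub_distrib,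
        ← Finset.mul_sum, ← Finset.mul_sum, ← Finset.mul_sum, o1, o2, o3]
      ring)
  intro j hj
  have h1 := key j hj
  simp only [Polynomial.eval_sub, Polynomial.eval_mul, Polynomial.eval_C] at h1
  have h2 := hf (ζ j)
  have h3 : Q'.eval (ζ j) / t' = f.eval (ζ j) := by
    rw [div_eq_mul_one_div, mul_comm]; linarith
  rw [h3, ← h2]
  field_simp

/-! ### Spectral data in terms of values at the eigenvalues -/

/-- A factor `X` enters only when `p` picks up `q`, so two steps raise the degrees by one. The
bounds make `2K` peakons match `K` nodes. -/
lemma qp_coeff_eq_zero (m x : ℕ → ℝ) (i : ℕ) :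
    (∀ l, i ≤ l → (qp m x (2 * i)).1.coeff l = 0) ∧
      ∀ l, i + 1 ≤ l → (qp m x (2 * i)).2.coeff l = 0 := by
  have hstep : ∀ (a : ℝ) (q : Polynomial ℝ) (i : ℕ), (∀ l, i ≤ l → q.coeff l = 0) →
      ∀ l, i + 1 ≤ l → (Polynomial.X * Polynomial.C a * q).coeff l = 0 := by
    intro a q i hq l hl
    obtain ⟨l, rfl⟩ : ∃ l', l = l' + 1 := ⟨l - 1, by omega⟩
    rw [mul_assoc, Polynomial.coeff_X_mul, Polynomial.coeff_C_mul, hq l (by omega), mul_zero]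
  induction i with
  | zero =>
    refine ⟨fun l _ => by simp [qp], fun l hl => ?_⟩
    simp [qp, Polynomial.coeff_one]; omega
  | succ i ih =>
    obtain ⟨hq, hp⟩ := ih
    have hq1 : ∀ l, i + 1 ≤ l → (qp m x (2 * i + 1)).1.coeff l = 0 := by
      intro l hl
      simp only [qp, Polynomial.coeff_add, Polynomial.coeff_C_mul]
      rw [hq l (by omega), hp l hl]; ring
    have hp1 : ∀ l, i + 1 ≤ l → (qp m x (2 * i + 1)).2.coeff l = 0 := by
      intro l hl
      simp only [qp, Polynomial.coeff_sub]
      rw [hstep _ _ i hq l hl, hp l hl]; ring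
    refine ⟨fun l hl => ?_, fun l hl => ?_⟩
    · rw [show 2 * (i + 1) = 2 * i + 1 + 1 by ring, qp]
      simp only [Polynomial.coeff_add, Polynomial.coeff_C_mul]
      rw [hq1 l hl, hp1 l hl]; ring
    · rw [show 2 * (i + 1) = 2 * i + 1 + 1 by ring, qp]
      simp only [Polynomial.coeff_sub]
      rw [hstep _ _ (i + 1) hq1 l hl, hp1 l (by omega)]; ring

lemma qp_eval_zero (m x : ℕ → ℝ) (i : ℕ) : (qp m x i).2.eval 0 = 1 := by
  induction i with
  | zero => simp [qp]
  | succ i ih => simp [qp, ih]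

/-- The polynomial `∏_{i ∈ J} (1 - z / ζ_i)`. -/
def nodePoly (J : Finset ℕ) (ζ : ℕ → ℝ) : Polynomial ℝ :=
  ∏ i ∈ J, (1 - Polynomial.C (1 / ζ i) * Polynomial.X)

lemma eval_nodePoly (J : Finset ℕ) (ζ : ℕ → ℝ) (z : ℝ) :
    (nodePoly J ζ).eval z = ∏ i ∈ J, (1 - z / ζ i) := by
  simp only [nodePoly, Polynomial.eval_prod, Polynomial.eval_sub, Polynomial.eval_one,
    Polynomial.eval_mul, Polynomial.eval_C, Polynomial.eval_X]
  exact Finset.prod_congr rfl fun i _ => by ring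

lemma eval_nodePoly_node {J : Finset ℕ} {ζ : ℕ → ℝ} {j : ℕ} (hj : j ∈ J) (h0 : ζ j ≠ 0) :
    (nodePoly J ζ).eval (ζ j) = 0 := by
  rw [eval_nodePoly]
  exact Finset.prod_eq_zero hj (by rw [div_self h0, sub_self])

lemma natDegree_nodePoly_le (J : Finset ℕ) (ζ : ℕ → ℝ) : (nodePoly J ζ).natDegree ≤ J.card := by
  refine (Polynomial.natDegree_prod_le _ _).trans ?_
  rw [Finset.card_eq_sum_ones]
  refine Finset.sum_le_sum fun j _ => (Polynomial.natDegree_sub_le _ _).trans (max_le ?_ ?_)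
  · simp
  · exact (Polynomial.natDegree_C_mul_le _ _).trans (by simp)

/-- The numerator over the denominator `nodePoly S ζ` of `∑ b_j / (ζ_j - z)`. -/
def residuePoly (S : Finset ℕ) (ζ b : ℕ → ℝ) : Polynomial ℝ :=
  ∑ j ∈ S, Polynomial.C (b j / ζ j) * nodePoly (S.erase j) ζ

lemma eval_residuePoly_node {S : Finset ℕ} {ζ b : ℕ → ℝ} {j : ℕ} (hj : j ∈ S) (h0 : ζ j ≠ 0) :
    (residuePoly S ζ b).eval (ζ j) = b j / ζ j * ∏ i ∈ S.erase j, (1 - ζ j / ζ i) := by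
  simp only [residuePoly, Polynomial.eval_finsetSum, Polynomial.eval_mul, Polynomial.eval_C]
  rw [Finset.sum_eq_single_of_mem j hj, eval_nodePoly]
  intro i _ hij
  rw [eval_nodePoly_node (Finset.mem_erase.2 ⟨hij.symm, hj⟩) h0, mul_zero]

lemma degree_residuePoly_lt {S : Finset ℕ} {ζ b : ℕ → ℝ} :
    (residuePoly S ζ b).degree < S.card := by
  rw [residuePoly]
  refine (Polynomial.degree_sum_le _ _).trans_lt ?_
  refine (Finset.sup_lt_iff (WithBot.bot_lt_coe _)).2 fun j hj => ?_
  refine Polynomial.degree_le_natDegree.trans_lt ?_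
  have h1 := (Polynomial.natDegree_C_mul_le (b j / ζ j) (nodePoly (S.erase j) ζ)).trans
    (natDegree_nodePoly_le _ _)
  rw [Finset.card_erase_of_mem hj] at h1
  have := Finset.card_pos.2 ⟨j, hj⟩
  exact_mod_cast (by omega : (Polynomial.C (b j / ζ j) * nodePoly (S.erase j) ζ).natDegree < S.card)

lemma sum_residues_eq {S : Finset ℕ} {ζ : ℕ → ℝ} (b : ℕ → ℝ) (h0 : ∀ j ∈ S, ζ j ≠ 0) :
    ∑ j ∈ S, RatFunc.C (b j) / (RatFunc.C (ζ j) - RatFunc.X) =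
      algebraMap (Polynomial ℝ) (RatFunc ℝ) (residuePoly S ζ b) /
        algebraMap (Polynomial ℝ) (RatFunc ℝ) (nodePoly S ζ) := by
  rw [residuePoly, map_sum, Finset.sum_div]
  refine Finset.sum_congr rfl fun j hj => ?_
  have hN : nodePoly S ζ = (1 - Polynomial.C (1 / ζ j) * Polynomial.X) * nodePoly (S.erase j) ζ := by
    rw [nodePoly, nodePoly]
    exact (Finset.mul_prod_erase S _ hj).symm
  have hE : nodePoly (S.erase j) ζ ≠ 0 := fun h => by
    have := congrArg (Polynomial.eval 0) h
    rw [eval_nodePoly] at this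
    simp at this
  have hl : Polynomial.C (ζ j) - Polynomial.X ≠ (0 : Polynomial ℝ) := fun h => by
    have := congrArg (Polynomial.eval 0) h
    simp [h0 j hj] at this
  have hl' : (1 - Polynomial.C (1 / ζ j) * Polynomial.X : Polynomial ℝ) ≠ 0 := fun h => by
    have := congrArg (Polynomial.eval 0) h
    simp at this
  have hinj := IsFractionRing.injective (Polynomial ℝ) (RatFunc ℝ)
  rw [← RatFunc.algebraMap_C, ← RatFunc.algebraMap_C, ← RatFunc.algebraMap_X, ← map_sub,
    div_eq_div_iff ((map_ne_zero_iff _ hinj).2 hl)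
      ((map_ne_zero_iff _ hinj).2 (by rw [hN]; exact mul_ne_zero hl' hE)), ← map_mul, ← map_mul, hN]
  congr 1
  have h1 : (Polynomial.C (b j / ζ j) : Polynomial ℝ) * Polynomial.C (ζ j) = Polynomial.C (b j) := by
    rw [← Polynomial.C_mul, div_mul_cancel₀ _ (h0 j hj)]
  have h2 : (Polynomial.C (b j / ζ j) : Polynomial ℝ) =
      Polynomial.C (b j) * Polynomial.C (1 / ζ j) := by
    rw [← Polynomial.C_mul, mul_one_div]
  linear_combination (-(nodePoly (S.erase j) ζ)) * h1 + Polynomial.X * nodePoly (S.erase j) ζ * h2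

/-- Both sides have degree at most `K` and agree at the `K + 1` points `0, ζ_1, …, ζ_K`. -/
lemma qp_snd_eq_nodePoly {K : ℕ} {m x ζ : ℕ → ℝ} (hζ : Set.InjOn ζ (Finset.Icc 1 K))
    (h0 : ∀ j ∈ Finset.Icc 1 K, ζ j ≠ 0)
    (h : ∀ j ∈ Finset.Icc 1 K, (qp m x (2 * K)).2.eval (ζ j) = 0) :
    (qp m x (2 * K)).2 = nodePoly (Finset.Icc 1 K) ζ := by
  have hcard : (insert 0 ((Finset.Icc 1 K).image ζ)).card = K + 1 := by
    rw [Finset.card_insert_of_notMem, Finset.card_image_of_injOn hζ]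
    · simp
    · simp only [Finset.mem_image, not_exists, not_and]
      exact fun j hj => h0 j hj
  refine Polynomial.eq_of_degrees_lt_of_eval_finset_eq (insert 0 ((Finset.Icc 1 K).image ζ)) ?_ ?_ ?_
  · rw [hcard, Polynomial.degree_lt_iff_coeff_zero]
    exact (qp_coeff_eq_zero m x K).2
  · rw [hcard]
    refine Polynomial.degree_le_natDegree.trans_lt ?_
    have := natDegree_nodePoly_le (Finset.Icc 1 K) ζ
    rw [Nat.card_Icc, Nat.add_sub_cancel] at this
    exact_mod_cast Nat.lt_succ_of_le this
  · intro z hz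
    rw [Finset.mem_insert, Finset.mem_image] at hz
    rcases hz with rfl | ⟨j, hj, rfl⟩
    · rw [qp_eval_zero, eval_nodePoly]; simp
    · rw [h j hj, eval_nodePoly_node hj (h0 j hj)]

/-- Reduces an identity of rational functions to values at the nodes. At `ζ_j` the numerator of the
partial fraction sum is nonzero because `b_j ≠ 0`, so cross multiplication forces `p_{2K}(ζ_j) = 0`;
then the denominators coincide and the numerators, of degree below `K`, are fixed by their values.
-/
lemma hasSpectralData_iff {K : ℕ} {m x ζ b : ℕ → ℝ} (hζ : Set.InjOn ζ (Finset.Icc 1 K))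
    (h0 : ∀ j ∈ Finset.Icc 1 K, ζ j ≠ 0) (hb : ∀ j ∈ Finset.Icc 1 K, b j ≠ 0) :
    HasSpectralData K m x ζ b ↔ ∀ j ∈ Finset.Icc 1 K, (qp m x (2 * K)).2.eval (ζ j) = 0 ∧
      (qp m x (2 * K)).1.eval (ζ j) =
        b j / ζ j * ∏ i ∈ (Finset.Icc 1 K).erase j, (1 - ζ j / ζ i) := by
  have hinj := IsFractionRing.injective (Polynomial ℝ) (RatFunc ℝ)
  rw [HasSpectralData, weyl, sum_residues_eq b h0]
  have hp0 : (qp m x (2 * K)).2 ≠ 0 := fun h => by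
    have := qp_eval_zero m x (2 * K)
    simp [h] at this
  have hN0 : nodePoly (Finset.Icc 1 K) ζ ≠ 0 := fun h => by
    have := congrArg (Polynomial.eval 0) h
    rw [eval_nodePoly] at this
    simp at this
  rw [div_eq_div_iff ((map_ne_zero_iff _ hinj).2 hp0) ((map_ne_zero_iff _ hinj).2 hN0),
    ← map_mul, ← map_mul, hinj.eq_iff]
  constructor
  · intro h
    have hp : ∀ j ∈ Finset.Icc 1 K, (qp m x (2 * K)).2.eval (ζ j) = 0 := by
      intro j hj
      have h1 := congrArg (Polynomial.eval (ζ j)) h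
      rw [Polynomial.eval_mul, Polynomial.eval_mul, eval_nodePoly_node hj (h0 j hj), mul_zero,
        eval_residuePoly_node hj (h0 j hj)] at h1
      refine (mul_eq_zero.1 h1.symm).resolve_left (mul_ne_zero (div_ne_zero (hb j hj) (h0 j hj)) ?_)
      refine Finset.prod_ne_zero_iff.2 fun i hi => ?_
      rw [Finset.mem_erase] at hi
      rw [sub_ne_zero]
      intro h2
      rw [eq_div_iff (h0 i hi.2), one_mul] at h2
      exact hi.1 (hζ hi.2 hj h2)
    rw [qp_snd_eq_nodePoly hζ h0 hp] at h
    have h2 := mul_right_cancel₀ hN0 h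
    intro j hj
    exact ⟨hp j hj, by rw [h2, eval_residuePoly_node hj (h0 j hj)]⟩
  · intro h
    rw [qp_snd_eq_nodePoly hζ h0 fun j hj => (h j hj).1]
    congr 1
    refine Polynomial.eq_of_degrees_lt_of_eval_index_eq (Finset.Icc 1 K) hζ ?_
      degree_residuePoly_lt fun j hj => ?_
    · rw [Nat.card_Icc, Nat.add_sub_cancel, Polynomial.degree_lt_iff_coeff_zero]
      exact (qp_coeff_eq_zero m x K).1
    · rw [eval_residuePoly_node hj (h0 j hj), (h j hj).2]

/-! ### Uniqueness of the configuration with given Weyl function -/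

/-- For `z < 0` the recurrence has only nonnegative terms; in particular `p_n` does not vanish at
the point `-1/m_n²` used for peeling. -/
lemma qp_eval_pos {n : ℕ} {m x : ℕ → ℝ} (hm : ∀ k, 1 ≤ k → k ≤ n → 0 < m k) {z : ℝ} (hz : z < 0) :
    0 ≤ (qp m x n).1.eval z ∧ 0 < (qp m x n).2.eval z := by
  induction n with
  | zero => simp [qp]
  | succ n ih =>
    obtain ⟨h1, h2⟩ := ih fun k hk hk' => hm k hk (by omega)
    have h3 := hm (n + 1) (by omega) le_rfl
    simp only [qp, Polynomial.eval_add, Polynomial.eval_sub, Polynomial.eval_mul,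
      Polynomial.eval_C, Polynomial.eval_X]
    have h4 := mul_pos h3 (Real.exp_pos (x (n + 1)))
    have h5 := mul_pos h3 (Real.exp_pos (-x (n + 1)))
    refine ⟨by positivity, ?_⟩
    have : 0 ≤ -z * (m (n + 1) * Real.exp (-x (n + 1))) * (qp m x n).1.eval z := by
      have : 0 < -z := by linarith
      positivity
    linarith

/-- Evaluation where the last factor is singular recovers the last position; cancelling that common
factor leaves the same hypothesis for `n` peakons. -/
lemma eq_of_qp_cross_eq {n : ℕ} {m x y : ℕ → ℝ} (hm : ∀ k, 1 ≤ k → k ≤ n → 0 < m k)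
    (h : (qp m x n).1 * (qp m y n).2 = (qp m y n).1 * (qp m x n).2) :
    ∀ k, 1 ≤ k → k ≤ n → x k = y k := by
  induction n with
  | zero => intro k h1 h2; omega
  | succ n ih =>
    have h3 := hm (n + 1) (by omega) le_rfl
    set q := (qp m x n).1 with hq
    set p := (qp m x n).2 with hp
    set q' := (qp m y n).1 with hq'
    set p' := (qp m y n).2 with hp'
    have hexp : ∀ u : ℝ, m (n + 1) * Real.exp u * (m (n + 1) * Real.exp (-u)) = m (n + 1) ^ 2 := by
      intro u
      rw [Real.exp_neg]; field_simp
    have hxy : x (n + 1) = y (n + 1) := by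
      have hz : -(1 / m (n + 1) ^ 2) < 0 := by simp; positivity
      obtain ⟨a1, a2⟩ := qp_eval_pos (m := m) (x := x) (n := n)
        (fun k hk hk' => hm k hk (by omega)) hz
      obtain ⟨b1, b2⟩ := qp_eval_pos (m := m) (x := y) (n := n)
        (fun k hk hk' => hm k hk (by omega)) hz
      obtain ⟨-, c2⟩ := qp_eval_pos (m := m) (x := x) (n := n + 1) hm hz
      obtain ⟨-, d2⟩ := qp_eval_pos (m := m) (x := y) (n := n + 1) hm hz
      -- At `z = -1/m²` the elementary step has rank one: its image satisfies `q = m exp(u) p`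
      -- whatever the input.
      have key : ∀ u : ℝ, ∀ Q P : ℝ, Q + m (n + 1) * Real.exp u * P =
          m (n + 1) * Real.exp u * (P - -(1 / m (n + 1) ^ 2) *
            (m (n + 1) * Real.exp (-u)) * Q) := by
        intro u Q P
        have := hexp u
        have h1 : 1 / m (n + 1) ^ 2 * m (n + 1) ^ 2 = 1 := one_div_mul_cancel (pow_pos h3 2).ne'
        linear_combination (-(Q * (1 / m (n + 1) ^ 2))) * this - Q * h1
      have h4 := congrArg (Polynomial.eval (-(1 / m (n + 1) ^ 2))) h
      simp only [qp, Polynomial.eval_add, Polynomial.eval_sub, Polynomial.eval_mul,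
        Polynomial.eval_C, Polynomial.eval_X] at h4 c2 d2
      rw [key, key] at h4
      have h5 : Real.exp (x (n + 1)) = Real.exp (y (n + 1)) := by
        refine mul_left_cancel₀ (mul_pos (mul_pos h3 c2) d2).ne' ?_
        linear_combination h4
      exact Real.exp_injective h5
    have hrec : q * p' = q' * p := by
      -- With equal last factors the cross difference is multiplied by their determinant `1 + z m²`.
      have h6 : (1 + Polynomial.X * Polynomial.C (m (n + 1) ^ 2)) * (q * p' - q' * p) = 0 := by
        simp only [qp, ← hq, ← hp, ← hq', ← hp', hxy] at h
        have h7 := congrArg Polynomial.C (hexp (y (n + 1)))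
        rw [Polynomial.C_mul] at h7
        linear_combination h - Polynomial.X * (q * p' - q' * p) * h7
      have h8 : (1 + Polynomial.X * Polynomial.C (m (n + 1) ^ 2) : Polynomial ℝ) ≠ 0 := fun h => by
        have := congrArg (Polynomial.eval 0) h
        simp at this
      exact sub_eq_zero.1 ((mul_eq_zero.1 h6).resolve_left h8)
    intro k hk hk'
    rcases Nat.lt_or_ge n k with h9 | h9
    · rw [show k = n + 1 by omega]; exact hxy
    · exact ih (fun k hk hk' => hm k hk (by omega)) hrec k hk h9

lemma HasSpectralData.unique {K : ℕ} {m x y ζ b : ℕ → ℝ}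
    (hm : ∀ k, 1 ≤ k → k ≤ 2 * K → 0 < m k) (hx : HasSpectralData K m x ζ b)
    (hy : HasSpectralData K m y ζ b) : ∀ k, 1 ≤ k → k ≤ 2 * K → x k = y k := by
  refine eq_of_qp_cross_eq hm ?_
  have hinj := IsFractionRing.injective (Polynomial ℝ) (RatFunc ℝ)
  have hne : ∀ x : ℕ → ℝ, algebraMap (Polynomial ℝ) (RatFunc ℝ) (qp m x (2 * K)).2 ≠ 0 := by
    intro x
    refine (map_ne_zero_iff _ hinj).2 fun h => ?_
    have := qp_eval_zero m x (2 * K)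
    simp [h] at this
  have h := hx.trans hy.symm
  rw [weyl, weyl, div_eq_div_iff (hne x) (hne y), ← map_mul, ← map_mul, hinj.eq_iff] at h
  exact h

/-! ### The configuration with given spectral data -/

lemma heineSum_congr {S : Finset ℕ} {ζ w w' : ℕ → ℝ} (h : ∀ j ∈ S, w j = w' j) (d : ℕ) :
    heineSum S ζ w d = heineSum S ζ w' d := by
  refine Finset.sum_congr rfl fun J hJ => ?_
  rw [Finset.mem_powersetCard] at hJ
  rw [Finset.prod_congr rfl fun j hj => h j (hJ.1 hj)]

lemma heinePoly_congr {S : Finset ℕ} {ζ w w' : ℕ → ℝ} (h : ∀ j ∈ S, w j = w' j) (d : ℕ) :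
    heinePoly S ζ w d = heinePoly S ζ w' d := by
  refine Finset.sum_congr rfl fun J hJ => ?_
  rw [Finset.mem_powersetCard] at hJ
  rw [Finset.prod_congr rfl fun j hj => h j (hJ.1 hj)]

lemma heineSum_zero (S : Finset ℕ) (ζ w : ℕ → ℝ) : heineSum S ζ w 0 = 1 := by
  simp [heineSum, vdmSq]

lemma heinePoly_zero (S : Finset ℕ) (ζ w : ℕ → ℝ) : heinePoly S ζ w 0 = 1 := by
  simp [heinePoly, vdmSq]

/-- The weights `b_j / Γ_{[1,k],{j}}(e; ζ)`. -/
def wt (n : ℕ) (m ζ b : ℕ → ℝ) (k j : ℕ) : ℝ := b j / ∏ i ∈ Finset.Icc 1 k, (e n m i + ζ j)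

/-- The product `e_1 ⋯ e_k`. -/
def eProd (n : ℕ) (m : ℕ → ℝ) (k : ℕ) : ℝ := ∏ i ∈ Finset.Icc 1 k, e n m i

/-- The value of `m_{k'} exp x_{k'}` for the configuration with spectral data `ζ`, `b`. -/
def momentum (K : ℕ) (m ζ b : ℕ → ℝ) (k : ℕ) : ℝ :=
  eProd (2 * K) m (k - 1) *
      (heineSum (Finset.Icc 1 K) ζ (wt (2 * K) m ζ b (k - 1)) (k / 2) *
        heineSum (Finset.Icc 1 K) ζ (wt (2 * K) m ζ b k) ((k + 1) / 2)) /
    (heineSum (Finset.Icc 1 K) ζ (fun j => ζ j * wt (2 * K) m ζ b k j) (k / 2) *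
      heineSum (Finset.Icc 1 K) ζ (fun j => ζ j * wt (2 * K) m ζ b (k - 1) j) ((k - 1) / 2))

/-- The configuration with spectral data `ζ`, `b`. -/
def position (K : ℕ) (m ζ b : ℕ → ℝ) (i : ℕ) : ℝ :=
  Real.log (momentum K m ζ b (refl (2 * K) i) / m i)

lemma refl_refl {n k : ℕ} (hk : k ≤ n + 1) : refl n (refl n k) = k := by
  unfold refl; omega

lemma e_pos {n k : ℕ} {m : ℕ → ℝ} (hm : ∀ k, 1 ≤ k → k ≤ n → 0 < m k) (h1 : 1 ≤ k) (h2 : k ≤ n) :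
    0 < e n m k :=
  one_div_pos.2 (pow_pos (hm _ (by unfold refl; omega) (by unfold refl; omega)) 2)

lemma eProd_pos {n k : ℕ} {m : ℕ → ℝ} (hm : ∀ k, 1 ≤ k → k ≤ n → 0 < m k) (h2 : k ≤ n) :
    0 < eProd n m k := by
  refine Finset.prod_pos fun i hi => ?_
  rw [Finset.mem_Icc] at hi
  exact e_pos hm hi.1 (by omega)

lemma eProd_succ (n k : ℕ) (m : ℕ → ℝ) : eProd n m (k + 1) = eProd n m k * e n m (k + 1) :=
  Finset.prod_Icc_succ_top (by omega) _

lemma wt_pos {n k j : ℕ} {m ζ b : ℕ → ℝ} (hm : ∀ k, 1 ≤ k → k ≤ n → 0 < m k) (h2 : k ≤ n)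
    (hζ : 0 < ζ j) (hb : 0 < b j) : 0 < wt n m ζ b k j := by
  refine div_pos hb (Finset.prod_pos fun i hi => ?_)
  rw [Finset.mem_Icc] at hi
  exact add_pos (e_pos hm hi.1 (by omega)) hζ

lemma wt_eq_mul_wt_succ {n k j : ℕ} {m ζ : ℕ → ℝ} (b : ℕ → ℝ)
    (hm : ∀ k, 1 ≤ k → k ≤ n → 0 < m k) (h2 : k + 1 ≤ n) (hζ : 0 < ζ j) :
    wt n m ζ b k j = (ζ j + e n m (k + 1)) * wt n m ζ b (k + 1) j := by
  rw [wt, wt, Finset.prod_Icc_succ_top (by omega)]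
  have := (add_pos (e_pos hm (by omega) h2) hζ).ne'
  rw [mul_comm (∏ i ∈ Finset.Icc 1 k, _), ← mul_div_assoc, add_comm (ζ j), mul_div_mul_left _ _ this]

section

variable {K : ℕ} {m ζ b : ℕ → ℝ}

lemma injOn_of_lt (hζ_lt : ∀ i j, 1 ≤ i → i < j → j ≤ K → ζ i < ζ j) :
    Set.InjOn ζ (Finset.Icc 1 K) := by
  intro i hi j hj h
  rw [Finset.mem_coe, Finset.mem_Icc] at hi hj
  rcases lt_trichotomy i j with h1 | h1 | h1
  · exact absurd h (hζ_lt i j hi.1 h1 hj.2).ne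
  · exact h1
  · exact absurd h (hζ_lt j i hj.1 h1 hi.2).ne'

lemma heineSum_wt_pos {k d : ℕ} (hm : ∀ k, 1 ≤ k → k ≤ 2 * K → 0 < m k)
    (hζ : Set.InjOn ζ (Finset.Icc 1 K)) (hpos : ∀ j ∈ Finset.Icc 1 K, 0 < ζ j)
    (hb : ∀ j ∈ Finset.Icc 1 K, 0 < b j) (hk : k ≤ 2 * K) (hd : d ≤ K) :
    0 < heineSum (Finset.Icc 1 K) ζ (wt (2 * K) m ζ b k) d :=
  heineSum_pos hζ (fun j hj => wt_pos hm hk (hpos j hj) (hb j hj)) (by simpa using hd)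

lemma heineSum_mul_wt_pos {k d : ℕ} (hm : ∀ k, 1 ≤ k → k ≤ 2 * K → 0 < m k)
    (hζ : Set.InjOn ζ (Finset.Icc 1 K)) (hpos : ∀ j ∈ Finset.Icc 1 K, 0 < ζ j)
    (hb : ∀ j ∈ Finset.Icc 1 K, 0 < b j) (hk : k ≤ 2 * K) (hd : d ≤ K) :
    0 < heineSum (Finset.Icc 1 K) ζ (fun j => ζ j * wt (2 * K) m ζ b k j) d :=
  heineSum_pos hζ (fun j hj => mul_pos (hpos j hj) (wt_pos hm hk (hpos j hj) (hb j hj)))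
    (by simpa using hd)

lemma momentum_pos {k : ℕ} (hm : ∀ k, 1 ≤ k → k ≤ 2 * K → 0 < m k)
    (hζ : Set.InjOn ζ (Finset.Icc 1 K)) (hpos : ∀ j ∈ Finset.Icc 1 K, 0 < ζ j)
    (hb : ∀ j ∈ Finset.Icc 1 K, 0 < b j) (hk : k ≤ 2 * K) : 0 < momentum K m ζ b k :=
  div_pos (mul_pos (eProd_pos hm (by omega)) (mul_pos
    (heineSum_wt_pos hm hζ hpos hb (by omega) (by omega))
    (heineSum_wt_pos hm hζ hpos hb (by omega) (by omega)))) (mul_pos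
    (heineSum_mul_wt_pos hm hζ hpos hb (by omega) (by omega))
    (heineSum_mul_wt_pos hm hζ hpos hb (by omega) (by omega)))

lemma exp_position {i : ℕ} (hm : ∀ k, 1 ≤ k → k ≤ 2 * K → 0 < m k)
    (hζ : Set.InjOn ζ (Finset.Icc 1 K)) (hpos : ∀ j ∈ Finset.Icc 1 K, 0 < ζ j)
    (hb : ∀ j ∈ Finset.Icc 1 K, 0 < b j) (h1 : 1 ≤ i) (hi : i ≤ 2 * K) :
    m i * Real.exp (position K m ζ b i) = momentum K m ζ b (refl (2 * K) i) := by
  rw [position, Real.exp_log (div_pos (momentum_pos hm hζ hpos hb (by unfold refl; omega))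
    (hm i h1 hi)), mul_div_cancel₀ _ (hm i h1 hi).ne']

/-- The normalized value at `ζ_j` of the polynomial proportional to `q_{2K-k}`. -/
def qNode (K : ℕ) (m ζ b : ℕ → ℝ) (k j : ℕ) : ℝ :=
  (heinePoly (Finset.Icc 1 K) ζ (wt (2 * K) m ζ b k) (k / 2)).eval (ζ j) /
    heineSum (Finset.Icc 1 K) ζ (fun j => ζ j * wt (2 * K) m ζ b k j) (k / 2)

/-- The normalized value at `ζ_j` of the polynomial proportional to `p_{2K-k}`. -/
def pNode (K : ℕ) (m ζ b : ℕ → ℝ) (k j : ℕ) : ℝ :=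
  -- `k = 0` must encode the zero of `p_{2K}` at `ζ_j`; with truncated subtraction the general
  -- expression would give `ζ_j`.
  if k = 0 then 0 else
    ζ j * ((heinePoly (Finset.Icc 1 K) ζ (fun j => ζ j * wt (2 * K) m ζ b k j)
        ((k - 1) / 2)).eval (ζ j) /
      (eProd (2 * K) m k * heineSum (Finset.Icc 1 K) ζ (wt (2 * K) m ζ b k) ((k + 1) / 2)))

/-- The Christoffel relation with `w = wt (k+1)`, `w' = wt k` and `c = e_{k+1}`. As `1/e_{k+1}` is a
squared mass, this is the step for `q` up to the determinant factor on the left. -/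
lemma qNode_step {k j : ℕ} (hm : ∀ k, 1 ≤ k → k ≤ 2 * K → 0 < m k)
    (hζ : Set.InjOn ζ (Finset.Icc 1 K)) (hpos : ∀ j ∈ Finset.Icc 1 K, 0 < ζ j)
    (hb : ∀ j ∈ Finset.Icc 1 K, 0 < b j) (hk : k + 1 ≤ 2 * K) (hj : j ∈ Finset.Icc 1 K) :
    (1 + ζ j / e (2 * K) m (k + 1)) * qNode K m ζ b k j =
      qNode K m ζ b (k + 1) j + momentum K m ζ b (k + 1) * pNode K m ζ b (k + 1) j := by
  have he := e_pos hm (k := k + 1) (by omega) hk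
  have hww : ∀ j ∈ Finset.Icc 1 K, wt (2 * K) m ζ b k j =
      (ζ j + e (2 * K) m (k + 1)) * wt (2 * K) m ζ b (k + 1) j :=
    fun j hj => wt_eq_mul_wt_succ b hm hk (hpos j hj)
  have h := heinePoly_step_fst hζ hpos
    (w := wt (2 * K) m ζ b (k + 1))
    (w' := fun j => (ζ j + e (2 * K) m (k + 1)) * wt (2 * K) m ζ b (k + 1) j)
    (c := e (2 * K) m (k + 1)) (d := (k + 1) / 2) (D := k / 2)
    (fun j hj => wt_pos hm hk (hpos j hj) (hb j hj)) he (fun j => rfl) (by omega) (by omega)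
    (by simp; omega) (by simp; omega) j hj
  rw [← heinePoly_congr hww, ← heineSum_congr hww,
    ← heineSum_congr (fun j hj => by rw [hww j hj] :
      ∀ j ∈ Finset.Icc 1 K, ζ j * wt (2 * K) m ζ b k j = _)] at h
  rw [qNode, h, qNode, pNode, if_neg (by omega), momentum, eProd_succ]
  have e1 : (k + 1 + 1) / 2 = k / 2 + 1 := by omega
  have e2 : k + 1 - 1 = k := by omega
  rw [e1, e2]
  have p1 := eProd_pos hm (k := k) (by omega)
  have p2 := heineSum_wt_pos hm hζ hpos hb (k := k) (d := (k + 1) / 2) (by omega) (by omega)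
  have p3 := heineSum_wt_pos hm hζ hpos hb (k := k + 1) (d := k / 2 + 1) (by omega) (by omega)
  have p4 := heineSum_mul_wt_pos hm hζ hpos hb (k := k + 1) (d := (k + 1) / 2) (by omega) (by omega)
  have p5 := heineSum_mul_wt_pos hm hζ hpos hb (k := k) (d := k / 2) (by omega) (by omega)
  congr 1
  field_simp

lemma pNode_step {k j : ℕ} (hm : ∀ k, 1 ≤ k → k ≤ 2 * K → 0 < m k)
    (hζ : Set.InjOn ζ (Finset.Icc 1 K)) (hpos : ∀ j ∈ Finset.Icc 1 K, 0 < ζ j)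
    (hb : ∀ j ∈ Finset.Icc 1 K, 0 < b j) (hk : k + 1 ≤ 2 * K) (hj : j ∈ Finset.Icc 1 K) :
    (1 + ζ j / e (2 * K) m (k + 1)) * pNode K m ζ b k j =
      pNode K m ζ b (k + 1) j -
        ζ j * (1 / (e (2 * K) m (k + 1) * momentum K m ζ b (k + 1))) * qNode K m ζ b (k + 1) j := by
  have he := e_pos hm (k := k + 1) (by omega) hk
  have p1 := eProd_pos hm (k := k) (by omega)
  have p2 := heineSum_wt_pos hm hζ hpos hb (k := k) (d := (k + 1) / 2) (by omega) (by omega)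
  have p3 := heineSum_wt_pos hm hζ hpos hb (k := k + 1) (d := k / 2 + 1) (by omega) (by omega)
  have p4 := heineSum_mul_wt_pos hm hζ hpos hb (k := k + 1) (d := (k + 1) / 2) (by omega) (by omega)
  have p5 := heineSum_mul_wt_pos hm hζ hpos hb (k := k) (d := k / 2) (by omega) (by omega)
  have e1 : (k + 1 + 1) / 2 = k / 2 + 1 := by omega
  have e2 : k + 1 - 1 = k := by omega
  rcases Nat.eq_zero_or_pos k with rfl | hk0
  -- For `k = 0` the left side is zero and all sums have at most explicit order, so the identity is
  -- checked directly.
  · simp only [pNode, qNode, momentum, eProd_succ]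
    simp only [zero_add, Nat.reduceDiv, heineSum_zero, heinePoly_zero, Nat.add_one_sub_one,
      Nat.reduceAdd, Nat.zero_div] at *
    simp [eProd]
  · have hww : ∀ j ∈ Finset.Icc 1 K, wt (2 * K) m ζ b k j =
        (ζ j + e (2 * K) m (k + 1)) * wt (2 * K) m ζ b (k + 1) j :=
      fun j hj => wt_eq_mul_wt_succ b hm hk (hpos j hj)
    have hzw : ∀ j ∈ Finset.Icc 1 K, ζ j * wt (2 * K) m ζ b k j =
        ζ j * ((ζ j + e (2 * K) m (k + 1)) * wt (2 * K) m ζ b (k + 1) j) :=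
      fun j hj => by rw [hww j hj]
    have e3 : (k + 1) / 2 = (k - 1) / 2 + 1 := by omega
    have h := heinePoly_step_snd hζ hpos
      (w := wt (2 * K) m ζ b (k + 1))
      (w' := fun j => (ζ j + e (2 * K) m (k + 1)) * wt (2 * K) m ζ b (k + 1) j)
      (c := e (2 * K) m (k + 1)) (d := (k - 1) / 2) (D := k / 2)
      (fun j hj => wt_pos hm hk (hpos j hj) (hb j hj)) he (fun j => rfl) (by omega) (by omega)
      (by simp; omega) (by simp; omega) j hj
    rw [← heineSum_congr hww,
      ← heineSum_congr hzw, ← heinePoly_congr hzw, ← e3] at h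
    rw [pNode, if_neg (by omega), pNode, if_neg (by omega), momentum, qNode, e1, e2, eProd_succ]
    have : (1 + ζ j / e (2 * K) m (k + 1)) = (ζ j + e (2 * K) m (k + 1)) / e (2 * K) m (k + 1) := by
      field_simp
      ring
    rw [this]
    rw [← mul_div_assoc, div_eq_iff p2.ne'] at h
    set T2 := heineSum (Finset.Icc 1 K) ζ (wt (2 * K) m ζ b k) ((k + 1) / 2)
    set E := e (2 * K) m (k + 1)
    set Q := Polynomial.eval (ζ j) (heinePoly (Finset.Icc 1 K) ζ
      (fun j => ζ j * wt (2 * K) m ζ b k j) ((k - 1) / 2))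
    calc _ = ζ j / (E * eProd (2 * K) m k * T2) * ((ζ j + E) * Q) := by field_simp
      _ = _ := by rw [h]; field_simp

/-- Both sides obey the same two-term recurrence in `i`; the product collects the determinants `1 +
ζ_j m²`. Multiplying by the value at index `2K` avoids dividing before it is known to be nonzero. -/
lemma qp_position_mul {i j : ℕ} (hm : ∀ k, 1 ≤ k → k ≤ 2 * K → 0 < m k)
    (hζ : Set.InjOn ζ (Finset.Icc 1 K)) (hpos : ∀ j ∈ Finset.Icc 1 K, 0 < ζ j)
    (hb : ∀ j ∈ Finset.Icc 1 K, 0 < b j) (hi : i ≤ 2 * K) (hj : j ∈ Finset.Icc 1 K) :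
    (qp m (position K m ζ b) i).1.eval (ζ j) * pNode K m ζ b (2 * K) j =
        (∏ l ∈ Finset.range i, (1 + ζ j * m (l + 1) ^ 2)) * qNode K m ζ b (2 * K - i) j ∧
      (qp m (position K m ζ b) i).2.eval (ζ j) * pNode K m ζ b (2 * K) j =
        (∏ l ∈ Finset.range i, (1 + ζ j * m (l + 1) ^ 2)) * pNode K m ζ b (2 * K - i) j := by
  induction i with
  | zero =>
    -- The polynomial of full degree `K` vanishes at every node, which matches the initial value
    -- `q_0 = 0`.
    have : qNode K m ζ b (2 * K) j = 0 := by
      rw [qNode, eval_heinePoly, heineSum, Finset.sum_eq_zero, zero_div]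
      intro J hJ
      rw [Finset.mem_powersetCard] at hJ
      have hJ' : J = Finset.Icc 1 K := Finset.eq_of_subset_of_card_le hJ.1 (by
        rw [hJ.2, Nat.card_Icc]; omega)
      rw [Finset.prod_eq_zero (hJ'.symm ▸ hj : j ∈ J) (by simp), mul_zero]
    simp [qp, this]
  | succ i ih =>
    obtain ⟨h1, h2⟩ := ih (by omega)
    obtain ⟨k, hk⟩ : ∃ k, 2 * K - i = k + 1 := ⟨2 * K - i - 1, by omega⟩
    have hk' : 2 * K - (i + 1) = k := by omega
    have hr : refl (2 * K) (i + 1) = k + 1 := by unfold refl; omega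
    have hr' : refl (2 * K) (k + 1) = i + 1 := by unfold refl; omega
    have hmi := hm (i + 1) (by omega) hi
    have hE : e (2 * K) m (k + 1) = 1 / m (i + 1) ^ 2 := by rw [e, hr']
    have hx := exp_position hm hζ hpos hb (i := i + 1) (by omega) hi
    have hM := momentum_pos hm hζ hpos hb (k := k + 1) (by omega)
    rw [hr] at hx
    have hx' : m (i + 1) * Real.exp (-position K m ζ b (i + 1)) =
        1 / (e (2 * K) m (k + 1) * momentum K m ζ b (k + 1)) := by
      rw [← hx, hE, Real.exp_neg]
      have := Real.exp_pos (position K m ζ b (i + 1))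
      field_simp
    have s1 := qNode_step hm hζ hpos hb (k := k) (by omega) hj
    have s2 := pNode_step hm hζ hpos hb (k := k) (by omega) hj
    rw [← hx', hE, div_div_eq_mul_div, div_one] at s2
    rw [← hx, hE, div_div_eq_mul_div, div_one] at s1
    rw [hk] at h1 h2
    simp only [qp, Polynomial.eval_add, Polynomial.eval_sub, Polynomial.eval_mul,
      Polynomial.eval_C, Polynomial.eval_X]
    rw [Finset.prod_range_succ, hk']
    set Pr := ∏ l ∈ Finset.range i, (1 + ζ j * m (l + 1) ^ 2)
    constructor
    · linear_combination h1 + m (i + 1) * Real.exp (position K m ζ b (i + 1)) * h2 - Pr * s1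
    · linear_combination h2 - ζ j * (m (i + 1) * Real.exp (-position K m ζ b (i + 1))) * h1 - Pr * s2

/-- At index `2K` only one subset survives in each Heine expression: the full set in the determinant
and the full set minus `j` in the polynomial, since any subset containing `j` has the factor `ζ_j -
ζ_j`. The outcome is the normalization that makes the residue exactly `b_j`. -/
lemma pNode_top {j : ℕ} (hm : ∀ k, 1 ≤ k → k ≤ 2 * K → 0 < m k)
    (hζ : Set.InjOn ζ (Finset.Icc 1 K)) (hpos : ∀ j ∈ Finset.Icc 1 K, 0 < ζ j)
    (hb : ∀ j ∈ Finset.Icc 1 K, 0 < b j) (hj : j ∈ Finset.Icc 1 K) :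
    pNode K m ζ b (2 * K) j * (b j / ζ j * ∏ i ∈ (Finset.Icc 1 K).erase j, (1 - ζ j / ζ i)) =
      ∏ l ∈ Finset.range (2 * K), (1 + ζ j * m (l + 1) ^ 2) := by
  have hK : 1 ≤ K := by rw [Finset.mem_Icc] at hj; omega
  have hPr : ∏ l ∈ Finset.range (2 * K), (1 + ζ j * m (l + 1) ^ 2) =
      (∏ i ∈ Finset.Icc 1 (2 * K), (e (2 * K) m i + ζ j)) / eProd (2 * K) m (2 * K) := by
    rw [eProd, ← Finset.prod_div_distrib]
    refine Finset.prod_bij' (fun l _ => 2 * K - l) (fun i _ => 2 * K - i) ?_ ?_ ?_ ?_ ?_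
    · intro l hl; rw [Finset.mem_range] at hl; rw [Finset.mem_Icc]; omega
    · intro l hl; rw [Finset.mem_Icc] at hl; rw [Finset.mem_range]; omega
    · intro l hl; rw [Finset.mem_range] at hl; omega
    · intro l hl; rw [Finset.mem_Icc] at hl; omega
    · intro l hl
      rw [Finset.mem_range] at hl
      have hmi := hm (l + 1) (by omega) (by omega)
      rw [e, show refl (2 * K) (2 * K - l) = l + 1 by unfold refl; omega]
      field_simp
  set w := wt (2 * K) m ζ b (2 * K) with hw
  set S := Finset.Icc 1 K with hS
  have hwpos : ∀ i ∈ S, 0 < w i := fun i hi => wt_pos hm le_rfl (hpos i hi) (hb i hi)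
  have hT : heineSum S ζ w K = vdmSq ζ S * ∏ i ∈ S, w i := by
    have : S.powersetCard K = {S} := by
      conv_rhs => rw [← Finset.powersetCard_self]
      rw [hS, Nat.card_Icc, Nat.add_sub_cancel]
    rw [heineSum, this, Finset.sum_singleton]
  have hQ : (heinePoly S ζ (fun j => ζ j * w j) (K - 1)).eval (ζ j) =
      vdmSq ζ S / (∏ i ∈ S.erase j, (ζ i - ζ j)) * ∏ i ∈ S.erase j, (ζ i * w i) := by
    rw [eval_heinePoly, heineSum, Finset.sum_eq_single (S.erase j),
      Finset.prod_mul_distrib, ← mul_assoc, vdmSq_erase_mul_prod hζ subset_rfl hj]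
    · intro J hJ hne
      rw [Finset.mem_powersetCard] at hJ
      by_cases hjJ : j ∈ J
      · rw [Finset.prod_eq_zero hjJ (by simp), mul_zero]
      · exact absurd (Finset.eq_of_subset_of_card_le (Finset.subset_erase.2 ⟨hJ.1, hjJ⟩) (by
          rw [hJ.2, Finset.card_erase_of_mem hj, hS, Nat.card_Icc]; omega)) hne
    · intro h
      refine absurd (Finset.mem_powersetCard.2 ⟨Finset.erase_subset _ _, ?_⟩) h
      rw [Finset.card_erase_of_mem hj, hS, Nat.card_Icc, Nat.add_sub_cancel]
  have hV : 0 < vdmSq ζ S := vdmSq_pos hζ subset_rfl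
  have hW : 0 < ∏ i ∈ S.erase j, w i :=
    Finset.prod_pos fun i hi => hwpos i (Finset.mem_of_mem_erase hi)
  have hZ : 0 < ∏ i ∈ S.erase j, ζ i :=
    Finset.prod_pos fun i hi => hpos i (Finset.mem_of_mem_erase hi)
  have hD : ∏ i ∈ S.erase j, (ζ i - ζ j) ≠ 0 := by
    refine Finset.prod_ne_zero_iff.2 fun i hi => sub_ne_zero.2 fun h => ?_
    rw [Finset.mem_erase] at hi
    exact hi.1 (hζ hi.2 hj h)
  have hC : ∏ i ∈ S.erase j, (1 - ζ j / ζ i) =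
      (∏ i ∈ S.erase j, (ζ i - ζ j)) / ∏ i ∈ S.erase j, ζ i := by
    rw [← Finset.prod_div_distrib]
    refine Finset.prod_congr rfl fun i hi => ?_
    have := (hpos i (Finset.mem_of_mem_erase hi)).ne'
    field_simp
  have hwj : w j = b j / ∏ i ∈ Finset.Icc 1 (2 * K), (e (2 * K) m i + ζ j) := rfl
  have hG : 0 < ∏ i ∈ Finset.Icc 1 (2 * K), (e (2 * K) m i + ζ j) := by
    refine Finset.prod_pos fun i hi => ?_
    rw [Finset.mem_Icc] at hi
    exact add_pos (e_pos hm hi.1 hi.2) (hpos j hj)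
  have hEp := eProd_pos hm (k := 2 * K) le_rfl
  have hbj := hb j hj
  have hζj := hpos j hj
  rw [hPr, pNode, if_neg (by omega), show (2 * K - 1) / 2 = K - 1 by omega,
    show (2 * K + 1) / 2 = K by omega, hT, hQ, hC, ← Finset.mul_prod_erase S w hj, hwj,
    Finset.prod_mul_distrib]
  field_simp

theorem position_hasSpectralData (hm : ∀ k, 1 ≤ k → k ≤ 2 * K → 0 < m k)
    (hζ : Set.InjOn ζ (Finset.Icc 1 K)) (hpos : ∀ j ∈ Finset.Icc 1 K, 0 < ζ j)
    (hb : ∀ j ∈ Finset.Icc 1 K, 0 < b j) :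
    HasSpectralData K m (position K m ζ b) ζ b := by
  rw [hasSpectralData_iff hζ (fun j hj => (hpos j hj).ne') (fun j hj => (hb j hj).ne')]
  intro j hj
  obtain ⟨h1, h2⟩ := qp_position_mul hm hζ hpos hb le_rfl hj
  have h3 := pNode_top hm hζ hpos hb hj
  have hPr : 0 < ∏ l ∈ Finset.range (2 * K), (1 + ζ j * m (l + 1) ^ 2) :=
    Finset.prod_pos fun l _ => by have := hpos j hj; positivity
  have hp : pNode K m ζ b (2 * K) j ≠ 0 := fun h => by
    rw [h, zero_mul] at h3; exact hPr.ne h3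
  have hq0 : qNode K m ζ b 0 j = 1 := by simp [qNode, heinePoly_zero, heineSum_zero]
  have hp0 : pNode K m ζ b 0 j = 0 := if_pos rfl
  rw [Nat.sub_self, hq0, mul_one] at h1
  rw [Nat.sub_self, hp0, mul_zero] at h2
  refine ⟨(mul_eq_zero.1 h2).resolve_right hp, mul_right_cancel₀ hp ?_⟩
  rw [h1, ← h3, mul_comm]

end

/-! ### Evolution of the spectral data -/

/-- `∑_{i ≤ k} m_i exp y_i`. -/
def hSum (m y : ℕ → ℝ) (k : ℕ) : ℝ := ∑ i ∈ Finset.Icc 1 k, m i * Real.exp (y i)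

/-- `∑_{k < i ≤ n} m_i exp (-y_i)`. -/
def gSum (n : ℕ) (m y : ℕ → ℝ) (k : ℕ) : ℝ := ∑ i ∈ Finset.Icc (k + 1) n, m i * Real.exp (-y i)

/-- The peakon vector field on ordered configurations, written without absolute values. -/
def orderedField (n : ℕ) (m y : ℕ → ℝ) (j : ℕ) : ℝ :=
  2 * (m j * Real.exp (-y j) * hSum m y (j - 1) + m j * Real.exp (y j) * gSum n m y j) +
    4 * (hSum m y (j - 1) * gSum n m y j)

lemma peakonField_eq_orderedField {n : ℕ} {m y : ℕ → ℝ}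
    (hy : ∀ i j, 1 ≤ i → i < j → j ≤ n → y i < y j) {j : ℕ} (h1 : 1 ≤ j) (hj : j ≤ n) :
    peakonField n m y j = orderedField n m y j := by
  have habs : ∀ i k, 1 ≤ i → i < k → k ≤ n →
      Real.exp (-|y i - y k|) = Real.exp (y i) * Real.exp (-y k) := by
    intro i k hi hik hk
    rw [abs_of_neg (sub_neg.2 (hy i k hi hik hk)), ← Real.exp_add]
    ring_nf
  have hsplit : (Finset.Icc 1 n).erase j = Finset.Icc 1 (j - 1) ∪ Finset.Icc (j + 1) n := by
    ext i
    simp only [Finset.mem_erase, Finset.mem_union, Finset.mem_Icc]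
    omega
  have hdisj : Disjoint (Finset.Icc 1 (j - 1)) (Finset.Icc (j + 1) n) := by
    rw [Finset.disjoint_left]
    intro i
    simp only [Finset.mem_Icc]
    omega
  rw [peakonField, orderedField, hsplit, Finset.sum_union hdisj]
  have s1 : ∑ k ∈ Finset.Icc 1 (j - 1), m j * m k * Real.exp (-|y j - y k|) =
      m j * Real.exp (-y j) * hSum m y (j - 1) := by
    rw [hSum, Finset.mul_sum]
    refine Finset.sum_congr rfl fun k hk => ?_
    rw [Finset.mem_Icc] at hk
    rw [abs_sub_comm, habs k j hk.1 (by omega) hj]; ring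
  have s2 : ∑ k ∈ Finset.Icc (j + 1) n, m j * m k * Real.exp (-|y j - y k|) =
      m j * Real.exp (y j) * gSum n m y j := by
    rw [gSum, Finset.mul_sum]
    refine Finset.sum_congr rfl fun k hk => ?_
    rw [Finset.mem_Icc] at hk
    rw [habs j k h1 (by omega) hk.2]; ring
  have s3 : ∑ i ∈ Finset.Icc 1 (j - 1), ∑ k ∈ Finset.Icc (j + 1) n,
      m i * m k * Real.exp (-|y i - y k|) = hSum m y (j - 1) * gSum n m y j := by
    rw [hSum, gSum, Finset.sum_mul_sum]
    refine Finset.sum_congr rfl fun i hi => Finset.sum_congr rfl fun k hk => ?_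
    rw [Finset.mem_Icc] at hi hk
    rw [habs i k hi.1 (by omega) hk.2]; ring
  rw [s1, s2, s3]

/-- The time part of the Lax pair. -/
lemma hasDerivAt_qp {n : ℕ} {m : ℕ → ℝ} {x : ℝ → ℕ → ℝ} {t z : ℝ} (hz : z ≠ 0)
    (hx : ∀ j, 1 ≤ j → j ≤ n → HasDerivAt (fun s => x s j) (orderedField n m (x t) j) t)
    {k : ℕ} (hk : k ≤ n) :
    HasDerivAt (fun s => (qp m (x s) k).1.eval z)
        ((2 / z + 2 * (hSum m (x t) k * gSum n m (x t) k)) * (qp m (x t) k).1.eval z -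
          2 * hSum m (x t) k / z * (qp m (x t) k).2.eval z) t ∧
      HasDerivAt (fun s => (qp m (x s) k).2.eval z)
        (2 * gSum n m (x t) k * (qp m (x t) k).1.eval z -
          2 * (hSum m (x t) k * gSum n m (x t) k) * (qp m (x t) k).2.eval z) t := by
  induction k with
  | zero =>
    simp only [qp, hSum, Polynomial.eval_zero, Polynomial.eval_one]
    constructor
    · simpa using hasDerivAt_const t (0 : ℝ)
    · simpa using hasDerivAt_const t (1 : ℝ)
  | succ k ih =>
    obtain ⟨hq, hp⟩ := ih (by omega)
    have hxk := hx (k + 1) (by omega) hk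
    have hH : hSum m (x t) (k + 1) = hSum m (x t) k + m (k + 1) * Real.exp (x t (k + 1)) :=
      Finset.sum_Icc_succ_top (by omega) _
    have hG : gSum n m (x t) k = m (k + 1) * Real.exp (-x t (k + 1)) + gSum n m (x t) (k + 1) := by
      rw [gSum, gSum, ← Finset.insert_Icc_add_one_left_eq_Icc hk, Finset.sum_insert (by simp)]
    have hf : orderedField n m (x t) (k + 1) = 2 * (m (k + 1) * Real.exp (-x t (k + 1)) *
        hSum m (x t) k + m (k + 1) * Real.exp (x t (k + 1)) * gSum n m (x t) (k + 1)) +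
        4 * (hSum m (x t) k * gSum n m (x t) (k + 1)) := rfl
    rw [hf] at hxk
    have hu := (hxk.exp.const_mul (m (k + 1))).mul hp
    have hv := ((hxk.neg.exp.const_mul (m (k + 1))).const_mul z).mul hq
    have h1 := hq.add hu
    have h2 := hp.sub hv
    simp only [qp, Polynomial.eval_add, Polynomial.eval_sub, Polynomial.eval_mul,
      Polynomial.eval_C, Polynomial.eval_X]
    set H := hSum m (x t) k
    set G := gSum n m (x t) (k + 1)
    rw [hG] at h1 h2
    rw [hH]
    constructor
    · refine h1.congr_deriv ?_
      field_simp
      ring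
    · refine h2.congr_deriv ?_
      simp only [Pi.neg_apply]
      field_simp
      ring

lemma gSum_top (n : ℕ) (m y : ℕ → ℝ) : gSum n m y n = 0 := by simp [gSum]

/-- The residues at time `t`, given those at time `0`. -/
def residueAt (ζ b : ℕ → ℝ) (t : ℝ) (j : ℕ) : ℝ := b j * Real.exp (2 * t / ζ j)

/-- At `k = 2K` the sum `gSum` is empty, so `p_{2K}` is conserved, and at an eigenvalue `q_{2K}`
satisfies `q' = (2/ζ_j) q`. The interval is arbitrary because the lemma serves both local solutions
and global ones. -/
lemma hasSpectralData_evolve {K : ℕ} {m ζ b : ℕ → ℝ} {x : ℝ → ℕ → ℝ} {I : Set ℝ} {t₀ : ℝ}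
    (hζ : Set.InjOn ζ (Finset.Icc 1 K)) (h0 : ∀ j ∈ Finset.Icc 1 K, ζ j ≠ 0)
    (hb : ∀ j ∈ Finset.Icc 1 K, b j ≠ 0) (hI : IsOpen I) (hI' : IsPreconnected I) (ht₀ : t₀ ∈ I)
    (hx : ∀ t ∈ I, ∀ j, 1 ≤ j → j ≤ 2 * K →
      HasDerivAt (fun s => x s j) (orderedField (2 * K) m (x t) j) t)
    (h : HasSpectralData K m (x t₀) ζ (residueAt ζ b t₀)) :
    ∀ t ∈ I, HasSpectralData K m (x t) ζ (residueAt ζ b t) := by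
  have hbt : ∀ t, ∀ j ∈ Finset.Icc 1 K, residueAt ζ b t j ≠ 0 :=
    fun t j hj => mul_ne_zero (hb j hj) (Real.exp_pos _).ne'
  have hconst : ∀ f : ℝ → ℝ, (∀ t ∈ I, HasDerivAt f 0 t) → ∀ t ∈ I, f t = f t₀ := fun f hf t ht =>
    hI.is_const_of_deriv_eq_zero hI' (fun s hs => (hf s hs).differentiableAt.differentiableWithinAt)
      (fun s hs => (hf s hs).deriv) ht ht₀
  rw [hasSpectralData_iff hζ h0 (hbt t₀)] at h
  intro t ht
  rw [hasSpectralData_iff hζ h0 (hbt t)]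
  intro j hj
  have hp : ∀ t ∈ I, (qp m (x t) (2 * K)).2.eval (ζ j) = 0 := by
    intro t ht
    rw [← (h j hj).1]
    refine hconst (fun s => (qp m (x s) (2 * K)).2.eval (ζ j)) (fun s hs => ?_) t ht
    refine (hasDerivAt_qp (h0 j hj) (hx s hs) le_rfl).2.congr_deriv ?_
    rw [gSum_top]; ring
  refine ⟨hp t ht, ?_⟩
  have hq := hconst (fun s => (qp m (x s) (2 * K)).1.eval (ζ j) * Real.exp (-(2 * s / ζ j)))
    (fun s hs => by
      have h1 := (hasDerivAt_qp (h0 j hj) (hx s hs) le_rfl).1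
      have h2 : HasDerivAt (fun s : ℝ => -(2 * s / ζ j)) (-(2 * 1 / ζ j)) s :=
        (((hasDerivAt_id s).const_mul 2).div_const (ζ j)).neg
      refine (h1.mul h2.exp).congr_deriv ?_
      rw [gSum_top, hp s hs]
      ring) t ht
  simp only [(h j hj).2, residueAt] at hq ⊢
  rw [Real.exp_neg, Real.exp_neg] at hq
  have e1 := Real.exp_pos (2 * t / ζ j)
  have e2 := Real.exp_pos (2 * t₀ / ζ j)
  rw [← div_eq_mul_inv, div_eq_iff e1.ne'] at hq
  rw [hq]
  field_simp

/-! ### The explicit solution -/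

lemma qp_congr {n : ℕ} {m x y : ℕ → ℝ} (h : ∀ k, 1 ≤ k → k ≤ n → x k = y k) :
    qp m x n = qp m y n := by
  induction n with
  | zero => rfl
  | succ n ih =>
    rw [qp, qp, ih fun k hk hk' => h k hk (by omega), h (n + 1) (by omega) le_rfl]

lemma HasSpectralData.congr {K : ℕ} {m x y ζ b : ℕ → ℝ} (hx : HasSpectralData K m x ζ b)
    (h : ∀ k, 1 ≤ k → k ≤ 2 * K → x k = y k) : HasSpectralData K m y ζ b := by
  rw [HasSpectralData, weyl, qp_congr fun k hk hk' => (h k hk hk').symm]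
  exact hx

/-- A vector indexed by `Fin n` as a family indexed from `1`. -/
def extend (n : ℕ) (y : Fin n → ℝ) (i : ℕ) : ℝ :=
  if h : 1 ≤ i ∧ i ≤ n then y ⟨i - 1, by omega⟩ else 0

lemma extend_succ {n : ℕ} (y : Fin n → ℝ) (i : Fin n) : extend n y (i + 1) = y i := by
  rw [extend, dif_pos ⟨by omega, i.2⟩]
  rfl

lemma contDiff_extend (n i : ℕ) : ContDiff ℝ 1 fun y : Fin n → ℝ => extend n y i := by
  unfold extend
  split_ifs with h
  · exact contDiff_apply ℝ ℝ _
  · exact contDiff_const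

lemma contDiff_orderedField (n : ℕ) (m : ℕ → ℝ) :
    ContDiff ℝ 1 fun y : Fin n → ℝ => fun j : Fin n => orderedField n m (extend n y) (j + 1) := by
  refine contDiff_pi.2 fun j => ?_
  have h1 : ∀ i, ContDiff ℝ 1 fun y : Fin n → ℝ => m i * Real.exp (extend n y i) :=
    fun i => contDiff_const.mul (contDiff_extend n i).exp
  have h2 : ∀ i, ContDiff ℝ 1 fun y : Fin n → ℝ => m i * Real.exp (-extend n y i) :=
    fun i => contDiff_const.mul (contDiff_extend n i).neg.exp
  have h3 : ∀ k, ContDiff ℝ 1 fun y : Fin n → ℝ => hSum m (extend n y) k :=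
    fun k => ContDiff.sum fun i _ => h1 i
  have h4 : ∀ k, ContDiff ℝ 1 fun y : Fin n → ℝ => gSum n m (extend n y) k :=
    fun k => ContDiff.sum fun i _ => h2 i
  exact (contDiff_const.mul (((h2 _).mul (h3 _)).add ((h1 _).mul (h4 _)))).add
    (contDiff_const.mul ((h3 _).mul (h4 _)))

lemma orderedField_congr {n : ℕ} {m x y : ℕ → ℝ} (h : ∀ k, 1 ≤ k → k ≤ n → x k = y k) {j : ℕ}
    (h1 : 1 ≤ j) (hj : j ≤ n) : orderedField n m x j = orderedField n m y j := by
  have hh : hSum m x (j - 1) = hSum m y (j - 1) := Finset.sum_congr rfl fun i hi => by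
    rw [Finset.mem_Icc] at hi
    rw [h i hi.1 (by omega)]
  have hg : gSum n m x j = gSum n m y j := Finset.sum_congr rfl fun i hi => by
    rw [Finset.mem_Icc] at hi
    rw [h i (by omega) hi.2]
  rw [orderedField, orderedField, hh, hg, h j h1 hj]

lemma residueAt_pos {K : ℕ} {ζ b : ℕ → ℝ} (hb : ∀ j ∈ Finset.Icc 1 K, 0 < b j) (t : ℝ) :
    ∀ j ∈ Finset.Icc 1 K, 0 < residueAt ζ b t j :=
  fun j hj => mul_pos (hb j hj) (Real.exp_pos _)

/-- A local solution of the smooth field through `position` has the evolved spectral data, and the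
configuration with given data is unique; so near `t₀` the solution is `position` itself. No ordering
is needed, since `orderedField` has no absolute values. -/
theorem hasDerivAt_position {K : ℕ} {m ζ b : ℕ → ℝ} (hm : ∀ k, 1 ≤ k → k ≤ 2 * K → 0 < m k)
    (hζ : Set.InjOn ζ (Finset.Icc 1 K)) (hpos : ∀ j ∈ Finset.Icc 1 K, 0 < ζ j)
    (hb : ∀ j ∈ Finset.Icc 1 K, 0 < b j) (t₀ : ℝ) {j : ℕ} (h1 : 1 ≤ j) (hj : j ≤ 2 * K) :
    HasDerivAt (fun t => position K m ζ (residueAt ζ b t) j)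
      (orderedField (2 * K) m (position K m ζ (residueAt ζ b t₀)) j) t₀ := by
  set X : ℝ → ℕ → ℝ := fun t => position K m ζ (residueAt ζ b t) with hX
  have hXs : ∀ t, HasSpectralData K m (X t) ζ (residueAt ζ b t) :=
    fun t => position_hasSpectralData hm hζ hpos (residueAt_pos hb t)
  obtain ⟨α, hα0, ε, hε, hα⟩ :=
    ((contDiff_orderedField (2 * K) m).contDiffAt
      (x := fun i : Fin (2 * K) => X t₀ (i + 1))).exists_forall_mem_closedBall_exists_eq_forall_mem_Ioo_hasDerivAt₀ t₀
  have hext : ∀ k, 1 ≤ k → k ≤ 2 * K → ∀ y : Fin (2 * K) → ℝ, ∃ i : Fin (2 * K),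
      k = i + 1 ∧ extend (2 * K) y k = y i := by
    intro k hk hk' y
    refine ⟨⟨k - 1, by omega⟩, by simp; omega, ?_⟩
    rw [extend, dif_pos ⟨hk, hk'⟩]
  have h0 : ∀ k, 1 ≤ k → k ≤ 2 * K → X t₀ k = extend (2 * K) (α t₀) k := by
    intro k hk hk'
    obtain ⟨i, hi, he⟩ := hext k hk hk' (α t₀)
    rw [he, hα0, hi]
  have ht₀ : t₀ ∈ Set.Ioo (t₀ - ε) (t₀ + ε) := ⟨by linarith, by linarith⟩
  have hder : ∀ t ∈ Set.Ioo (t₀ - ε) (t₀ + ε), ∀ k, 1 ≤ k → k ≤ 2 * K →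
      HasDerivAt (fun s => extend (2 * K) (α s) k)
        (orderedField (2 * K) m (extend (2 * K) (α t)) k) t := by
    intro t ht k hk hk'
    obtain ⟨i, hi, -⟩ := hext k hk hk' (α t)
    subst hi
    have := hasDerivAt_pi.1 (hα t ht) i
    simpa only [extend_succ] using this
  have hspec := hasSpectralData_evolve (x := fun t => extend (2 * K) (α t)) hζ
    (fun j hj => (hpos j hj).ne') (fun j hj => (hb j hj).ne') isOpen_Ioo isPreconnected_Ioo ht₀ hder
    ((hXs t₀).congr h0)
  have heq : (fun t => X t j) =ᶠ[𝓝 t₀] fun t => extend (2 * K) (α t) j := by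
    filter_upwards [Ioo_mem_nhds ht₀.1 ht₀.2] with t ht
    exact (hXs t).unique hm (hspec t ht) j h1 hj
  rw [orderedField_congr h0 h1 hj]
  exact (hder t₀ ht₀ j h1 hj).congr_of_eventuallyEq heq

/-- Ordering lets the peakon field be replaced by `orderedField`; then the evolved data determine
the configuration at each time. -/
theorem IsGlobalMultipeakon.eq_position {K : ℕ} {m ζ b : ℕ → ℝ} {y : ℝ → ℕ → ℝ}
    (hm : ∀ k, 1 ≤ k → k ≤ 2 * K → 0 < m k)
    (hζ : Set.InjOn ζ (Finset.Icc 1 K)) (hpos : ∀ j ∈ Finset.Icc 1 K, 0 < ζ j)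
    (hb : ∀ j ∈ Finset.Icc 1 K, 0 < b j) (hy : IsGlobalMultipeakon (2 * K) m y)
    (h0 : HasSpectralData K m (y 0) ζ b) (t : ℝ) {k : ℕ} (h1 : 1 ≤ k) (hk : k ≤ 2 * K) :
    y t k = position K m ζ (residueAt ζ b t) k := by
  have hres : residueAt ζ b 0 = b := by funext j; simp [residueAt]
  have := hasSpectralData_evolve (b := b) (t₀ := 0) hζ (fun j hj => (hpos j hj).ne')
    (fun j hj => (hb j hj).ne') isOpen_univ isPreconnected_univ (Set.mem_univ _)
    (fun t _ j hj hj' => by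
      rw [← peakonField_eq_orderedField (hy.ordered t) hj hj']
      exact hy.evolves t j hj hj') (by rwa [hres])
  exact (this t (Set.mem_univ _)).unique hm
    (position_hasSpectralData hm hζ hpos (residueAt_pos hb t)) k h1 hk

/-! ### Ordering of the peakons under the mass condition -/

lemma le_heineSum_mul {S : Finset ℕ} {ζ w : ℕ → ℝ} {a : ℝ} (d : ℕ) (hζ : Set.InjOn ζ S)
    (hw : ∀ j ∈ S, 0 < w j) (ha : 0 ≤ a) (h : ∀ j ∈ S, a ≤ ζ j) :
    a ^ d * heineSum S ζ w d ≤ heineSum S ζ (fun j => ζ j * w j) d := by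
  rw [heineSum, heineSum, Finset.mul_sum]
  refine Finset.sum_le_sum fun J hJ => ?_
  rw [Finset.mem_powersetCard] at hJ
  have h1 : a ^ d ≤ ∏ j ∈ J, ζ j := by
    rw [← hJ.2, ← Finset.prod_const]
    exact Finset.prod_le_prod (fun _ _ => ha) fun j hj => h j (hJ.1 hj)
  have h2 : 0 < ∏ j ∈ J, w j := Finset.prod_pos fun j hj => hw j (hJ.1 hj)
  have h3 := vdmSq_pos hζ hJ.1
  rw [Finset.prod_mul_distrib]
  calc a ^ d * (vdmSq ζ J * ∏ j ∈ J, w j) = vdmSq ζ J * (a ^ d * ∏ j ∈ J, w j) := by ring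
    _ ≤ _ := by gcongr

lemma heineSum_mul_le {S : Finset ℕ} {ζ w : ℕ → ℝ} {A : ℝ} (d : ℕ) (hζ : Set.InjOn ζ S)
    (hpos : ∀ j ∈ S, 0 < ζ j) (hw : ∀ j ∈ S, 0 < w j) (h : ∀ j ∈ S, ζ j ≤ A) :
    heineSum S ζ (fun j => ζ j * w j) d ≤ A ^ d * heineSum S ζ w d := by
  rw [heineSum, heineSum, Finset.mul_sum]
  refine Finset.sum_le_sum fun J hJ => ?_
  rw [Finset.mem_powersetCard] at hJ
  have h1 : ∏ j ∈ J, ζ j ≤ A ^ d := by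
    rw [← hJ.2, ← Finset.prod_const]
    exact Finset.prod_le_prod (fun j hj => (hpos j (hJ.1 hj)).le) fun j hj => h j (hJ.1 hj)
  have h2 : 0 < ∏ j ∈ J, w j := Finset.prod_pos fun j hj => hw j (hJ.1 hj)
  have h3 := vdmSq_pos hζ hJ.1
  rw [Finset.prod_mul_distrib]
  calc vdmSq ζ J * ((∏ j ∈ J, ζ j) * ∏ j ∈ J, w j) ≤ vdmSq ζ J * (A ^ d * ∏ j ∈ J, w j) := by gcongr
    _ = _ := by ring

/-- Moving an element from a set of size `d + 2` to a set of size `d`. -/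
lemma sum_powersetCard_exchange {S : Finset ℕ} {d : ℕ} {f g u v : Finset ℕ → ℝ} {C : ℝ}
    (hu : ∀ A ∈ S.powersetCard (d + 1), 0 ≤ u A) (hv : ∀ A ∈ S.powersetCard (d + 1), 0 ≤ v A)
    (hC : 0 ≤ C)
    (h : ∀ I ∈ S.powersetCard d, ∀ J ∈ S.powersetCard (d + 2), ∀ j ∈ J \ I,
      f I * g J ≤ C * (u (insert j I) * v (J.erase j))) :
    (∑ I ∈ S.powersetCard d, f I) * ∑ J ∈ S.powersetCard (d + 2), g J ≤
      C * ((d + 1) * ((∑ A ∈ S.powersetCard (d + 1), u A) * ∑ B ∈ S.powersetCard (d + 1), v B)) := by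
  classical
  have hins : ∀ I ∈ S.powersetCard d, ∀ j ∈ S, j ∉ I → insert j I ∈ S.powersetCard (d + 1) := by
    intro I hI j hj hjI
    rw [Finset.mem_powersetCard] at hI ⊢
    exact ⟨Finset.insert_subset hj hI.1, by rw [Finset.card_insert_of_notMem hjI, hI.2]⟩
  have hers : ∀ J ∈ S.powersetCard (d + 2), ∀ j ∈ J, J.erase j ∈ S.powersetCard (d + 1) := by
    intro J hJ j hj
    rw [Finset.mem_powersetCard] at hJ ⊢
    exact ⟨(Finset.erase_subset _ _).trans hJ.1, by rw [Finset.card_erase_of_mem hj, hJ.2]; rfl⟩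
  set X := ((S.powersetCard d ×ˢ S.powersetCard (d + 2)) ×ˢ S).filter
    fun p => p.2 ∈ p.1.2 ∧ p.2 ∉ p.1.1 with hX
  set Y := ((S.powersetCard (d + 1) ×ˢ S.powersetCard (d + 1)) ×ˢ S).filter
    fun p => p.2 ∈ p.1.1 with hY
  let φ : (Finset ℕ × Finset ℕ) × ℕ → (Finset ℕ × Finset ℕ) × ℕ :=
    fun p => ((insert p.2 p.1.1, p.1.2.erase p.2), p.2)
  -- `J` is larger than `I`, so some `j` can be moved. One admissible `j` already bounds the term;
  -- the sum over all of them only adds nonnegative terms.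
  have h1 : (∑ I ∈ S.powersetCard d, f I) * ∑ J ∈ S.powersetCard (d + 2), g J ≤
      ∑ p ∈ X, C * (u (insert p.2 p.1.1) * v (p.1.2.erase p.2)) := by
    rw [hX, Finset.sum_filter, Finset.sum_product, Finset.sum_product, Finset.sum_mul_sum]
    refine Finset.sum_le_sum fun I hI => Finset.sum_le_sum fun J hJ => ?_
    have hI' := Finset.mem_powersetCard.1 hI
    have hJ' := Finset.mem_powersetCard.1 hJ
    obtain ⟨j, hjJ, hjI⟩ := Finset.exists_mem_notMem_of_card_lt_card (s := I) (t := J) (by omega)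
    refine (h I hI J hJ j (Finset.mem_sdiff.2 ⟨hjJ, hjI⟩)).trans ?_
    refine le_trans (le_of_eq ?_) (Finset.single_le_sum
      (f := fun j => if j ∈ J ∧ j ∉ I then C * (u (insert j I) * v (J.erase j)) else 0)
      (fun i hi => ?_) (hJ'.1 hjJ))
    · simp only [if_pos (And.intro hjJ hjI)]
    · split_ifs with hc
      · exact mul_nonneg hC (mul_nonneg (hu _ (hins I hI i hi hc.2)) (hv _ (hers J hJ i hc.1)))
      · exact le_rfl
  -- Keeping the moved element as a mark makes the exchange reversible.
  have hinj : Set.InjOn φ X := by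
    rintro ⟨⟨I, J⟩, j⟩ hp ⟨⟨I', J'⟩, j'⟩ hp' heq
    simp only [hX, Finset.coe_filter, Set.mem_ofPred_eq] at hp hp'
    simp only [φ, Prod.mk.injEq] at heq
    obtain ⟨⟨e1, e2⟩, rfl⟩ := heq
    have e3 : I = I' := by
      rw [← Finset.erase_insert hp.2.2, e1, Finset.erase_insert hp'.2.2]
    have e4 : J = J' := by
      rw [← Finset.insert_erase hp.2.1, e2, Finset.insert_erase hp'.2.1]
    rw [e3, e4]
  have h2 : ∑ p ∈ X, C * (u (insert p.2 p.1.1) * v (p.1.2.erase p.2)) ≤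
      ∑ p ∈ Y, C * (u p.1.1 * v p.1.2) := by
    rw [← Finset.sum_image (f := fun p => C * (u p.1.1 * v p.1.2)) hinj]
    refine Finset.sum_le_sum_of_subset_of_nonneg ?_ ?_
    · intro q hq
      rw [Finset.mem_image] at hq
      obtain ⟨⟨⟨I, J⟩, j⟩, hp, rfl⟩ := hq
      simp only [hX, Finset.mem_filter, Finset.mem_product] at hp
      simp only [hY, φ, Finset.mem_filter, Finset.mem_product]
      exact ⟨⟨⟨hins I hp.1.1.1 j hp.1.2 hp.2.2, hers J hp.1.1.2 j hp.2.1⟩, hp.1.2⟩,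
        Finset.mem_insert_self _ _⟩
    · rintro ⟨⟨A, B⟩, j⟩ hp _
      simp only [hY, Finset.mem_filter, Finset.mem_product] at hp
      exact mul_nonneg hC (mul_nonneg (hu _ hp.1.1.1) (hv _ hp.1.1.2))
  -- Each `A` has `d + 1` elements that can be the mark; this is the factor `d + 1`.
  have h3 : ∑ p ∈ Y, C * (u p.1.1 * v p.1.2) = C * ((d + 1) *
      ((∑ A ∈ S.powersetCard (d + 1), u A) * ∑ B ∈ S.powersetCard (d + 1), v B)) := by
    rw [hY, Finset.sum_filter, Finset.sum_product, Finset.sum_product, Finset.sum_mul_sum,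
      Finset.mul_sum, Finset.mul_sum]
    refine Finset.sum_congr rfl fun A hA => ?_
    rw [Finset.mul_sum, Finset.mul_sum]
    refine Finset.sum_congr rfl fun B _ => ?_
    rw [Finset.mem_powersetCard] at hA
    have : S.filter (fun j => j ∈ A) = A := by
      ext j; simp only [Finset.mem_filter]; exact ⟨fun h => h.2, fun h => ⟨hA.1 h, h⟩⟩
    rw [← Finset.sum_filter, this]
    simp only [Finset.sum_const, hA.2, nsmul_eq_mul]
    push_cast; ring
  exact (h1.trans h2).trans h3.le

/-- Moving `j` from `J` to `I` creates at least `gap ^ (2d)` in one squared Vandermonde, destroys at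
most `D ^ (2(d+1))` in the other, and changes a weight `v_j` to `w_j` at cost `c`. The powers of `a`
and `A` pay for node products present on one side only; `a` and `gap` stay on the left to avoid
division. -/
lemma heineSum_exchange {S : Finset ℕ} {ζ w v : ℕ → ℝ} {a A c D gap : ℝ} (d : ℕ)
    (hζ : Set.InjOn ζ S) (hpos : ∀ j ∈ S, 0 < ζ j) (hw : ∀ j ∈ S, 0 < w j) (hv : ∀ j ∈ S, 0 < v j)
    (hvw : ∀ j ∈ S, v j ≤ c * w j) (ha : 0 ≤ a) (haζ : ∀ j ∈ S, a ≤ ζ j) (hA : 0 ≤ A)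
    (hAζ : ∀ j ∈ S, ζ j ≤ A)
    (hc : 0 ≤ c) (hgap : 0 ≤ gap) (hD : ∀ i ∈ S, ∀ j ∈ S, |ζ i - ζ j| ≤ D)
    (hgapζ : ∀ i ∈ S, ∀ j ∈ S, i ≠ j → gap ≤ |ζ i - ζ j|) :
    a ^ (d + 1) * gap ^ (2 * d) *
        (heineSum S ζ (fun j => ζ j * w j) d * heineSum S ζ v (d + 2)) ≤
      A ^ d * c * D ^ (2 * (d + 1)) * ((d + 1) *
        (heineSum S ζ w (d + 1) * heineSum S ζ (fun j => ζ j * v j) (d + 1))) := by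
  have hC : 0 ≤ A ^ d * c * D ^ (2 * (d + 1)) := by
    have : 0 ≤ D ^ (2 * (d + 1)) := by rw [pow_mul']; exact sq_nonneg _
    positivity
  have key := sum_powersetCard_exchange (S := S) (d := d)
    (f := fun I => a ^ (d + 1) * gap ^ (2 * d) * (vdmSq ζ I * ∏ j ∈ I, (ζ j * w j)))
    (g := fun J => vdmSq ζ J * ∏ j ∈ J, v j)
    (u := fun I => vdmSq ζ I * ∏ j ∈ I, w j) (v := fun J => vdmSq ζ J * ∏ j ∈ J, (ζ j * v j))
    (C := A ^ d * c * D ^ (2 * (d + 1)))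
    (fun I hI => by
      rw [Finset.mem_powersetCard] at hI
      exact mul_nonneg (vdmSq_pos hζ hI.1).le (Finset.prod_nonneg fun j hj => (hw j (hI.1 hj)).le))
    (fun I hI => by
      rw [Finset.mem_powersetCard] at hI
      exact mul_nonneg (vdmSq_pos hζ hI.1).le (Finset.prod_nonneg fun j hj =>
        (mul_pos (hpos j (hI.1 hj)) (hv j (hI.1 hj))).le)) hC ?_
  · rw [← Finset.mul_sum] at key
    rw [mul_assoc] at key ⊢
    simpa only [heineSum, mul_assoc] using key
  · intro I hI J hJ j hj
    rw [Finset.mem_powersetCard] at hI hJ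
    rw [Finset.mem_sdiff] at hj
    obtain ⟨hjJ, hjI⟩ := hj
    have hjS := hJ.1 hjJ
    have hEc : (J.erase j).card = d + 1 := by rw [Finset.card_erase_of_mem hjJ, hJ.2]; rfl
    have hES : ∀ i ∈ J.erase j, i ∈ S := fun i hi => hJ.1 (Finset.mem_of_mem_erase hi)
    have b1 : gap ^ (2 * d) ≤ ∏ i ∈ I, (ζ i - ζ j) ^ 2 := by
      rw [pow_mul, ← hI.2, ← Finset.prod_const]
      refine Finset.prod_le_prod (fun _ _ => sq_nonneg _) fun i hi => ?_
      rw [← sq_abs (ζ i - ζ j)]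
      exact pow_le_pow_left₀ hgap (hgapζ i (hI.1 hi) j hjS fun h => hjI (h ▸ hi)) 2
    have b2 : ∏ i ∈ J.erase j, (ζ i - ζ j) ^ 2 ≤ D ^ (2 * (d + 1)) := by
      rw [pow_mul, ← hEc, ← Finset.prod_const]
      refine Finset.prod_le_prod (fun _ _ => sq_nonneg _) fun i hi => ?_
      rw [← sq_abs (ζ i - ζ j)]
      exact pow_le_pow_left₀ (abs_nonneg _) (hD i (hES i hi) j hjS) 2
    have b3 : a ^ (d + 1) ≤ ∏ i ∈ J.erase j, ζ i := by
      rw [← hEc, ← Finset.prod_const]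
      exact Finset.prod_le_prod (fun _ _ => ha) fun i hi => haζ i (hES i hi)
    have b4 : ∏ i ∈ I, ζ i ≤ A ^ d := by
      rw [← hI.2, ← Finset.prod_const]
      exact Finset.prod_le_prod (fun i hi => (hpos i (hI.1 hi)).le) fun i hi => hAζ i (hI.1 hi)
    have b5 := hvw j hjS
    have hVJ : vdmSq ζ J = vdmSq ζ (J.erase j) * ∏ i ∈ J.erase j, (ζ i - ζ j) ^ 2 := by
      conv_lhs => rw [← Finset.insert_erase hjJ, vdmSq_insert ζ (Finset.notMem_erase j J)]
    rw [hVJ, vdmSq_insert ζ hjI, Finset.prod_insert hjI, Finset.prod_mul_distrib,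
      Finset.prod_mul_distrib, ← Finset.mul_prod_erase J v hjJ]
    have v1 := (vdmSq_pos hζ hI.1).le
    have v2 := (vdmSq_pos (J := J.erase j) hζ hES).le
    have w1 : 0 ≤ ∏ i ∈ I, w i := Finset.prod_nonneg fun i hi => (hw i (hI.1 hi)).le
    have w2 : 0 ≤ ∏ i ∈ J.erase j, v i := Finset.prod_nonneg fun i hi => (hv i (hES i hi)).le
    have w3 : 0 ≤ ∏ i ∈ I, ζ i := Finset.prod_nonneg fun i hi => (hpos i (hI.1 hi)).le
    have w4 : 0 ≤ ∏ i ∈ J.erase j, ζ i := Finset.prod_nonneg fun i hi => (hpos i (hES i hi)).le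
    have w5 := (hv j hjS).le
    have w6 := (hw j hjS).le
    have w7 : 0 ≤ ∏ i ∈ J.erase j, (ζ i - ζ j) ^ 2 := Finset.prod_nonneg fun _ _ => sq_nonneg _
    have w8 : 0 ≤ ∏ i ∈ I, (ζ i - ζ j) ^ 2 := Finset.prod_nonneg fun _ _ => sq_nonneg _
    have w9 : 0 ≤ D ^ (2 * (d + 1)) := w7.trans b2
    generalize (∏ i ∈ I, (ζ i - ζ j) ^ 2) = r1 at *
    generalize (∏ i ∈ J.erase j, (ζ i - ζ j) ^ 2) = r2 at *
    generalize (∏ i ∈ I, w i) = r3 at *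
    generalize (∏ i ∈ J.erase j, v i) = r4 at *
    generalize (∏ i ∈ I, ζ i) = r5 at *
    generalize (∏ i ∈ J.erase j, ζ i) = r6 at *
    calc a ^ (d + 1) * gap ^ (2 * d) * (vdmSq ζ I * (r5 * r3)) *
          (vdmSq ζ (J.erase j) * r2 * (v j * r4))
        = (vdmSq ζ I * vdmSq ζ (J.erase j) * r3 * r4) *
          (a ^ (d + 1) * gap ^ (2 * d) * r5 * r2 * v j) := by ring
      _ ≤ (vdmSq ζ I * vdmSq ζ (J.erase j) * r3 * r4) *
          (r6 * r1 * A ^ d * D ^ (2 * (d + 1)) * (c * w j)) := by gcongr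
      _ = _ := by ring

lemma minGap_nonneg {K : ℕ} {ζ : ℕ → ℝ} (hζ_lt : ∀ i j, 1 ≤ i → i < j → j ≤ K → ζ i < ζ j) :
    0 ≤ minGap K ζ := by
  refine Real.sInf_nonneg ?_
  rintro _ ⟨j, hj, rfl⟩
  obtain ⟨h1, h2⟩ := hj
  exact (sub_pos.2 (hζ_lt j (j + 1) h1 (by omega) (by omega))).le

lemma minGap_le {K : ℕ} {ζ : ℕ → ℝ} (hζ_lt : ∀ i j, 1 ≤ i → i < j → j ≤ K → ζ i < ζ j) {i j : ℕ}
    (hi : 1 ≤ i) (hij : i < j) (hj : j ≤ K) : minGap K ζ ≤ ζ j - ζ i := by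
  have h1 : minGap K ζ ≤ ζ (i + 1) - ζ i :=
    csInf_le ((Set.finite_Icc 1 (K - 1)).image _).bddBelow ⟨i, ⟨hi, by omega⟩, rfl⟩
  have h2 : ζ (i + 1) ≤ ζ j := by
    rcases Nat.lt_or_ge (i + 1) j with h | h
    · exact (hζ_lt _ _ (by omega) h hj).le
    · rw [show i + 1 = j by omega]
  linarith

/-! ### Ratios of neighbouring momenta and the mass condition -/

section

variable {K : ℕ} {m ζ b : ℕ → ℝ}

/-- The two Heine sums shared by neighbouring momenta cancel, and the extra factor `e_k` of `eProd`
becomes the inverse square of a mass. The even case works the same way with different orders. -/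
lemma momentum_eq_of_odd {k : ℕ} (hm : ∀ k, 1 ≤ k → k ≤ 2 * K → 0 < m k)
    (hζ : Set.InjOn ζ (Finset.Icc 1 K)) (hpos : ∀ j ∈ Finset.Icc 1 K, 0 < ζ j)
    (hb : ∀ j ∈ Finset.Icc 1 K, 0 < b j) {d : ℕ} (hkd : k = 2 * d + 1) (hk : k + 1 ≤ 2 * K) :
    momentum K m ζ b k = momentum K m ζ b (k + 1) * m (refl (2 * K) k) ^ 2 *
      (heineSum (Finset.Icc 1 K) ζ (wt (2 * K) m ζ b (k - 1)) d *
        heineSum (Finset.Icc 1 K) ζ (fun j => ζ j * wt (2 * K) m ζ b (k + 1) j) (d + 1) /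
      (heineSum (Finset.Icc 1 K) ζ (fun j => ζ j * wt (2 * K) m ζ b (k - 1) j) d *
        heineSum (Finset.Icc 1 K) ζ (wt (2 * K) m ζ b (k + 1)) (d + 1))) := by
  subst hkd
  rw [momentum, momentum,
    show (2 * d + 1) / 2 = d by omega, show (2 * d + 1 + 1) / 2 = d + 1 by omega,
    show (2 * d + 1 - 1) / 2 = d by omega, show (2 * d + 1 + 1 + 1) / 2 = d + 1 by omega,
    show (2 * d + 1 + 1 - 1) / 2 = d by omega, show 2 * d + 1 + 1 - 1 = 2 * d + 1 by omega,
    show 2 * d + 1 - 1 = 2 * d by omega, eProd_succ, e]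
  have q1 := hm (refl (2 * K) (2 * d + 1)) (by unfold refl; omega) (by unfold refl; omega)
  have q2 := heineSum_wt_pos hm hζ hpos hb (k := 2 * d + 1) (d := d + 1) (by omega) (by omega)
  have q3 := heineSum_wt_pos hm hζ hpos hb (k := 2 * d + 1 + 1) (d := d + 1) (by omega) (by omega)
  have q4 := heineSum_mul_wt_pos hm hζ hpos hb (k := 2 * d + 1 + 1) (d := d + 1) (by omega) (by omega)
  have q5 := heineSum_mul_wt_pos hm hζ hpos hb (k := 2 * d + 1) (d := d) (by omega) (by omega)
  have q6 := heineSum_mul_wt_pos hm hζ hpos hb (k := 2 * d) (d := d) (by omega) (by omega)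
  field_simp

lemma momentum_eq_of_even {k : ℕ} (hm : ∀ k, 1 ≤ k → k ≤ 2 * K → 0 < m k)
    (hζ : Set.InjOn ζ (Finset.Icc 1 K)) (hpos : ∀ j ∈ Finset.Icc 1 K, 0 < ζ j)
    (hb : ∀ j ∈ Finset.Icc 1 K, 0 < b j) {d : ℕ} (hkd : k = 2 * d + 2) (hk : k + 1 ≤ 2 * K) :
    momentum K m ζ b k = momentum K m ζ b (k + 1) * m (refl (2 * K) k) ^ 2 *
      (heineSum (Finset.Icc 1 K) ζ (wt (2 * K) m ζ b (k - 1)) (d + 1) *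
        heineSum (Finset.Icc 1 K) ζ (fun j => ζ j * wt (2 * K) m ζ b (k + 1) j) (d + 1) /
      (heineSum (Finset.Icc 1 K) ζ (fun j => ζ j * wt (2 * K) m ζ b (k - 1) j) d *
        heineSum (Finset.Icc 1 K) ζ (wt (2 * K) m ζ b (k + 1)) (d + 2))) := by
  subst hkd
  rw [momentum, momentum,
    show (2 * d + 2) / 2 = d + 1 by omega, show (2 * d + 2 + 1) / 2 = d + 1 by omega,
    show (2 * d + 2 - 1) / 2 = d by omega, show (2 * d + 2 + 1 + 1) / 2 = d + 2 by omega,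
    show (2 * d + 2 + 1 - 1) / 2 = d + 1 by omega, show 2 * d + 2 + 1 - 1 = 2 * d + 1 + 1 by omega,
    show 2 * d + 2 - 1 = 2 * d + 1 by omega, eProd_succ _ (2 * d + 1), e, show 2 * d + 2 = 2 * d + 1 + 1 by omega]
  have q1 := hm (refl (2 * K) (2 * d + 1 + 1)) (by unfold refl; omega) (by unfold refl; omega)
  have q2 := heineSum_wt_pos hm hζ hpos hb (k := 2 * d + 1 + 1) (d := d + 1) (by omega) (by omega)
  have q3 := heineSum_wt_pos hm hζ hpos hb (k := 2 * d + 1 + 1 + 1) (d := d + 2) (by omega) (by omega)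
  have q4 := heineSum_mul_wt_pos hm hζ hpos hb (k := 2 * d + 1 + 1) (d := d + 1) (by omega) (by omega)
  have q5 := heineSum_mul_wt_pos hm hζ hpos hb (k := 2 * d + 1) (d := d) (by omega) (by omega)
  have q6 := heineSum_mul_wt_pos hm hζ hpos hb (k := 2 * d + 1 + 1 + 1) (d := d + 1)
    (by omega) (by omega)
  field_simp

lemma position_lt_of_momentum {k : ℕ} {R : ℝ} (hm : ∀ k, 1 ≤ k → k ≤ 2 * K → 0 < m k)
    (hζ : Set.InjOn ζ (Finset.Icc 1 K)) (hpos : ∀ j ∈ Finset.Icc 1 K, 0 < ζ j)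
    (hb : ∀ j ∈ Finset.Icc 1 K, 0 < b j) (h1 : 1 ≤ k) (hk : k + 1 ≤ 2 * K)
    (hR : momentum K m ζ b k = momentum K m ζ b (k + 1) * m (refl (2 * K) k) ^ 2 * R)
    (hR1 : 1 < m (refl (2 * K) (k + 1)) * m (refl (2 * K) k) * R) :
    position K m ζ b (refl (2 * K) (k + 1)) < position K m ζ b (refl (2 * K) k) := by
  have q1 := hm (refl (2 * K) k) (by unfold refl; omega) (by unfold refl; omega)
  have q2 := hm (refl (2 * K) (k + 1)) (by unfold refl; omega) (by unfold refl; omega)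
  have p1 := momentum_pos hm hζ hpos hb (k := k + 1) hk
  rw [position, position, refl_refl (by omega), refl_refl (by omega)]
  refine Real.log_lt_log (div_pos p1 q2) ?_
  rw [div_lt_div_iff₀ q2 q1, hR]
  have := mul_lt_mul_of_pos_left hR1 (mul_pos p1 q1)
  linarith

/-- With `k = 2d + 1`, both quotients of Heine sums have equal orders above and below, so inserting
`ζ` costs between `ζ_1 ^ (d+1)` and `ζ_K ^ d`. This is the threshold in the lower mass bound. -/
lemma position_lt_of_odd {k : ℕ} (hm : ∀ k, 1 ≤ k → k ≤ 2 * K → 0 < m k) (hζ_pos : 0 < ζ 1)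
    (hζ_lt : ∀ i j, 1 ≤ i → i < j → j ≤ K → ζ i < ζ j)
    (hpos : ∀ j ∈ Finset.Icc 1 K, 0 < ζ j)
    (hb : ∀ j ∈ Finset.Icc 1 K, 0 < b j) (hcond : MassCondition K m ζ)
    (hodd : Odd k) (hk : k + 1 ≤ 2 * K) :
    position K m ζ b (refl (2 * K) (k + 1)) < position K m ζ b (refl (2 * K) k) := by
  have hlow := hcond.lower k hodd hk
  have hζ := injOn_of_lt hζ_lt
  obtain ⟨d, rfl⟩ := hodd
  have hR := momentum_eq_of_odd hm hζ hpos hb (k := 2 * d + 1) rfl hk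
  refine position_lt_of_momentum hm hζ hpos hb (by omega) hk hR ?_
  rw [show (2 * d + 1 - 1) / 2 = d by omega, show (2 * d + 1 + 1) / 2 = d + 1 by omega] at hlow
  have hle1 : ∀ j ∈ Finset.Icc 1 K, ζ 1 ≤ ζ j := fun j hj => by
    rw [Finset.mem_Icc] at hj
    rcases hj.1.eq_or_lt with h | h
    · rw [← h]
    · exact (hζ_lt 1 j le_rfl h hj.2).le
  have hleK : ∀ j ∈ Finset.Icc 1 K, ζ j ≤ ζ K := fun j hj => by
    rw [Finset.mem_Icc] at hj
    rcases hj.2.eq_or_lt with h | h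
    · rw [← h]
    · exact (hζ_lt j K hj.1 h le_rfl).le
  have hK : 0 < ζ K := hpos K (Finset.mem_Icc.2 ⟨by omega, le_rfl⟩)
  have t1 := le_heineSum_mul (d + 1) hζ
    (fun j hj => wt_pos hm hk (hpos j hj) (hb j hj)) hζ_pos.le hle1
  have t2 := heineSum_mul_le d hζ hpos
    (fun j hj => wt_pos hm (k := 2 * d + 1 - 1) (by omega) (hpos j hj) (hb j hj)) hleK
  have q1 := heineSum_wt_pos hm hζ hpos hb (k := 2 * d + 1 - 1) (d := d) (by omega) (by omega)
  have q2 := heineSum_wt_pos hm hζ hpos hb (k := 2 * d + 1 + 1) (d := d + 1) (by omega) (by omega)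
  have q3 := heineSum_mul_wt_pos hm hζ hpos hb (k := 2 * d + 1 + 1) (d := d + 1) (by omega) (by omega)
  have q4 := heineSum_mul_wt_pos hm hζ hpos hb (k := 2 * d + 1 - 1) (d := d) (by omega) (by omega)
  rw [div_lt_iff₀ (pow_pos hζ_pos _)] at hlow
  set M := m (refl (2 * K) (2 * d + 1 + 1)) * m (refl (2 * K) (2 * d + 1))
  set T1 := heineSum (Finset.Icc 1 K) ζ (wt (2 * K) m ζ b (2 * d + 1 - 1)) d
  set T2 := heineSum (Finset.Icc 1 K) ζ (wt (2 * K) m ζ b (2 * d + 1 + 1)) (d + 1)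
  set T3 := heineSum (Finset.Icc 1 K) ζ (fun j => ζ j * wt (2 * K) m ζ b (2 * d + 1 + 1) j) (d + 1)
  set T4 := heineSum (Finset.Icc 1 K) ζ (fun j => ζ j * wt (2 * K) m ζ b (2 * d + 1 - 1) j) d
  have hM : 0 < M := by
    by_contra hM
    have h1 := mul_nonpos_of_nonpos_of_nonneg (not_lt.1 hM) (pow_pos hζ_pos (d + 1)).le
    have h2 := pow_pos hK d
    linarith
  rw [← mul_div_assoc, lt_div_iff₀ (mul_pos q4 q2), one_mul]
  calc T4 * T2 ≤ ζ K ^ d * T1 * T2 := by gcongr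
    _ = ζ K ^ d * (T1 * T2) := by ring
    _ < M * ζ 1 ^ (d + 1) * (T1 * T2) := by
      exact mul_lt_mul_of_pos_right hlow (mul_pos q1 q2)
    _ = M * T1 * (ζ 1 ^ (d + 1) * T2) := by ring
    _ ≤ M * T1 * T3 := by gcongr
    _ = _ := by ring

/-- Here orders `d` and `d + 2` face `d + 1` and `d + 1`, so node bounds alone do not compare them;
`heineSum_exchange` does, and its constant is the one in the upper mass bound. -/
lemma position_lt_of_even {k : ℕ} (hm : ∀ k, 1 ≤ k → k ≤ 2 * K → 0 < m k) (hζ_pos : 0 < ζ 1)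
    (hζ_lt : ∀ i j, 1 ≤ i → i < j → j ≤ K → ζ i < ζ j)
    (hpos : ∀ j ∈ Finset.Icc 1 K, 0 < ζ j)
    (hb : ∀ j ∈ Finset.Icc 1 K, 0 < b j) (hcond : MassCondition K m ζ)
    (heven : Even k) (h1 : 1 ≤ k) (hk : k + 1 ≤ 2 * K) :
    position K m ζ b (refl (2 * K) (k + 1)) < position K m ζ b (refl (2 * K) k) := by
  have hζ := injOn_of_lt hζ_lt
  obtain ⟨d, rfl⟩ : ∃ d, k = 2 * d + 2 := by
    obtain ⟨r, hr⟩ := heven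
    exact ⟨r - 1, by omega⟩
  -- The upper condition at an odd index concerns the next two peakons, hence the index `k - 1`
  -- here.
  have hup := hcond.upper (2 * d + 1) ⟨d, rfl⟩ (by omega)
  have hR := momentum_eq_of_even hm hζ hpos hb (k := 2 * d + 2) rfl hk
  refine position_lt_of_momentum hm hζ hpos hb (by omega) hk hR ?_
  rw [show (2 * d + 1 - 1) / 2 = d by omega, show (2 * d + 1 + 1) / 2 = d + 1 by omega,
    show 2 * d + 1 - 1 = 2 * d by omega, show 2 * d + 1 + 1 = 2 * (d + 1) by ring,
    show 2 * d + 1 + 2 = 2 * d + 2 + 1 by ring, show 2 * (d + 1) = 2 * d + 2 by ring] at hup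
  push_cast at hup
  have hle1 : ∀ j ∈ Finset.Icc 1 K, ζ 1 ≤ ζ j := fun j hj => by
    rw [Finset.mem_Icc] at hj
    rcases hj.1.eq_or_lt with h | h
    · rw [← h]
    · exact (hζ_lt 1 j le_rfl h hj.2).le
  have hleK : ∀ j ∈ Finset.Icc 1 K, ζ j ≤ ζ K := fun j hj => by
    rw [Finset.mem_Icc] at hj
    rcases hj.2.eq_or_lt with h | h
    · rw [← h]
    · exact (hζ_lt j K hj.1 h le_rfl).le
  have hK : 0 < ζ K := hpos K (Finset.mem_Icc.2 ⟨by omega, le_rfl⟩)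
  have hD : 0 < ζ K - ζ 1 := sub_pos.2 (hζ_lt 1 K le_rfl (by omega) le_rfl)
  have m1 := hm (refl (2 * K) (2 * d + 2)) (by unfold refl; omega) (by unfold refl; omega)
  have m2 := hm (refl (2 * K) (2 * d + 2 + 1)) (by unfold refl; omega) (by unfold refl; omega)
  have e1 : e (2 * K) m (2 * d + 2) = 1 / m (refl (2 * K) (2 * d + 2)) ^ 2 := rfl
  have e2 : e (2 * K) m (2 * d + 2 + 1) = 1 / m (refl (2 * K) (2 * d + 2 + 1)) ^ 2 := rfl
  have hwpos : ∀ k ≤ 2 * K, ∀ j ∈ Finset.Icc 1 K, 0 < wt (2 * K) m ζ b k j :=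
    fun k hk j hj => wt_pos hm hk (hpos j hj) (hb j hj)
  have key := heineSum_exchange (S := Finset.Icc 1 K) (w := wt (2 * K) m ζ b (2 * d + 2 - 1))
    (v := wt (2 * K) m ζ b (2 * d + 2 + 1)) (a := ζ 1) (A := ζ K)
    (c := 1 / ((e (2 * K) m (2 * d + 2) + ζ 1) * (e (2 * K) m (2 * d + 2 + 1) + ζ 1)))
    (D := ζ K - ζ 1) (gap := minGap K ζ) d hζ hpos
    (hwpos _ (by omega)) (hwpos _ (by omega)) ?_ hζ_pos.le hle1 hK.le hleK ?_
    (minGap_nonneg hζ_lt) ?_ ?_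
  · set M1 := m (refl (2 * K) (2 * d + 2))
    set M2 := m (refl (2 * K) (2 * d + 2 + 1))
    have q1 := heineSum_wt_pos hm hζ hpos hb (k := 2 * d + 2 - 1) (d := d + 1) (by omega) (by omega)
    have q2 := heineSum_wt_pos hm hζ hpos hb (k := 2 * d + 2 + 1) (d := d + 2) (by omega) (by omega)
    have q3 := heineSum_mul_wt_pos hm hζ hpos hb (k := 2 * d + 2 + 1) (d := d + 1)
      (by omega) (by omega)
    have q4 := heineSum_mul_wt_pos hm hζ hpos hb (k := 2 * d + 2 - 1) (d := d) (by omega) (by omega)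
    -- One factor `M2 * M1` is needed in the ordering inequality; the rest is the left side of the
    -- upper mass condition.
    have hc : 1 / ((e (2 * K) m (2 * d + 2) + ζ 1) * (e (2 * K) m (2 * d + 2 + 1) + ζ 1)) =
        M2 * M1 * (M2 * M1 / ((1 + M1 ^ 2 * ζ 1) * (1 + M2 ^ 2 * ζ 1))) := by
      rw [e1, e2]
      have : 0 < 1 + M1 ^ 2 * ζ 1 := by positivity
      have : 0 < 1 + M2 ^ 2 * ζ 1 := by positivity
      field_simp
    rw [hc] at key
    set T1 := heineSum (Finset.Icc 1 K) ζ (wt (2 * K) m ζ b (2 * d + 2 - 1)) (d + 1)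
    set T2 := heineSum (Finset.Icc 1 K) ζ (wt (2 * K) m ζ b (2 * d + 2 + 1)) (d + 2)
    set T3 := heineSum (Finset.Icc 1 K) ζ (fun j => ζ j * wt (2 * K) m ζ b (2 * d + 2 + 1) j) (d + 1)
    set T4 := heineSum (Finset.Icc 1 K) ζ (fun j => ζ j * wt (2 * K) m ζ b (2 * d + 2 - 1) j) d
    set L := M2 * M1 / ((1 + M1 ^ 2 * ζ 1) * (1 + M2 ^ 2 * ζ 1))
    have hd : (0 : ℝ) < d + 1 := by positivity
    have hup' : L * (ζ K ^ d * (d + 1) * (ζ K - ζ 1) ^ (2 * (d + 1))) <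
        ζ 1 ^ (d + 1) * minGap K ζ ^ (2 * d) := by
      -- The factor `2/(k+1)` of the mass condition, at odd index `2d + 1`, is the `1/(d+1)` from
      -- the exchange count.
      have h3 : ζ 1 ^ (d + 1) / ζ K ^ d *
          (2 * minGap K ζ ^ (2 * d) / ((2 * (d : ℝ) + 1 + 1) * (ζ K - ζ 1) ^ (2 * d + 2))) =
          ζ 1 ^ (d + 1) * minGap K ζ ^ (2 * d) /
            (ζ K ^ d * (d + 1) * (ζ K - ζ 1) ^ (2 * (d + 1))) := by
        rw [show (2 * (d : ℝ) + 1 + 1) = 2 * (d + 1) by ring, show 2 * d + 2 = 2 * (d + 1) by ring]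
        have : (ζ K - ζ 1) ^ (2 * (d + 1)) ≠ 0 := (pow_pos hD _).ne'
        field_simp
      rw [h3, lt_div_iff₀ (mul_pos (mul_pos (pow_pos hK _) hd) (pow_pos hD _))] at hup
      exact hup
    rw [← mul_div_assoc, lt_div_iff₀ (mul_pos q4 q2), one_mul]
    have hX : 0 ≤ ζ 1 ^ (d + 1) * minGap K ζ ^ (2 * d) :=
      mul_nonneg (pow_pos hζ_pos _).le (pow_nonneg (minGap_nonneg hζ_lt) _)
    refine lt_of_mul_lt_mul_left (key.trans_lt ?_) hX
    have h4 := mul_lt_mul_of_pos_right hup' (mul_pos (mul_pos m2 m1) (mul_pos q1 q3))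
    linarith
  · intro j hj
    have w1 := wt_eq_mul_wt_succ b hm (k := 2 * d + 2 - 1) (by omega) (hpos j hj)
    have w2 := wt_eq_mul_wt_succ b hm (k := 2 * d + 2) (by omega) (hpos j hj)
    rw [show 2 * d + 2 - 1 + 1 = 2 * d + 2 by omega] at w1
    rw [w1, w2]
    have p1 := e_pos hm (k := 2 * d + 2) (by omega) (by omega)
    have p2 := e_pos hm (k := 2 * d + 2 + 1) (by omega) (by omega)
    have p3 := hwpos (2 * d + 2 + 1) hk j hj
    have p4 := hle1 j hj
    rw [one_div_mul_eq_div, le_div_iff₀ (by positivity)]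
    have : (e (2 * K) m (2 * d + 2) + ζ 1) * (e (2 * K) m (2 * d + 2 + 1) + ζ 1) ≤
        (ζ j + e (2 * K) m (2 * d + 2)) * (ζ j + e (2 * K) m (2 * d + 2 + 1)) := by
      apply mul_le_mul <;> linarith
    calc _ ≤ wt (2 * K) m ζ b (2 * d + 2 + 1) j * ((ζ j + e (2 * K) m (2 * d + 2)) *
          (ζ j + e (2 * K) m (2 * d + 2 + 1))) := by gcongr
      _ = _ := by ring
  · have p1 := e_pos hm (k := 2 * d + 2) (by omega) (by omega)
    have p2 := e_pos hm (k := 2 * d + 2 + 1) (by omega) (by omega)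
    positivity
  · intro i hi j hj
    have := hle1 i hi
    have := hle1 j hj
    have := hleK i hi
    have := hleK j hj
    rw [abs_le]; constructor <;> linarith
  · intro i hi j hj hij
    rw [Finset.mem_Icc] at hi hj
    rcases lt_or_gt_of_ne hij with h | h
    · rw [abs_sub_comm]
      exact (minGap_le hζ_lt hi.1 h hj.2).trans (le_abs_self _)
    · exact (minGap_le hζ_lt hj.1 h hi.2).trans (le_abs_self _)

theorem position_ordered (hm : ∀ k, 1 ≤ k → k ≤ 2 * K → 0 < m k) (hζ_pos : 0 < ζ 1)
    (hζ_lt : ∀ i j, 1 ≤ i → i < j → j ≤ K → ζ i < ζ j)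
    (hpos : ∀ j ∈ Finset.Icc 1 K, 0 < ζ j)
    (hb : ∀ j ∈ Finset.Icc 1 K, 0 < b j) (hcond : MassCondition K m ζ) :
    ∀ i j, 1 ≤ i → i < j → j ≤ 2 * K → position K m ζ b i < position K m ζ b j := by
  have hstep : ∀ i, 1 ≤ i → i + 1 ≤ 2 * K → position K m ζ b i < position K m ζ b (i + 1) := by
    intro i hi hi'
    have r1 : i = refl (2 * K) (2 * K - i + 1) := by unfold refl; omega
    have r2 : i + 1 = refl (2 * K) (2 * K - i) := by unfold refl; omega
    rw [r2]
    conv_lhs => rw [r1]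
    rcases Nat.even_or_odd (2 * K - i) with h | h
    · exact position_lt_of_even hm hζ_pos hζ_lt hpos hb hcond h (by omega) (by omega)
    · exact position_lt_of_odd hm hζ_pos hζ_lt hpos hb hcond h (by omega)
  intro i j hi hij hj
  induction j, hij using Nat.le_induction with
  | base => exact hstep i hi hj
  | succ j hij ih => exact (ih (by omega)).trans (hstep j (by omega) hj)

end

/-! ### Exponentially small errors -/

/-- `f` is `O(exp (-α |t|))` along `l` for some `α > 0`. -/
def ExpSmall (l : Filter ℝ) (f : ℝ → ℝ) : Prop :=
  ∃ α : ℝ, 0 < α ∧ f =O[l] fun t => Real.exp (-α * |t|)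

lemma isBigO_exp_of_le {l : Filter ℝ} {f : ℝ → ℝ} {α β : ℝ} (h : β ≤ α)
    (hf : f =O[l] fun t => Real.exp (-α * |t|)) : f =O[l] fun t => Real.exp (-β * |t|) := by
  refine hf.trans (IsBigO.of_bound 1 (Eventually.of_forall fun t => ?_))
  rw [Real.norm_eq_abs, Real.norm_eq_abs, Real.abs_exp, Real.abs_exp, one_mul, Real.exp_le_exp]
  nlinarith [abs_nonneg t]

lemma ExpSmall.add {l : Filter ℝ} {f g : ℝ → ℝ} (hf : ExpSmall l f) (hg : ExpSmall l g) :
    ExpSmall l fun t => f t + g t := by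
  obtain ⟨α, hα, hf⟩ := hf
  obtain ⟨β, hβ, hg⟩ := hg
  exact ⟨min α β, lt_min hα hβ, (isBigO_exp_of_le (min_le_left _ _) hf).add
    (isBigO_exp_of_le (min_le_right _ _) hg)⟩

lemma ExpSmall.sub {l : Filter ℝ} {f g : ℝ → ℝ} (hf : ExpSmall l f) (hg : ExpSmall l g) :
    ExpSmall l fun t => f t - g t := by
  obtain ⟨α, hα, hf⟩ := hf
  obtain ⟨β, hβ, hg⟩ := hg
  exact ⟨min α β, lt_min hα hβ, (isBigO_exp_of_le (min_le_left _ _) hf).sub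
    (isBigO_exp_of_le (min_le_right _ _) hg)⟩

lemma ExpSmall.congr {l : Filter ℝ} {f g : ℝ → ℝ} (hf : ExpSmall l f) (h : ∀ t, f t = g t) :
    ExpSmall l g := by
  rwa [show g = f from funext fun t => (h t).symm]

lemma ExpSmall.tendsto_div {l : Filter ℝ} {x : ℝ → ℝ} {z c : ℝ}
    (h : ExpSmall l fun t => x t - (2 * t / z + c)) (hl : Tendsto (fun t : ℝ => |t|) l atTop) :
    Tendsto (fun t => x t / t) l (𝓝 (2 / z)) := by
  obtain ⟨α, hα, hO⟩ := h
  have h0 : Tendsto (fun t => x t - (2 * t / z + c)) l (𝓝 0) := by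
    refine hO.trans_tendsto ?_
    refine Real.tendsto_exp_atBot.comp ?_
    have := hl.const_mul_atTop_of_neg (neg_lt_zero.2 hα)
    exact this
  have hinv : Tendsto (fun t : ℝ => t⁻¹) l (𝓝 0) := by
    rw [tendsto_zero_iff_abs_tendsto_zero]
    refine (tendsto_inv_atTop_zero.comp hl).congr fun t => ?_
    simp [abs_inv]
  have h1 : Tendsto (fun t => 2 / z + (c + (x t - (2 * t / z + c))) * t⁻¹) l
      (𝓝 (2 / z + (c + 0) * 0)) :=
    tendsto_const_nhds.add ((tendsto_const_nhds.add h0).mul hinv)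
  rw [mul_zero, add_zero] at h1
  refine h1.congr' ?_
  filter_upwards [hl.eventually_gt_atTop 0] with t ht
  have : t ≠ 0 := abs_pos.1 ht
  field_simp
  ring

/-- Factoring out the dominant exponential leaves `log (1 + R)` with `0 ≤ R` exponentially small,
and `log (1 + R) ≤ R`. The sign `σ = ±1` treats both time directions at once through `|t| = σ t`. -/
lemma expSmall_log_sum {ι : Type*} [DecidableEq ι] {P : Finset ι} {J₀ : ι} (hJ₀ : J₀ ∈ P)
    {c r : ι → ℝ} (hc : ∀ J ∈ P, 0 < c J) {l : Filter ℝ} {σ : ℝ} (hσ : σ ^ 2 = 1)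
    (hl : Tendsto (fun t => σ * t) l atTop) (hr : ∀ J ∈ P, J ≠ J₀ → σ * r J < σ * r J₀) :
    ExpSmall l fun t =>
      Real.log (∑ J ∈ P, c J * Real.exp (t * r J)) - (Real.log (c J₀) + t * r J₀) := by
  -- The rate is the smallest gap to the dominant exponent; with no competing term any positive
  -- number serves.
  obtain ⟨α, hα, hαr⟩ : ∃ α : ℝ, 0 < α ∧ ∀ J ∈ P.erase J₀, α ≤ σ * r J₀ - σ * r J := by
    rcases (P.erase J₀).eq_empty_or_nonempty with h | h
    · exact ⟨1, one_pos, fun J hJ => by simp [h] at hJ⟩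
    · obtain ⟨J, hJ, hmin⟩ := Finset.exists_min_image _ (fun J => σ * r J₀ - σ * r J) h
      rw [Finset.mem_erase] at hJ
      exact ⟨_, sub_pos.2 (hr J hJ.2 hJ.1), hmin⟩
  refine ⟨α, hα, ?_⟩
  have h0 := hc J₀ hJ₀
  refine IsBigO.of_bound (∑ J ∈ P.erase J₀, c J / c J₀) ?_
  filter_upwards [hl.eventually_gt_atTop 0] with t ht
  have habs : |t| = σ * t := by
    have : |σ| = 1 := by rw [← sq_eq_sq₀ (abs_nonneg _) zero_le_one, sq_abs, hσ, one_pow]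
    rw [← abs_of_pos ht, abs_mul, this, one_mul]
  have hsum : ∑ J ∈ P, c J * Real.exp (t * r J) = c J₀ * Real.exp (t * r J₀) *
      (1 + ∑ J ∈ P.erase J₀, c J / c J₀ * Real.exp (t * (r J - r J₀))) := by
    rw [← Finset.add_sum_erase P _ hJ₀, mul_add, mul_one, Finset.mul_sum]
    congr 1
    refine Finset.sum_congr rfl fun J _ => ?_
    rw [mul_sub, Real.exp_sub]
    have := Real.exp_pos (t * r J₀)
    field_simp
  have hR : 0 ≤ ∑ J ∈ P.erase J₀, c J / c J₀ * Real.exp (t * (r J - r J₀)) :=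
    Finset.sum_nonneg fun J hJ =>
      mul_nonneg (div_pos (hc J (Finset.mem_of_mem_erase hJ)) h0).le (Real.exp_pos _).le
  have hRle : ∑ J ∈ P.erase J₀, c J / c J₀ * Real.exp (t * (r J - r J₀)) ≤
      (∑ J ∈ P.erase J₀, c J / c J₀) * Real.exp (-α * |t|) := by
    rw [Finset.sum_mul]
    refine Finset.sum_le_sum fun J hJ => ?_
    have h1 := (div_pos (hc J (Finset.mem_of_mem_erase hJ)) h0).le
    have h2 : t * (r J - r J₀) ≤ -α * |t| := by
      have h3 := mul_le_mul_of_nonneg_right (hαr J hJ) ht.le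
      have h4 : (σ * r J₀ - σ * r J) * (σ * t) = t * (r J₀ - r J) := by
        linear_combination (t * (r J₀ - r J)) * hσ
      rw [habs]
      linarith
    gcongr
  set R := ∑ J ∈ P.erase J₀, c J / c J₀ * Real.exp (t * (r J - r J₀))
  have hlog : Real.log (∑ J ∈ P, c J * Real.exp (t * r J)) - (Real.log (c J₀) + t * r J₀) =
      Real.log (1 + R) := by
    rw [hsum, Real.log_mul (by positivity) (by positivity), Real.log_mul h0.ne' (Real.exp_pos _).ne',
      Real.log_exp]
    ring
  rw [hlog, Real.norm_eq_abs, Real.norm_eq_abs, Real.abs_exp,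
    abs_of_nonneg (Real.log_nonneg (by linarith))]
  have := Real.log_le_sub_one_of_pos (show 0 < 1 + R by linarith)
  linarith

/-! ### Asymptotics of Heine sums -/

/-- The coefficient of the dominant exponential in a Heine sum. -/
def domCoeff (ζ w : ℕ → ℝ) (d : ℕ) : ℝ := vdmSq ζ (Finset.Icc 1 d) * ∏ j ∈ Finset.Icc 1 d, w j

lemma domCoeff_succ (ζ w : ℕ → ℝ) (d : ℕ) : domCoeff ζ w (d + 1) =
    domCoeff ζ w d * ((∏ i ∈ Finset.Icc 1 d, (ζ i - ζ (d + 1)) ^ 2) * w (d + 1)) := by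
  have : Finset.Icc 1 (d + 1) = insert (d + 1) (Finset.Icc 1 d) :=
    (Finset.insert_Icc_right_eq_Icc_add_one (by omega)).symm
  rw [domCoeff, domCoeff, Finset.prod_Icc_succ_top (by omega), this, vdmSq_insert _ (by simp)]
  ring

lemma domCoeff_mul (ζ w : ℕ → ℝ) (d : ℕ) : domCoeff ζ (fun j => ζ j * w j) d =
    (∏ j ∈ Finset.Icc 1 d, ζ j) * domCoeff ζ w d := by
  rw [domCoeff, domCoeff, Finset.prod_mul_distrib]; ring

lemma domCoeff_pos {K d : ℕ} {ζ w : ℕ → ℝ} (hζ : Set.InjOn ζ (Finset.Icc 1 K))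
    (hw : ∀ j ∈ Finset.Icc 1 K, 0 < w j) (hd : d ≤ K) : 0 < domCoeff ζ w d := by
  have hsub : Finset.Icc 1 d ⊆ Finset.Icc 1 K := Finset.Icc_subset_Icc_right hd
  exact mul_pos (vdmSq_pos hζ hsub) (Finset.prod_pos fun j hj => hw j (hsub hj))

/-- The parts of `J` and of `[1, d]` outside each other have equal size, and `f d` separates their
values: strictly below it for `J`, at least it for `[1, d]`. -/
lemma sum_lt_sum_Icc {K d : ℕ} {f : ℕ → ℝ} (hf : ∀ i j, 1 ≤ i → i < j → j ≤ K → f j < f i)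
    (hd : d ≤ K) {J : Finset ℕ} (hJ : J ⊆ Finset.Icc 1 K) (hJd : J.card = d)
    (hne : J ≠ Finset.Icc 1 d) : ∑ j ∈ J, f j < ∑ j ∈ Finset.Icc 1 d, f j := by
  have hcard : (J \ Finset.Icc 1 d).card = (Finset.Icc 1 d \ J).card := by
    apply Finset.card_sdiff_comm
    rw [hJd, Nat.card_Icc, Nat.add_sub_cancel]
  have hne' : (J \ Finset.Icc 1 d).Nonempty := by
    rw [Finset.sdiff_nonempty]
    intro hs
    exact hne (Finset.eq_of_subset_of_card_le hs (by rw [hJd, Nat.card_Icc, Nat.add_sub_cancel]))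
  have hd0 : 1 ≤ d := by
    rw [← hJd]
    exact Finset.card_pos.2 (hne'.mono Finset.sdiff_subset)
  have h1 : ∑ j ∈ J \ Finset.Icc 1 d, f j < (J \ Finset.Icc 1 d).card • f d := by
    rw [← Finset.sum_const]
    refine Finset.sum_lt_sum_of_nonempty hne' fun j hj => ?_
    rw [Finset.mem_sdiff, Finset.mem_Icc] at hj
    have := Finset.mem_Icc.1 (hJ hj.1)
    exact hf d j hd0 (by omega) this.2
  have h2 : (Finset.Icc 1 d \ J).card • f d ≤ ∑ j ∈ Finset.Icc 1 d \ J, f j := by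
    refine Finset.card_nsmul_le_sum _ _ _ fun j hj => ?_
    rw [Finset.mem_sdiff, Finset.mem_Icc] at hj
    rcases hj.1.2.eq_or_lt with h | h
    · rw [h]
    · exact (hf j d hj.1.1 h hd).le
  rw [← Finset.sum_inter_add_sum_sdiff J (Finset.Icc 1 d),
    ← Finset.sum_inter_add_sum_sdiff (Finset.Icc 1 d) J, Finset.inter_comm (Finset.Icc 1 d) J]
  rw [hcard] at h1
  linarith

section

variable {K : ℕ} {m ζ b : ℕ → ℝ} {σ : ℝ} {l : Filter ℝ}

/-- The subset `J` contributes an exponential of rate `∑ 2/ζ_j` over `J`. When `σ/ζ` decreases along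
the list, the first `d` nodes win. -/
lemma expSmall_log_heineSum {w : ℕ → ℝ} {W : ℝ → ℕ → ℝ} {d : ℕ}
    (hζ : Set.InjOn ζ (Finset.Icc 1 K)) (hw : ∀ j ∈ Finset.Icc 1 K, 0 < w j)
    (hW : ∀ t j, W t j = w j * Real.exp (2 * t / ζ j)) (hσ : σ ^ 2 = 1)
    (hl : Tendsto (fun t => σ * t) l atTop)
    (hlt : ∀ i j, 1 ≤ i → i < j → j ≤ K → σ / ζ j < σ / ζ i) (hd : d ≤ K) :
    ExpSmall l fun t => Real.log (heineSum (Finset.Icc 1 K) ζ (W t) d) -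
      (Real.log (domCoeff ζ w d) + t * ∑ j ∈ Finset.Icc 1 d, 2 / ζ j) := by
  have h := expSmall_log_sum (P := (Finset.Icc 1 K).powersetCard d) (J₀ := Finset.Icc 1 d)
    (c := fun J => vdmSq ζ J * ∏ j ∈ J, w j) (r := fun J => ∑ j ∈ J, 2 / ζ j)
    (Finset.mem_powersetCard.2 ⟨Finset.Icc_subset_Icc_right hd, by simp⟩)
    (fun J hJ => by
      rw [Finset.mem_powersetCard] at hJ
      exact mul_pos (vdmSq_pos hζ hJ.1) (Finset.prod_pos fun j hj => hw j (hJ.1 hj)))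
    hσ hl (fun J hJ hne => by
      rw [Finset.mem_powersetCard] at hJ
      rw [Finset.mul_sum, Finset.mul_sum]
      refine sum_lt_sum_Icc (fun i j hi hij hj => ?_) hd hJ.1 hJ.2 hne
      have := hlt i j hi hij hj
      calc σ * (2 / ζ j) = 2 * (σ / ζ j) := by ring
        _ < 2 * (σ / ζ i) := by linarith
        _ = _ := by ring)
  refine h.congr fun t => ?_
  have : heineSum (Finset.Icc 1 K) ζ (W t) d = ∑ J ∈ (Finset.Icc 1 K).powersetCard d,
      (vdmSq ζ J * ∏ j ∈ J, w j) * Real.exp (t * ∑ j ∈ J, 2 / ζ j) := by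
    refine Finset.sum_congr rfl fun J _ => ?_
    rw [Finset.mul_sum, Real.exp_sum, mul_assoc, ← Finset.prod_mul_distrib]
    congr 1
    refine Finset.prod_congr rfl fun j _ => ?_
    rw [hW]; congr 2; ring
  rw [this, domCoeff]

lemma wt_residueAt (n k : ℕ) (t : ℝ) (j : ℕ) :
    wt n m ζ (residueAt ζ b t) k j = wt n m ζ b k j * Real.exp (2 * t / ζ j) := by
  rw [wt, wt, residueAt]; ring

/-- The asymptotic position, with the constant in terms of the dominant coefficients. -/
lemma expSmall_position {k : ℕ} (hm : ∀ k, 1 ≤ k → k ≤ 2 * K → 0 < m k)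
    (hζ : Set.InjOn ζ (Finset.Icc 1 K)) (hpos : ∀ j ∈ Finset.Icc 1 K, 0 < ζ j)
    (hb : ∀ j ∈ Finset.Icc 1 K, 0 < b j) (hσ : σ ^ 2 = 1)
    (hl : Tendsto (fun t => σ * t) l atTop)
    (hlt : ∀ i j, 1 ≤ i → i < j → j ≤ K → σ / ζ j < σ / ζ i) (h1 : 1 ≤ k) (hk : k ≤ 2 * K) :
    ExpSmall l fun t => position K m ζ (residueAt ζ b t) (refl (2 * K) k) -
      (2 * t / ζ ((k + 1) / 2) + Real.log (eProd (2 * K) m (k - 1) *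
        (domCoeff ζ (wt (2 * K) m ζ b (k - 1)) (k / 2) *
          domCoeff ζ (wt (2 * K) m ζ b k) ((k + 1) / 2)) /
        (domCoeff ζ (fun j => ζ j * wt (2 * K) m ζ b k j) (k / 2) *
          domCoeff ζ (fun j => ζ j * wt (2 * K) m ζ b (k - 1) j) ((k - 1) / 2)) /
        m (refl (2 * K) k))) := by
  have hwp : ∀ k ≤ 2 * K, ∀ j ∈ Finset.Icc 1 K, 0 < wt (2 * K) m ζ b k j :=
    fun k hk j hj => wt_pos hm hk (hpos j hj) (hb j hj)
  have hzwp : ∀ k ≤ 2 * K, ∀ j ∈ Finset.Icc 1 K, 0 < ζ j * wt (2 * K) m ζ b k j :=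
    fun k hk j hj => mul_pos (hpos j hj) (hwp k hk j hj)
  have hW : ∀ k t j, wt (2 * K) m ζ (residueAt ζ b t) k j =
      wt (2 * K) m ζ b k j * Real.exp (2 * t / ζ j) := fun k t j => wt_residueAt _ _ _ _
  have hzW : ∀ k t j, ζ j * wt (2 * K) m ζ (residueAt ζ b t) k j =
      (ζ j * wt (2 * K) m ζ b k j) * Real.exp (2 * t / ζ j) := fun k t j => by rw [hW, mul_assoc]
  have a1 := expSmall_log_heineSum (d := k / 2) hζ (hwp (k - 1) (by omega)) (hW (k - 1)) hσ hl hlt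
    (by omega)
  have a2 := expSmall_log_heineSum (d := (k + 1) / 2) hζ (hwp k hk) (hW k) hσ hl hlt (by omega)
  have a3 := expSmall_log_heineSum (W := fun t j => ζ j * wt (2 * K) m ζ (residueAt ζ b t) k j)
    (d := k / 2) hζ (hzwp k hk) (hzW k) hσ hl hlt (by omega)
  have a4 := expSmall_log_heineSum
    (W := fun t j => ζ j * wt (2 * K) m ζ (residueAt ζ b t) (k - 1) j)
    (d := (k - 1) / 2) hζ (hzwp (k - 1) (by omega)) (hzW (k - 1)) hσ hl hlt (by omega)
  refine (((a1.add a2).sub a3).sub a4).congr fun t => ?_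
  have hbt := residueAt_pos (ζ := ζ) hb t
  have p1 := (heineSum_wt_pos hm hζ hpos hbt (k := k - 1) (d := k / 2) (by omega) (by omega)).ne'
  have p2 := (heineSum_wt_pos hm hζ hpos hbt (k := k) (d := (k + 1) / 2) hk (by omega)).ne'
  have p3 := (heineSum_mul_wt_pos hm hζ hpos hbt (k := k) (d := k / 2) hk (by omega)).ne'
  have p4 := (heineSum_mul_wt_pos hm hζ hpos hbt (k := k - 1) (d := (k - 1) / 2)
    (by omega) (by omega)).ne'
  have c1 := (domCoeff_pos (d := k / 2) hζ (hwp (k - 1) (by omega)) (by omega)).ne'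
  have c2 := (domCoeff_pos (d := (k + 1) / 2) hζ (hwp k hk) (by omega)).ne'
  have c3 := (domCoeff_pos (d := k / 2) hζ (hzwp k hk) (by omega)).ne'
  have c4 := (domCoeff_pos (d := (k - 1) / 2) hζ (hzwp (k - 1) (by omega)) (by omega)).ne'
  have hE := (eProd_pos hm (k := k - 1) (by omega)).ne'
  have hmk := (hm (refl (2 * K) k) (by unfold refl; omega) (by unfold refl; omega)).ne'
  -- The linear rates over the first `k/2` nodes cancel between numerator and denominator; the other
  -- two sums differ by the single term at `(k + 1)/2`, which is the speed.
  rw [position, refl_refl (by omega), momentum,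
    Real.log_div (div_ne_zero (mul_ne_zero hE (mul_ne_zero p1 p2)) (mul_ne_zero p3 p4)) hmk,
    Real.log_div (mul_ne_zero hE (mul_ne_zero p1 p2)) (mul_ne_zero p3 p4),
    Real.log_mul hE (mul_ne_zero p1 p2), Real.log_mul p1 p2, Real.log_mul p3 p4,
    Real.log_div (div_ne_zero (mul_ne_zero hE (mul_ne_zero c1 c2)) (mul_ne_zero c3 c4)) hmk,
    Real.log_div (mul_ne_zero hE (mul_ne_zero c1 c2)) (mul_ne_zero c3 c4),
    Real.log_mul hE (mul_ne_zero c1 c2), Real.log_mul c1 c2, Real.log_mul c3 c4,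
    show (k + 1) / 2 = (k - 1) / 2 + 1 by omega, Finset.sum_Icc_succ_top (by omega)]
  ring

/-- Quotients of dominant coefficients with the same weight lose everything but the contribution of
node `s + 1` and two copies of `∏ ζ` over `[1, s]`, hence the square in the denominator. -/
lemma shiftOdd_eq {s : ℕ} (hm : ∀ k, 1 ≤ k → k ≤ 2 * K → 0 < m k)
    (hζ : Set.InjOn ζ (Finset.Icc 1 K)) (hpos : ∀ j ∈ Finset.Icc 1 K, 0 < ζ j)
    (hb : ∀ j ∈ Finset.Icc 1 K, 0 < b j) (hk : 2 * s + 1 ≤ 2 * K) :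
    Real.log (eProd (2 * K) m (2 * s) * (domCoeff ζ (wt (2 * K) m ζ b (2 * s)) s *
          domCoeff ζ (wt (2 * K) m ζ b (2 * s + 1)) (s + 1)) /
        (domCoeff ζ (fun j => ζ j * wt (2 * K) m ζ b (2 * s + 1) j) s *
          domCoeff ζ (fun j => ζ j * wt (2 * K) m ζ b (2 * s) j) s) /
        m (refl (2 * K) (2 * s + 1))) = shiftOdd (2 * K) m ζ b (2 * s + 1) := by
  have c1 := domCoeff_pos (d := s) hζ
    (fun j hj => wt_pos hm (k := 2 * s) (by omega) (hpos j hj) (hb j hj)) (by omega)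
  have c2 := domCoeff_pos (d := s) hζ
    (fun j hj => wt_pos hm hk (hpos j hj) (hb j hj)) (by omega)
  have hmk := hm (refl (2 * K) (2 * s + 1)) (by unfold refl; omega) (by unfold refl; omega)
  have hZ : 0 < ∏ j ∈ Finset.Icc 1 s, ζ j := Finset.prod_pos fun j hj => by
    rw [Finset.mem_Icc] at hj
    exact hpos j (Finset.mem_Icc.2 ⟨hj.1, by omega⟩)
  have hG : 0 < ∏ i ∈ Finset.Icc 1 (2 * s + 1), (e (2 * K) m i + ζ (s + 1)) :=
    Finset.prod_pos fun i hi => by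
      rw [Finset.mem_Icc] at hi
      exact add_pos (e_pos hm hi.1 (by omega)) (hpos _ (Finset.mem_Icc.2 ⟨by omega, by omega⟩))
  rw [shiftOdd, domCoeff_mul, domCoeff_mul, domCoeff_succ,
    show (2 * s + 1 + 1) / 2 = s + 1 by omega, show (2 * s + 1 - 1) / 2 = s by omega,
    show 2 * s + 1 - 1 = 2 * s by omega]
  congr 1
  simp only [Delta, Gamma, Finset.prod_singleton]
  have hw : wt (2 * K) m ζ b (2 * s + 1) (s + 1) =
      b (s + 1) / ∏ i ∈ Finset.Icc 1 (2 * s + 1), (e (2 * K) m i + ζ (s + 1)) := rfl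
  rw [← Finset.prod_pow, eProd, hw]
  field_simp

/-- As in the odd case, except that one product of nodes now runs to `s + 1`; this is the additional
factor `ζ_{s+1}`. -/
lemma shiftEven_eq {s : ℕ} (hm : ∀ k, 1 ≤ k → k ≤ 2 * K → 0 < m k)
    (hζ : Set.InjOn ζ (Finset.Icc 1 K)) (hpos : ∀ j ∈ Finset.Icc 1 K, 0 < ζ j)
    (hb : ∀ j ∈ Finset.Icc 1 K, 0 < b j) (hk : 2 * s + 2 ≤ 2 * K) :
    Real.log (eProd (2 * K) m (2 * s + 1) * (domCoeff ζ (wt (2 * K) m ζ b (2 * s + 1)) (s + 1) *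
          domCoeff ζ (wt (2 * K) m ζ b (2 * s + 2)) (s + 1)) /
        (domCoeff ζ (fun j => ζ j * wt (2 * K) m ζ b (2 * s + 2) j) (s + 1) *
          domCoeff ζ (fun j => ζ j * wt (2 * K) m ζ b (2 * s + 1) j) s) /
        m (refl (2 * K) (2 * s + 2))) = shiftEven (2 * K) m ζ b (2 * s + 2) := by
  have c1 := domCoeff_pos (d := s) hζ
    (fun j hj => wt_pos hm (k := 2 * s + 1) (by omega) (hpos j hj) (hb j hj)) (by omega)
  have c2 := domCoeff_pos (d := s + 1) hζ
    (fun j hj => wt_pos hm hk (hpos j hj) (hb j hj)) (by omega)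
  have hmk := hm (refl (2 * K) (2 * s + 2)) (by unfold refl; omega) (by unfold refl; omega)
  have hZ : 0 < ∏ j ∈ Finset.Icc 1 s, ζ j := Finset.prod_pos fun j hj => by
    rw [Finset.mem_Icc] at hj
    exact hpos j (Finset.mem_Icc.2 ⟨hj.1, by omega⟩)
  have hζs := hpos (s + 1) (Finset.mem_Icc.2 ⟨by omega, by omega⟩)
  have hG : 0 < ∏ i ∈ Finset.Icc 1 (2 * s + 1), (e (2 * K) m i + ζ (s + 1)) :=
    Finset.prod_pos fun i hi => by
      rw [Finset.mem_Icc] at hi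
      exact add_pos (e_pos hm hi.1 (by omega)) hζs
  rw [shiftEven, domCoeff_mul, domCoeff_mul,
    domCoeff_succ ζ (wt (2 * K) m ζ b (2 * s + 1)), Finset.prod_Icc_succ_top (by omega),
    show (2 * s + 2) / 2 = s + 1 by omega, Nat.add_sub_cancel,
    show 2 * s + 2 - 1 = 2 * s + 1 by omega]
  congr 1
  simp only [Delta, Gamma, Finset.prod_singleton]
  rw [← Finset.prod_pow, eProd]
  have hw : wt (2 * K) m ζ b (2 * s + 1) (s + 1) =
      b (s + 1) / ∏ i ∈ Finset.Icc 1 (2 * s + 1), (e (2 * K) m i + ζ (s + 1)) := rfl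
  rw [hw]
  field_simp

/-- The `Δ`, `Γ` and residue factors of the pair coincide. What remains is `e_{2s+1}`, the inverse
square of a mass, the two masses, and `ζ_{s+1}`. -/
lemma shiftOdd_sub_shiftEven {s : ℕ} (hm : ∀ k, 1 ≤ k → k ≤ 2 * K → 0 < m k)
    (hζ : Set.InjOn ζ (Finset.Icc 1 K)) (hpos : ∀ j ∈ Finset.Icc 1 K, 0 < ζ j)
    (hb : ∀ j ∈ Finset.Icc 1 K, 0 < b j) (hk : 2 * s + 2 ≤ 2 * K) :
    shiftOdd (2 * K) m ζ b (2 * s + 1) - shiftEven (2 * K) m ζ b (2 * s + 2) =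
      Real.log (m (refl (2 * K) (2 * s + 2)) * m (refl (2 * K) (2 * s + 1)) * ζ (s + 1)) := by
  have hs : s + 1 ∈ Finset.Icc 1 K := Finset.mem_Icc.2 ⟨by omega, by omega⟩
  have hmk := hm (refl (2 * K) (2 * s + 1)) (by unfold refl; omega) (by unfold refl; omega)
  have hmk' := hm (refl (2 * K) (2 * s + 2)) (by unfold refl; omega) (by unfold refl; omega)
  have hZ : 0 < ∏ j ∈ Finset.Icc 1 s, ζ j := Finset.prod_pos fun j hj => by
    rw [Finset.mem_Icc] at hj
    exact hpos j (Finset.mem_Icc.2 ⟨hj.1, by omega⟩)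
  have hζs := hpos _ hs
  have hbs := hb _ hs
  have hG : 0 < ∏ i ∈ Finset.Icc 1 (2 * s + 1), (e (2 * K) m i + ζ (s + 1)) :=
    Finset.prod_pos fun i hi => by
      rw [Finset.mem_Icc] at hi
      exact add_pos (e_pos hm hi.1 (by omega)) hζs
  have hD : ∏ i ∈ Finset.Icc 1 s, (ζ i - ζ (s + 1)) ≠ 0 :=
    Finset.prod_ne_zero_iff.2 fun i hi => sub_ne_zero.2 fun h => by
      rw [Finset.mem_Icc] at hi
      have := hζ (Finset.mem_coe.2 (Finset.mem_Icc.2 ⟨hi.1, by omega⟩)) (Finset.mem_coe.2 hs) h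
      omega
  have hE : 0 < ∏ i ∈ Finset.Icc 1 (2 * s), e (2 * K) m i := eProd_pos hm (by omega)
  have hE' : e (2 * K) m (2 * s + 1) = 1 / m (refl (2 * K) (2 * s + 1)) ^ 2 := rfl
  rw [shiftOdd, shiftEven, show (2 * s + 1 + 1) / 2 = s + 1 by omega,
    show (2 * s + 1 - 1) / 2 = s by omega, show 2 * s + 1 - 1 = 2 * s by omega,
    Nat.add_sub_cancel,
    show 2 * s + 2 - 1 = 2 * s + 1 by omega, Finset.prod_Icc_succ_top (by omega), hE']
  simp only [Delta, Gamma, Finset.prod_singleton]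
  rw [← Real.log_div (by positivity) (by positivity)]
  congr 1
  field_simp

theorem position_hasAsymptotics (hm : ∀ k, 1 ≤ k → k ≤ 2 * K → 0 < m k)
    (hζ : Set.InjOn ζ (Finset.Icc 1 K)) (hpos : ∀ j ∈ Finset.Icc 1 K, 0 < ζ j)
    (hb : ∀ j ∈ Finset.Icc 1 K, 0 < b j) (hσ : σ ^ 2 = 1)
    (hl : Tendsto (fun t => σ * t) l atTop)
    (hlt : ∀ i j, 1 ≤ i → i < j → j ≤ K → σ / ζ j < σ / ζ i) :
    HasAsymptotics (2 * K) m ζ b (fun t => position K m ζ (residueAt ζ b t)) l := by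
  have hodd : ∀ k, Odd k → k ≤ 2 * K → ExpSmall l fun t =>
      position K m ζ (residueAt ζ b t) (refl (2 * K) k) -
        (2 * t / ζ ((k + 1) / 2) + shiftOdd (2 * K) m ζ b k) := by
    rintro k ⟨s, rfl⟩ hk
    have h := expSmall_position hm hζ hpos hb hσ hl hlt (k := 2 * s + 1) (by omega) hk
    rw [← shiftOdd_eq hm hζ hpos hb hk]
    simpa only [show (2 * s + 1) / 2 = s by omega, show (2 * s + 1 + 1) / 2 = s + 1 by omega,
      show 2 * s / 2 = s by omega, Nat.add_sub_cancel] using h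
  have heven : ∀ k, Even k → 1 ≤ k → k ≤ 2 * K → ExpSmall l fun t =>
      position K m ζ (residueAt ζ b t) (refl (2 * K) k) -
        (2 * t / ζ (k / 2) + shiftEven (2 * K) m ζ b k) := by
    intro k hke h1 hk
    obtain ⟨s, rfl⟩ : ∃ s, k = 2 * s + 2 := by
      obtain ⟨r, hr⟩ := hke
      exact ⟨r - 1, by omega⟩
    have h := expSmall_position hm hζ hpos hb hσ hl hlt (k := 2 * s + 2) (by omega) hk
    rw [← shiftEven_eq hm hζ hpos hb hk]
    simpa only [show (2 * s + 2) / 2 = s + 1 by omega, show (2 * s + 2 + 1) / 2 = s + 1 by omega,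
      show (2 * s + 1) / 2 = s by omega, show 2 * s + 2 - 1 = 2 * s + 1 by omega] using h
  refine ⟨hodd, heven, ?_⟩
  rintro k ⟨s, rfl⟩ hk
  have h1 := hodd (2 * s + 1) ⟨s, rfl⟩ (by omega)
  have h2 := heven (2 * s + 2) ⟨s + 1, by ring⟩ (by omega) hk
  refine (h1.sub h2).congr fun t => ?_
  have h3 := shiftOdd_sub_shiftEven hm hζ hpos hb (s := s) hk
  rw [show (2 * s + 1 + 1) / 2 = s + 1 by omega, ← h3,
    show 2 * s + 1 + 1 = 2 * s + 2 by ring]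
  ring

end

/-! ### Transfer of asymptotics, speeds, and reversal of the node list -/

lemma HasAsymptotics.congr {n : ℕ} {m ζ b : ℕ → ℝ} {x y : ℝ → ℕ → ℝ} {l : Filter ℝ}
    (h : HasAsymptotics n m ζ b x l) (hxy : ∀ t k, 1 ≤ k → k ≤ n → x t k = y t k) :
    HasAsymptotics n m ζ b y l := by
  have hr : ∀ k, 1 ≤ k → k ≤ n → ∀ t, x t (refl n k) = y t (refl n k) := fun k h1 hk t =>
    hxy t _ (by unfold refl; omega) (by unfold refl; omega)
  refine ⟨fun k ho hk => ?_, fun k he h1 hk => ?_, fun k ho hk => ?_⟩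
  · obtain ⟨α, hα, hO⟩ := h.odd k ho hk
    exact ⟨α, hα, by simpa only [hr k ho.pos hk] using hO⟩
  · obtain ⟨α, hα, hO⟩ := h.even k he h1 hk
    exact ⟨α, hα, by simpa only [hr k h1 hk] using hO⟩
  · obtain ⟨α, hα, hO⟩ := h.pairs k ho hk
    exact ⟨α, hα, by simpa only [hr k ho.pos (by omega), hr (k + 1) (by omega) hk] using hO⟩

lemma HasAsymptotics.tendsto_div {n : ℕ} {m ζ b : ℕ → ℝ} {x : ℝ → ℕ → ℝ} {l : Filter ℝ}
    (h : HasAsymptotics n m ζ b x l) (hl : Tendsto (fun t : ℝ => |t|) l atTop) {s k : ℕ}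
    (hs : 1 ≤ s) (hk : k = 2 * s - 1 ∨ k = 2 * s) (hkn : k ≤ n) :
    Tendsto (fun t => x t (refl n k) / t) l (𝓝 (2 / ζ s)) := by
  rcases hk with rfl | rfl
  · have h1 := h.odd (2 * s - 1) ⟨s - 1, by omega⟩ hkn
    rw [show (2 * s - 1 + 1) / 2 = s by omega] at h1
    exact ExpSmall.tendsto_div h1 hl
  · have h1 := h.even (2 * s) ⟨s, by ring⟩ (by omega) hkn
    rw [show 2 * s / 2 = s by omega] at h1
    exact ExpSmall.tendsto_div h1 hl

/-- The partial fraction sum does not depend on the order of its terms; this lets the asymptotics be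
applied to the list of nodes in decreasing order. -/
lemma HasSpectralData.reflect {K : ℕ} {m x ζ b : ℕ → ℝ} (h : HasSpectralData K m x ζ b) :
    HasSpectralData K m x (fun j => ζ (refl K j)) fun j => b (refl K j) := by
  refine h.trans (Finset.sum_bij' (fun j _ => refl K j) (fun j _ => refl K j) ?_ ?_ ?_ ?_ ?_)
  · intro j hj; rw [Finset.mem_Icc] at *; unfold refl; omega
  · intro j hj; rw [Finset.mem_Icc] at *; unfold refl; omega
  · intro j hj; rw [Finset.mem_Icc] at hj; exact refl_refl (by omega)
  · intro j hj; rw [Finset.mem_Icc] at hj; exact refl_refl (by omega)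
  · intro j hj; rw [Finset.mem_Icc] at hj; simp only [refl_refl (n := K) (k := j) (by omega)]

end MCH

end

/-! ### The theorem -/

theorem theorem5p4 (K : ℕ) (hK : 1 ≤ K) (m ζ b : ℕ → ℝ)
    (hm : ∀ k, 1 ≤ k → k ≤ 2 * K → 0 < m k)
    (hζ_pos : 0 < ζ 1)
    (hζ_lt : ∀ i j, 1 ≤ i → i < j → j ≤ K → ζ i < ζ j)
    (hb : ∀ j, 1 ≤ j → j ≤ K → 0 < b j)
    (hcond : MCH.MassCondition K m ζ) :
    ∃ x : ℝ → ℕ → ℝ,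
      -- `x` is the global `2K`-peakon solution whose spectral data at time `0` are `ζ`, `b`
      (MCH.IsGlobalMultipeakon (2 * K) m x ∧ MCH.HasSpectralData K m (x 0) ζ b) ∧
      (∀ y : ℝ → ℕ → ℝ, MCH.IsGlobalMultipeakon (2 * K) m y →
        MCH.HasSpectralData K m (y 0) ζ b →
        ∀ t k, 1 ≤ k → k ≤ 2 * K → y t k = x t k) ∧
      -- asymptotic positions and pairing as `t → +∞`
      MCH.HasAsymptotics (2 * K) m ζ b x atTop ∧
      -- the same as `t → -∞`, with `ζ_j`, `b_j` replaced by `ζ_{j*}`, `b_{j*}`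
      MCH.HasAsymptotics (2 * K) m (fun j => ζ (MCH.refl K j)) (fun j => b (MCH.refl K j))
        x atBot ∧
      -- asymptotic speeds, sorted as in the Toda lattice
      (∀ s, 1 ≤ s → s ≤ K → ∀ k, (k = 2 * s - 1 ∨ k = 2 * s) →
        Tendsto (fun t => x t (MCH.refl (2 * K) k) / t) atTop (𝓝 (2 / ζ s)) ∧
        Tendsto (fun t => x t (MCH.refl (2 * K) k) / t) atBot (𝓝 (2 / ζ (MCH.refl K s)))) ∧
      (∀ s r, 1 ≤ s → s < r → r ≤ K →
        2 / ζ r < 2 / ζ s ∧ 2 / ζ (MCH.refl K s) < 2 / ζ (MCH.refl K r)) := by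
  have hrefl : ∀ j ∈ Finset.Icc 1 K, MCH.refl K j ∈ Finset.Icc 1 K := fun j hj => by
    rw [Finset.mem_Icc] at *; unfold MCH.refl; omega
  have hζ := MCH.injOn_of_lt hζ_lt
  have hpos : ∀ j ∈ Finset.Icc 1 K, 0 < ζ j := fun j hj => by
    rw [Finset.mem_Icc] at hj
    rcases hj.1.eq_or_lt with h | h
    · rwa [← h]
    · exact hζ_pos.trans (hζ_lt 1 j le_rfl h hj.2)
  have hb' : ∀ j ∈ Finset.Icc 1 K, 0 < b j := fun j hj => by
    rw [Finset.mem_Icc] at hj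
    exact hb j hj.1 hj.2
  have hζr : Set.InjOn (fun j => ζ (MCH.refl K j)) (Finset.Icc 1 K) := by
    intro i hi j hj h
    have h1 := hζ (Finset.mem_coe.2 (hrefl i hi)) (Finset.mem_coe.2 (hrefl j hj)) h
    rw [Finset.mem_coe, Finset.mem_Icc] at hi hj
    unfold MCH.refl at h1
    omega
  have hspeed : ∀ s r, 1 ≤ s → s < r → r ≤ K →
      2 / ζ r < 2 / ζ s ∧ 2 / ζ (MCH.refl K s) < 2 / ζ (MCH.refl K r) := by
    intro s r hs hsr hr
    have h1 : s ∈ Finset.Icc 1 K := Finset.mem_Icc.2 ⟨hs, by omega⟩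
    have h2 : r ∈ Finset.Icc 1 K := Finset.mem_Icc.2 ⟨by omega, hr⟩
    exact ⟨div_lt_div_of_pos_left two_pos (hpos s h1) (hζ_lt s r hs hsr hr),
      div_lt_div_of_pos_left two_pos (hpos _ (hrefl r h2))
        (hζ_lt _ _ (by unfold MCH.refl; omega) (by unfold MCH.refl; omega)
          (by unfold MCH.refl; omega))⟩
  have hx0 : MCH.residueAt ζ b 0 = b := by funext j; simp [MCH.residueAt]
  have hord := fun t => MCH.position_ordered hm hζ_pos hζ_lt hpos
    (MCH.residueAt_pos (ζ := ζ) hb' t) hcond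
  have htop : MCH.HasAsymptotics (2 * K) m ζ b
      (fun t => MCH.position K m ζ (MCH.residueAt ζ b t)) atTop :=
    MCH.position_hasAsymptotics (σ := 1) hm hζ hpos hb' (by norm_num)
      (tendsto_id.congr fun t => (one_mul t).symm) fun i j hi hij hj => by
        have := (hspeed i j hi hij hj).1
        rw [← mul_one_div 2, ← mul_one_div 2 (ζ i)] at this
        linarith
  have hbot : MCH.HasAsymptotics (2 * K) m (fun j => ζ (MCH.refl K j))
      (fun j => b (MCH.refl K j)) (fun t => MCH.position K m ζ (MCH.residueAt ζ b t)) atBot := by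
    -- For `t → -∞` the slowest rate `2/ζ_K` dominates, so the nodes are listed backwards and `σ =
    -- -1`.
    refine (MCH.position_hasAsymptotics (σ := -1) hm hζr (fun j hj => hpos _ (hrefl j hj))
      (fun j hj => hb' _ (hrefl j hj)) (by norm_num) (by simpa using tendsto_neg_atBot_atTop)
      fun i j hi hij hj => ?_).congr fun t k h1 hk => ?_
    · have := (hspeed i j hi hij hj).2
      rw [← mul_one_div 2, ← mul_one_div 2 (ζ (MCH.refl K j))] at this
      rw [neg_div, neg_div]
      linarith
    -- The positions built from the reversed list have the same Weyl function, hence are the same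
    -- positions.
    · exact (MCH.position_hasSpectralData hm hζr (fun j hj => hpos _ (hrefl j hj))
        (MCH.residueAt_pos (fun j hj => hb' _ (hrefl j hj)) t)).unique hm
        (MCH.position_hasSpectralData hm hζ hpos (MCH.residueAt_pos hb' t)).reflect k h1 hk
  refine ⟨fun t => MCH.position K m ζ (MCH.residueAt ζ b t), ⟨⟨hord, fun t j h1 hj => ?_⟩, ?_⟩,
    fun y hy hy0 t k h1 hk => hy.eq_position hm hζ hpos hb' hy0 t h1 hk, htop, hbot,
    fun s hs hsK k hk => ⟨htop.tendsto_div tendsto_abs_atTop_atTop hs hk (by omega),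
      hbot.tendsto_div tendsto_abs_atBot_atTop hs hk (by omega)⟩, hspeed⟩
  · rw [MCH.peakonField_eq_orderedField (hord t) h1 hj]
    exact MCH.hasDerivAt_position hm hζ hpos hb' t h1 hj
  · dsimp only
    rw [hx0]
    exact MCH.position_hasSpectralData hm hζ hpos hb'
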